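/- Let $\Omega$ be a separable metric space with its Borel $\sigma$-algebra, $\phi_t:\Omega\to\Omega$ ($t\in\mathbb R$) a continuous flow and $\mu$ a $\phi_t$-invariant probability measure on $\Omega$. Let $d\in\mathbb N$, $T>0$, $p\in(3,\infty)$, $\kappa\in(0,1)$. Write $\|v\|_{C^\kappa}=\sup_y|v(y)|+\sup_{y\ne y'}|v(y)-v(y')|/\mathrm{dist}(y,y')^\kappa$ for $v:\Omega\to\mathbb R$ and let $C^\kappa_0(\Omega)$ be the set of $v$ with $\|v\|_{C^\kappa}<\infty$ and $\int_\Omega v\,d\mu=0$. Assume that for all $v,w\in C^\kappa_0(\Omega)$ there is $K>0$ such that, for all $t\ge 0$, $$\Big(\mathbf E_\mu\Big|\int_0^t v\circ\phi_s\,ds\Big|^{2p}\Big)^{1/(2p)}\le K t^{1/2},\qquad \Big(\mathbf E_\mu\Big|\int_0^t\!\int_0^s v\circ\phi_r\; w\circ\phi_s\,dr\,ds\Big|^{p}\Big)^{1/p}\le K t .$$ For a norm $N$ on functions of a second variable, set $$\|u\|_{C^{\alpha};N}=\sum_{|k|\le\lfloor\alpha\rfloor}\sup_x N(D_x^ku(x,\cdot))+\sum_{|k|=\lfloor\alpha\rfloor}\sup_{x\ne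 x'}\frac{N(D_x^ku(x,\cdot)-D_x^ku(x',\cdot))}{|x-x'|^{\alpha-\lfloor\alpha\rfloor}},$$ the second sum being omitted if $\alpha\in\mathbb N$. This gives the norm of $C^{\alpha,\kappa}(\mathbb R^d\times\Omega)$ for $N=\|\cdot\|_{C^\kappa}$, that of $C^\theta(\mathbb R^d)$ when there is no second variable ($N=|\cdot|$), and that of $C^{\theta,\theta}(\mathbb R^d\times\mathbb R^d)$ for $\alpha=\theta$, $N=\|\cdot\|_{C^\theta}$; norms of vector- and matrix-valued functions are the sums of the norms of the entries. Let $\mathcal B=C^\theta(\mathbb R^d,\mathbb R^d)$ and let $\mathcal B\otimes\mathcal B$ be the space of $d\times d$ matrices with entries in $C^\theta(\mathbb R^d)\otimes C^\theta(\mathbb R^d)$, the completion of the algebraic tensor product in the norm of $C^{\theta,\theta}$ (that is, the closure in $C^{\theta,\theta}(\mathbb R^d\times\mathbb R^d)$ of the functions $(x,z)\mapsto\sum_n u_n(x)v_n(z)$, finite sums with $u_n,v_n\in C^\theta(\mathbb R^d)$). Let $\theta>2+\frac{2}{p-1}$ and $\alpha>\theta+\frac dp$, and let $b\in C^{\alpha,\kappa}(\mathbb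 R^d\times\Omega,\mathbb R^d)$ satisfy $\int_\Omega b(x,y)\,d\mu(y)=0$ for all $x$, and $b(x,y)=0$ for all $y$ whenever $|x|>R$, for some $R>0$. For $\varepsilon>0$ and an initial condition $y\in\Omega$ put $y_\varepsilon(t)=\phi_{t\varepsilon^{-2}}(y)$ and, for $t\in[0,T]$, $$W_\varepsilon(t)=\varepsilon^{-1}\int_0^t b(\cdot,y_\varepsilon(r))\,dr,\qquad \mathbb W_\varepsilon(t)=\int_0^tW_\varepsilon\otimes dW_\varepsilon=\varepsilon^{-2}\int_0^t\!\int_0^r b(\cdot,y_\varepsilon(u))\otimes b(\cdot,y_\varepsilon(r))\,du\,dr ,$$ and $\mathbf W_\varepsilon=(W_\varepsilon,\mathbb W_\varepsilon)$. For a path $\mathbf W=(W,\mathbb W)$ in $\mathcal B\times(\mathcal B\otimes\mathcal B)$ write $W(s,t)=W(t)-W(s)$, $\mathbb W(s,t)=\mathbb W(t)-\mathbb W(s)-W(s)\otimes W(s,t)$ and $$|||\mathbf W|||_{\mathcal C^\gamma}=\sup_{s,t\in[0,T],\,s\ne t}\frac{\|W(s,t)\|_{\mathcal B}}{|t-s|^\gamma}+\sup_{s,t\in[0,T],\,s\ne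 t}\frac{\|\mathbb W(s,t)\|_{\mathcal B\otimes\mathcal B}^{1/2}}{|t-s|^\gamma}.$$ Then for every $\gamma\in\left(\frac13,\frac12-\frac1{2p}\right)$: for every $\varepsilon>0$ and every initial condition, $\mathbf W_\varepsilon$ is a $\gamma$-rough path (a continuous path in $\mathcal B\times(\mathcal B\otimes\mathcal B)$ starting at $0$ with $\sup_{s\ne t}\|W_\varepsilon(s,t)\|_{\mathcal B}/|t-s|^{\gamma}<\infty$ and $\sup_{s\ne t}\|\mathbb W_\varepsilon(s,t)\|_{\mathcal B\otimes\mathcal B}/|t-s|^{2\gamma}<\infty$); $|||\mathbf W_\varepsilon|||_{\mathcal C^\gamma}$ is a measurable function of the initial condition; and $$\sup_{\varepsilon>0}\mathbf E_\mu|||\mathbf W_\varepsilon|||_{\mathcal C^\gamma}^{2p}<\infty .$$ -/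

import Mathlib

open MeasureTheory Filter Topology Set
open scoped ENNReal

noncomputable section

/-- The Euclidean space `ℝ^d`. -/
abbrev EucSp (d : ℕ) : Type := EuclideanSpace ℝ (Fin d)

/-- The partial derivative `∂_i u`. -/
def partialD {d : ℕ} (i : Fin d) (u : EucSp d → ℝ) : EucSp d → ℝ :=
  fun x => lineDeriv ℝ u x (EuclideanSpace.single i 1)

/-- The multi-index derivative `D^k u = ∂_0^{k_0} ⋯ ∂_{d-1}^{k_{d-1}} u`. -/
def multiD {d : ℕ} (k : Fin d → ℕ) (u : EucSp d → ℝ) : EucSp d → ℝ :=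
  (List.finRange d).foldr (fun i v => (partialD i)^[k i] v) u

/-- The multi-indices `k` with `|k| = n`. -/
def multiIdx (d n : ℕ) : Finset (Fin d → ℕ) := Finset.piAntidiag Finset.univ n

/-! ### Hölder norms (with values in `[0, ∞]`) -/

/-- The Hölder norm `‖v‖_{C^κ} = sup |v| + sup_{y ≠ y'} |v y - v y'| / dist(y, y')^κ`
of a real function on a metric space. -/
def holderNormM {Ω : Type*} [MetricSpace Ω] (κ : ℝ) (v : Ω → ℝ) : ℝ≥0∞ :=
  (⨆ y, ‖v y‖ₑ) +
    ⨆ (y) (y') (_ : y ≠ y'), ‖v y - v y'‖ₑ / ENNReal.ofReal (dist y y' ^ κ)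

/-- The Hölder norm of a function `u : ℝ^d × Y → ℝ`, of order `α` in the first variable and
measured by the norm `N` in the second one:
`∑_{|k| ≤ ⌊α⌋} sup_x N(D^k u(x,·))
  + ∑_{|k| = ⌊α⌋} sup_{x ≠ x'} N(D^k u(x,·) - D^k u(x',·)) / |x - x'|^{α - ⌊α⌋}`,
where the second sum is omitted if `α` is an integer. Derivatives are in the first variable. -/
def mixedNorm {d : ℕ} {Y : Type*} (N : (Y → ℝ) → ℝ≥0∞) (α : ℝ)
    (u : EucSp d → Y → ℝ) : ℝ≥0∞ :=
  (∑ n ∈ Finset.range (⌊α⌋₊ + 1), ∑ k ∈ multiIdx d n,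
      ⨆ x, N (fun y => multiD k (fun x => u x y) x)) +
    if (⌊α⌋₊ : ℝ) = α then 0 else
      ∑ k ∈ multiIdx d ⌊α⌋₊, ⨆ (x) (x') (_ : x ≠ x'),
        N (fun y => multiD k (fun x => u x y) x - multiD k (fun x => u x y) x') /
          ENNReal.ofReal (‖x - x'‖ ^ (α - ⌊α⌋₊))

/-- The Hölder norm `‖u‖_{C^θ}` of a scalar function on `ℝ^d`. -/
def holderNorm {d : ℕ} (θ : ℝ) (u : EucSp d → ℝ) : ℝ≥0∞ :=
  (∑ n ∈ Finset.range (⌊θ⌋₊ + 1), ∑ k ∈ multiIdx d n, ⨆ x, ‖multiD k u x‖ₑ) +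
    if (⌊θ⌋₊ : ℝ) = θ then 0 else
      ∑ k ∈ multiIdx d ⌊θ⌋₊, ⨆ (x) (x') (_ : x ≠ x'),
        ‖multiD k u x - multiD k u x'‖ₑ / ENNReal.ofReal (‖x - x'‖ ^ (θ - ⌊θ⌋₊))

/-- `u ∈ C^θ(ℝ^d)`. -/
def MemHolderSp {d : ℕ} (θ : ℝ) (u : EucSp d → ℝ) : Prop :=
  ContDiff ℝ (⌊θ⌋₊ : ℕ) u ∧ holderNorm θ u < ∞

/-- The norm of `C^θ(ℝ^d, ℝ^d)`: the sum of the norms of the components. -/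
def holderNormVec {d : ℕ} (θ : ℝ) (u : EucSp d → EucSp d) : ℝ≥0∞ :=
  ∑ i, holderNorm θ (fun x => u x i)

/-- `u ∈ C^θ(ℝ^d, ℝ^d)`. -/
def MemHolderVec {d : ℕ} (θ : ℝ) (u : EucSp d → EucSp d) : Prop :=
  ∀ i, MemHolderSp θ (fun x => u x i)

/-- `b ∈ C^{α,κ}(ℝ^d × Ω, ℝ^d)`. -/
def MemMixedHolder {d : ℕ} {Ω : Type*} [MetricSpace Ω] (α κ : ℝ)
    (b : EucSp d → Ω → EucSp d) : Prop :=
  ∀ i, (∀ y, ContDiff ℝ (⌊α⌋₊ : ℕ) (fun x => b x y i)) ∧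
    mixedNorm (holderNormM κ) α (fun x y => b x y i) < ∞

/-! ### The tensor product of Hölder spaces -/

/-- The norm of `C^{θ,θ}(ℝ^d × ℝ^d)`. -/
def holderNorm₂ {d : ℕ} (θ : ℝ) (U : EucSp d → EucSp d → ℝ) : ℝ≥0∞ :=
  mixedNorm (holderNorm θ) θ U

/-- `U ∈ C^{θ,θ}(ℝ^d × ℝ^d)`: the derivatives `D_x^k D_z^l U` of orders `|k|, |l| ≤ ⌊θ⌋` exist
and the norm is finite. -/
def MemHolderSp₂ {d : ℕ} (θ : ℝ) (U : EucSp d → EucSp d → ℝ) : Prop :=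
  Continuous (fun q : EucSp d × EucSp d => U q.1 q.2) ∧
  (∀ z, ContDiff ℝ (⌊θ⌋₊ : ℕ) (fun x => U x z)) ∧
  (∀ n ≤ ⌊θ⌋₊, ∀ k ∈ multiIdx d n, ∀ x,
    ContDiff ℝ (⌊θ⌋₊ : ℕ) (fun z => multiD k (fun x => U x z) x)) ∧
  holderNorm₂ θ U < ∞

/-- `U` is (the image in `C^{θ,θ}` of) an element `∑_n u_n ⊗ v_n` of the algebraic tensor product
of `C^θ(ℝ^d)` with itself. -/
def IsAlgTensor {d : ℕ} (θ : ℝ) (U : EucSp d → EucSp d → ℝ) : Prop :=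
  ∃ (m : ℕ) (u v : Fin m → EucSp d → ℝ),
    (∀ n, MemHolderSp θ (u n)) ∧ (∀ n, MemHolderSp θ (v n)) ∧
      ∀ x z, U x z = ∑ n, u n x * v n z

/-- `U ∈ C^θ(ℝ^d) ⊗ C^θ(ℝ^d)`. The completion of the algebraic tensor product in the norm of
`C^{θ,θ}` is realised as its closure in the Banach space `C^{θ,θ}(ℝ^d × ℝ^d)`. -/
def MemTensor {d : ℕ} (θ : ℝ) (U : EucSp d → EucSp d → ℝ) : Prop :=
  MemHolderSp₂ θ U ∧
    ∀ δ : ℝ≥0∞, 0 < δ → ∃ A, IsAlgTensor θ A ∧ holderNorm₂ θ (fun x z => U x z - A x z) < δ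

/-- The norm of `C^θ(ℝ^d, ℝ^d) ⊗ C^θ(ℝ^d, ℝ^d)`, the space of `d × d` matrices with entries in
`C^θ(ℝ^d) ⊗ C^θ(ℝ^d)`: the sum of the norms of the entries. -/
def tensorNorm {d : ℕ} (θ : ℝ) (U : Fin d → Fin d → EucSp d → EucSp d → ℝ) : ℝ≥0∞ :=
  ∑ i, ∑ j, holderNorm₂ θ (U i j)

/-! ### Rough paths in `C^θ(ℝ^d, ℝ^d)` -/

/-- The increment `W(s,t) = W(t) - W(s)`. -/
def incr {d : ℕ} (W : ℝ → EucSp d → EucSp d) (s t : ℝ) : EucSp d → EucSp d :=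
  fun x => W t x - W s x

/-- The second order increment `𝕎(s,t) = 𝕎(t) - 𝕎(s) - W(s) ⊗ W(s,t)`. -/
def incr₂ {d : ℕ} (W : ℝ → EucSp d → EucSp d)
    (WW : ℝ → Fin d → Fin d → EucSp d → EucSp d → ℝ) (s t : ℝ) :
    Fin d → Fin d → EucSp d → EucSp d → ℝ :=
  fun i j x z => WW t i j x z - WW s i j x z - W s x i * incr W s t z j

/-- `sup_{s,t ∈ [0,T]} ‖W(s,t)‖ / |t - s|^γ`. -/
def roughSup₁ {d : ℕ} (θ γ T : ℝ) (W : ℝ → EucSp d → EucSp d) : ℝ≥0∞ :=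
  ⨆ (s ∈ Icc 0 T) (t ∈ Icc 0 T) (_ : s ≠ t),
    holderNormVec θ (incr W s t) / ENNReal.ofReal (|t - s| ^ γ)

/-- `sup_{s,t ∈ [0,T]} ‖𝕎(s,t)‖ / |t - s|^{2γ}`. -/
def roughSup₂ {d : ℕ} (θ γ T : ℝ) (W : ℝ → EucSp d → EucSp d)
    (WW : ℝ → Fin d → Fin d → EucSp d → EucSp d → ℝ) : ℝ≥0∞ :=
  ⨆ (s ∈ Icc 0 T) (t ∈ Icc 0 T) (_ : s ≠ t),
    tensorNorm θ (incr₂ W WW s t) / ENNReal.ofReal (|t - s| ^ (2 * γ))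

/-- `(W, 𝕎) ∈ 𝒞^γ(C^θ(ℝ^d, ℝ^d))`: a `γ`-rough path on `[0,T]`. -/
def IsRoughPath {d : ℕ} (θ γ T : ℝ) (W : ℝ → EucSp d → EucSp d)
    (WW : ℝ → Fin d → Fin d → EucSp d → EucSp d → ℝ) : Prop :=
  (∀ t ∈ Icc 0 T, MemHolderVec θ (W t) ∧ ∀ i j, MemTensor θ (WW t i j)) ∧
  (∀ t ∈ Icc 0 T, Tendsto (fun s => holderNormVec θ (fun x => W s x - W t x))
    (𝓝[Icc 0 T] t) (𝓝 0)) ∧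
  (∀ t ∈ Icc 0 T, Tendsto (fun s => tensorNorm θ (fun i j x z => WW s i j x z - WW t i j x z))
    (𝓝[Icc 0 T] t) (𝓝 0)) ∧
  W 0 = 0 ∧ WW 0 = 0 ∧ roughSup₁ θ γ T W < ∞ ∧ roughSup₂ θ γ T W WW < ∞

/-- The norm-like object
`|||(W,𝕎)|||_{𝒞^γ} = sup_{s,t} ‖W(s,t)‖ / |t-s|^γ + sup_{s,t} ‖𝕎(s,t)‖^{1/2} / |t-s|^γ`. -/
def roughNorm {d : ℕ} (θ γ T : ℝ) (W : ℝ → EucSp d → EucSp d)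
    (WW : ℝ → Fin d → Fin d → EucSp d → EucSp d → ℝ) : ℝ≥0∞ :=
  roughSup₁ θ γ T W +
    ⨆ (s ∈ Icc 0 T) (t ∈ Icc 0 T) (_ : s ≠ t),
      tensorNorm θ (incr₂ W WW s t) ^ (1 / 2 : ℝ) / ENNReal.ofReal (|t - s| ^ γ)

/-! ### The fast flow -/

/-- `v ∈ C^κ_0(Ω)`: Hölder observables of mean zero. -/
def MemHolderZero {Ω : Type*} [MetricSpace Ω] [MeasurableSpace Ω] (μ : Measure Ω) (κ : ℝ)
    (v : Ω → ℝ) : Prop :=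
  holderNormM κ v < ∞ ∧ ∫ y, v y ∂μ = 0

/-- The moment assumption on the fast flow: for all `v, w ∈ C^κ_0(Ω)` there is `K` with
`‖v_t‖_{L^{2p}(μ)} ≤ K t^{1/2}` and `‖S_t‖_{L^p(μ)} ≤ K t` for all `t ≥ 0`, where
`v_t = ∫_0^t v ∘ φ_s ds` and `S_t = ∫_0^t ∫_0^s v ∘ φ_r w ∘ φ_s dr ds`. -/
def FlowMoments {Ω : Type*} [MetricSpace Ω] [MeasurableSpace Ω] (φ : Flow ℝ Ω)
    (μ : Measure Ω) (κ p : ℝ) : Prop :=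
  ∀ v w : Ω → ℝ, MemHolderZero μ κ v → MemHolderZero μ κ w →
    ∃ K : ℝ, 0 < K ∧ ∀ t : ℝ, 0 ≤ t →
      eLpNorm (fun y => ∫ s in (0 : ℝ)..t, v (φ s y)) (ENNReal.ofReal (2 * p)) μ
        ≤ ENNReal.ofReal (K * t ^ (1 / 2 : ℝ)) ∧
      eLpNorm (fun y => ∫ s in (0 : ℝ)..t, ∫ r in (0 : ℝ)..s, v (φ r y) * w (φ s y))
        (ENNReal.ofReal p) μ ≤ ENNReal.ofReal (K * t)

/-- The rescaled fast trajectory `y_ε(t) = φ_{t ε^{-2}} y`. -/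
def fastTraj {Ω : Type*} [MetricSpace Ω] (φ : Flow ℝ Ω) (ε : ℝ) (y : Ω) (t : ℝ) : Ω :=
  φ (t / ε ^ 2) y

/-- `W_ε(t) = ε^{-1} ∫_0^t b(·, y_ε(r)) dr`. -/
def pathW {d : ℕ} {Ω : Type*} [MetricSpace Ω] (φ : Flow ℝ Ω) (b : EucSp d → Ω → EucSp d)
    (ε : ℝ) (y : Ω) (t : ℝ) : EucSp d → EucSp d :=
  fun x => ε⁻¹ • ∫ r in (0 : ℝ)..t, b x (fastTraj φ ε y r)

/-- `𝕎_ε(t) = ε^{-2} ∫_0^t ∫_0^r b(·, y_ε(u)) ⊗ b(·, y_ε(r)) du dr`. -/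
def pathWW {d : ℕ} {Ω : Type*} [MetricSpace Ω] (φ : Flow ℝ Ω) (b : EucSp d → Ω → EucSp d)
    (ε : ℝ) (y : Ω) (t : ℝ) : Fin d → Fin d → EucSp d → EucSp d → ℝ :=
  fun i j x z => (ε ^ 2)⁻¹ * ∫ r in (0 : ℝ)..t, ∫ u in (0 : ℝ)..r,
    b x (fastTraj φ ε y u) i * b z (fastTraj φ ε y r) j

end

/-! For fixed `ε` the driving velocity is bounded in `C^θ`, so the path is Lipschitz in time and its
iterated integral is quadratic in `|t - s|`. This gives the qualitative rough path property, with
constants that explode as `ε → 0` (`IsLift.isRoughPath`). Measurability holds because every Hölder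
norm involved is a supremum of quantities continuous in the initial condition, hence lower
semicontinuous. The uniform moment bound rests on four ingredients.

Uniformity in the observable. The flow hypothesis gives a constant for each pair of observables.
Baire's theorem on the unit ball of `C^κ_0`, complete in the sup metric, makes the constant uniform
over that ball (`exists_uniform_bound_of_pointwise`, `FlowMoments.exists_uniform`). Stationarity and
the diffusive scaling then turn it into a bound by `(t - s)^p`, free of `ε` and homogeneous in the
size of the observables (`FlowMoments.exists_fast`).

From points to function norms. Expectations commute with integrals and sums but not with suprema, so
the norm of `C^θ` is dominated by a Besov norm: `‖f‖^q ≤ C ∑ 2^{θ' q n} ∫ |Q_n f - Q_{n-1} f|^q`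
when `θ + d/q < θ'`, where `Q_n` is a combination of mollifications at scale `2⁻ⁿ`
(`exists_enorm_ev_rpow_le`). The combination is chosen so that `f - Q_n f` averages finite
differences of high order. Therefore the `n`-th block of a `C^α` function is `O(2^{-αn})`
(`exists_abs_qblock_le`). Applied to `b`, this says that the `n`-th block at a point `x` is a mean
zero `κ`-Hölder observable of size `O(2^{-αn})` (`MixedBound.exists_holderBall_qblock`). Since
blocks commute with time integration, the block of `W_ε` is the time integral of that observable and
the first ingredient applies; the sum over `n` converges because `α > θ + d/p`. For the iterated
integral, blocks are taken in each of the two space variables, and the result is again an iterated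
integral of two scalar observables (`qblock_pathInt₂`).

A subadditive size. By Chen's relation, the maximum of `‖W(s,t)‖` and `(2 ‖𝕎(s,t)‖)^{1/2}` satisfies
the triangle inequality along the path (`roughSize_add_le`). Both levels of the rough path are
thereby controlled by one pseudo-metric on `[0,T]`.

Kolmogorov in time. Dyadic chaining bounds the `γ`-Hölder constant of a pseudo-metric by a weighted
sum over dyadic increments (`exists_chaining_bound`). In expectation, level `k` contributes `2^k ·
2^{2pγk} · 2^{-pk}`, which is summable exactly when `γ < 1/2 - 1/(2p)`
(`exists_lintegral_roughNorm_le`). -/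

noncomputable section

/-! ### Partial derivatives along words, and their relation to multi-index derivatives. -/

/-- Iterated partial derivatives along a list of coordinates. -/
def listD {d : ℕ} (L : List (Fin d)) (u : EucSp d → ℝ) : EucSp d → ℝ :=
  L.foldr partialD u

section ListD

variable {d : ℕ}

@[simp] lemma listD_nil (u : EucSp d → ℝ) : listD [] u = u := rfl

lemma listD_cons (i : Fin d) (L : List (Fin d)) (u : EucSp d → ℝ) :
    listD (i :: L) u = partialD i (listD L u) := rfl

lemma listD_append (L L' : List (Fin d)) (u : EucSp d → ℝ) :
    listD (L ++ L') u = listD L (listD L' u) := by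
  simp [listD, List.foldr_append]

lemma listD_concat (L : List (Fin d)) (i : Fin d) (u : EucSp d → ℝ) :
    listD (L ++ [i]) u = listD L (partialD i u) := by
  simp [listD]

lemma partialD_const_mul (i : Fin d) (c : ℝ) (u : EucSp d → ℝ) :
    partialD i (fun x => c * u x) = fun x => c * partialD i u x := by
  funext x
  simp only [partialD, lineDeriv]
  exact deriv_const_mul_field (v := fun t => u (x + t • EuclideanSpace.single i 1)) c

lemma listD_const_mul (L : List (Fin d)) (c : ℝ) (u : EucSp d → ℝ) :
    listD L (fun x => c * u x) = fun x => c * listD L u x := by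
  induction L with
  | nil => rfl
  | cons i L ih => rw [listD_cons, ih, partialD_const_mul, listD_cons]

lemma partialD_eq_fderiv {u : EucSp d → ℝ} {x : EucSp d} (hu : DifferentiableAt ℝ u x)
    (i : Fin d) : partialD i u x = fderiv ℝ u x (EuclideanSpace.single i 1) :=
  hu.lineDeriv_eq_fderiv

lemma ContDiff.partialD {n : ℕ} {u : EucSp d → ℝ} (hu : ContDiff ℝ (n + 1 : ℕ) u) (i : Fin d) :
    ContDiff ℝ n (partialD i u) := by
  have h1 : ∀ x, DifferentiableAt ℝ u x := fun x =>
    (hu.differentiable (by simp)).differentiableAt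
  have : _root_.partialD i u = fun x => fderiv ℝ u x (EuclideanSpace.single i 1) := by
    funext x; exact partialD_eq_fderiv (h1 x) i
  rw [this]
  exact (hu.fderiv_right (by norm_cast)).clm_apply contDiff_const

lemma ContDiff.listD {n : ℕ} {u : EucSp d → ℝ} :
    ∀ (L : List (Fin d)), ContDiff ℝ (n + L.length : ℕ) u → ContDiff ℝ n (listD L u)
  | [], hu => by simpa using hu
  | i :: L, hu => by
    rw [listD_cons]
    apply ContDiff.partialD
    apply ContDiff.listD L
    convert hu using 2
    simp; ring

lemma continuous_listD {n : ℕ} {u : EucSp d → ℝ} (hu : ContDiff ℝ n u) {L : List (Fin d)}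
    (hL : L.length ≤ n) : Continuous (listD L u) := by
  have : ContDiff ℝ (0 : ℕ) (listD L u) :=
    ContDiff.listD L (hu.of_le (by simpa using hL))
  exact this.continuous

lemma partialD_add {u v : EucSp d → ℝ} (hu : Differentiable ℝ u) (hv : Differentiable ℝ v)
    (i : Fin d) : partialD i (fun x => u x + v x) = fun x => partialD i u x + partialD i v x := by
  funext x
  rw [partialD_eq_fderiv ((hu x).fun_add (hv x)), partialD_eq_fderiv (hu x),
    partialD_eq_fderiv (hv x), fderiv_fun_add (hu x) (hv x)]
  rfl

lemma listD_add {u v : EucSp d → ℝ} :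
    ∀ (L : List (Fin d)), ContDiff ℝ L.length u → ContDiff ℝ L.length v →
      listD L (fun x => u x + v x) = fun x => listD L u x + listD L v x
  | [], _, _ => rfl
  | i :: L, hu, hv => by
    have hu' : ContDiff ℝ (1 + L.length : ℕ) u := by rwa [add_comm]
    have hv' : ContDiff ℝ (1 + L.length : ℕ) v := by rwa [add_comm]
    rw [listD_cons, listD_add L (hu.of_le (by simp)) (hv.of_le (by simp)), partialD_add]
    · rfl
    · exact (ContDiff.listD L hu').differentiable (by simp)
    · exact (ContDiff.listD L hv').differentiable (by simp)

lemma listD_sub {u v : EucSp d → ℝ} (L : List (Fin d)) (hu : ContDiff ℝ L.length u)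
    (hv : ContDiff ℝ L.length v) :
    listD L (fun x => u x - v x) = fun x => listD L u x - listD L v x := by
  have := listD_add L hu (contDiff_const.mul hv : ContDiff ℝ L.length fun x => (-1 : ℝ) * v x)
  rw [listD_const_mul] at this
  simpa [sub_eq_add_neg] using this

lemma listD_comp_add_right (L : List (Fin d)) (u : EucSp d → ℝ) (h : EucSp d) :
    listD L (fun x => u (x + h)) = fun x => listD L u (x + h) := by
  induction L with
  | nil => rfl
  | cons i L ih =>
    rw [listD_cons, ih]
    funext x
    simp only [listD_cons, partialD, lineDeriv]
    congr 1
    funext t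
    congr 1
    abel

lemma partialD_comp_smul {c : ℝ} (u : EucSp d → ℝ) (hu : Differentiable ℝ u) (i : Fin d) :
    partialD i (fun x => u (c • x)) = fun x => c * partialD i u (c • x) := by
  funext x
  have h1 : HasFDerivAt (fun x : EucSp d => c • x) (c • ContinuousLinearMap.id ℝ (EucSp d)) x :=
    (hasFDerivAt_id x).const_smul c
  have h2 := (hu (c • x)).hasFDerivAt.comp x h1
  rw [partialD_eq_fderiv (hu _)]
  have h3 : HasFDerivAt (fun x => u (c • x)) _ x := h2
  rw [partialD_eq_fderiv h3.differentiableAt, h3.fderiv]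
  simp

lemma listD_comp_smul {c : ℝ} {u : EucSp d → ℝ} :
    ∀ (L : List (Fin d)), ContDiff ℝ L.length u →
      listD L (fun x => u (c • x)) = fun x => c ^ L.length * listD L u (c • x)
  | [], _ => by simp
  | i :: L, hu => by
    have hu' : ContDiff ℝ (1 + L.length : ℕ) u := by rwa [add_comm]
    rw [listD_cons, listD_comp_smul L (hu.of_le (by simp)), partialD_const_mul,
      partialD_comp_smul _ ((ContDiff.listD L hu').differentiable (by simp))]
    funext x
    simp [listD_cons]
    ring

/-! ### Commutation of partial derivatives -/

lemma partialD_comm {u : EucSp d → ℝ} (hu : ContDiff ℝ 2 u) (i j : Fin d) :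
    partialD i (partialD j u) = partialD j (partialD i u) := by
  have hd : Differentiable ℝ u := hu.differentiable (by simp)
  have key : ∀ i : Fin d, partialD i u = fun x => fderiv ℝ u x (EuclideanSpace.single i 1) := by
    intro i; funext x; exact partialD_eq_fderiv (hd x) i
  have hdd : ∀ x, DifferentiableAt ℝ (fderiv ℝ u) x := fun x =>
    ((hu.fderiv_right (m := 1) (by norm_cast)).differentiable (by simp)) x
  have key2 : ∀ i j : Fin d, ∀ x, partialD i (partialD j u) x =
      fderiv ℝ (fderiv ℝ u) x (EuclideanSpace.single i 1) (EuclideanSpace.single j 1) := by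
    intro i j x
    have h : HasFDerivAt (fun x => fderiv ℝ u x (EuclideanSpace.single j 1))
        ((fderiv ℝ (fderiv ℝ u) x).flip (EuclideanSpace.single j 1)) x := by
      simpa using (hdd x).hasFDerivAt.clm_apply (hasFDerivAt_const (EuclideanSpace.single j 1) x)
    rw [key j, partialD_eq_fderiv h.differentiableAt, h.fderiv]
    simp
  funext x
  rw [key2, key2]
  exact (hu.contDiffAt.isSymmSndFDerivAt (by simp)).eq _ _

/-- By induction on the permutation, with symmetry of the second derivative in the swap case. The
derivatives taken before the swap leave a `C²` function, so regularity equal to the length of the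
word is enough. -/
lemma listD_perm {L L' : List (Fin d)} (h : L.Perm L') :
    ∀ {u : EucSp d → ℝ}, ContDiff ℝ L.length u → listD L u = listD L' u := by
  induction h with
  | nil => intros; rfl
  | cons i _ ih =>
    intro u hu
    rw [listD_cons, listD_cons, ih (hu.of_le (by simp))]
  | swap i j L =>
    intro u hu
    simp only [listD_cons]
    rw [partialD_comm]
    apply ContDiff.listD (n := 2) L
    convert hu using 2
    simp; ring
  | trans h1 _ ih1 ih2 =>
    intro u hu
    rw [ih1 hu, ih2 (by rwa [← h1.length_eq])]

/-- The sorted list of coordinates belonging to a multi-index. -/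
def idxList (k : Fin d → ℕ) : List (Fin d) :=
  (List.finRange d).flatMap fun i => List.replicate (k i) i

lemma multiD_eq_listD (k : Fin d → ℕ) (u : EucSp d → ℝ) : multiD k u = listD (idxList k) u := by
  unfold multiD idxList
  induction List.finRange d with
  | nil => rfl
  | cons i l ih =>
    rw [List.foldr_cons, List.flatMap_cons, listD_append, ← ih]
    generalize k i = n
    induction n with
    | zero => rfl
    | succ n ihn => rw [Function.iterate_succ_apply', ihn, List.replicate_succ, listD_cons]

lemma count_idxList (k : Fin d → ℕ) (i : Fin d) : (idxList k).count i = k i := by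
  unfold idxList
  rw [List.count_flatMap]
  have h1 : ((List.finRange d).map (List.count i ∘ fun j => List.replicate (k j) j)).sum
      = ∑ j, (if j = i then k j else 0) := by
    rw [← List.ofFn_id, List.map_ofFn, List.sum_ofFn]
    refine Finset.sum_congr rfl fun j _ => ?_
    simp [List.count_replicate]
  rw [h1]; simp

lemma length_idxList (k : Fin d → ℕ) : (idxList k).length = ∑ i, k i := by
  unfold idxList
  rw [List.length_flatMap, ← List.ofFn_id, List.map_ofFn, List.sum_ofFn]
  simp

lemma length_idxList_of_mem {n : ℕ} {k : Fin d → ℕ} (hk : k ∈ multiIdx d n) :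
    (idxList k).length = n := by
  rw [length_idxList]
  simpa [multiIdx] using hk

lemma exists_multiIdx_perm (L : List (Fin d)) :
    ∃ k ∈ multiIdx d L.length, L.Perm (idxList k) := by
  refine ⟨fun i => L.count i, ?_, ?_⟩
  · have := Multiset.sum_count_eq_card (s := Finset.univ) (m := (L : Multiset (Fin d))) (by simp)
    simpa [multiIdx] using this
  · rw [List.perm_iff_count]
    intro i
    rw [count_idxList]

/-- Transfers bounds stated with multi-indices to arbitrary words. Words suit inductions better,
since a derivative can be split off at either end. -/
lemma exists_listD_eq_multiD (L : List (Fin d)) :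
    ∃ k ∈ multiIdx d L.length, ∀ u : EucSp d → ℝ, ContDiff ℝ L.length u →
      listD L u = multiD k u := by
  obtain ⟨k, hk, hp⟩ := exists_multiIdx_perm L
  exact ⟨k, hk, fun u hu => by rw [multiD_eq_listD, listD_perm hp hu]⟩

lemma fderiv_eq_sum_partialD {u : EucSp d → ℝ} {x : EucSp d} (hu : DifferentiableAt ℝ u x) :
    fderiv ℝ u x = ∑ i, partialD i u x • (EuclideanSpace.proj i : EucSp d →L[ℝ] ℝ) := by
  ext v
  have hv : v = ∑ i, v i • EuclideanSpace.single i (1 : ℝ) := by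
    ext j; simp [Pi.single_apply]
  conv_lhs => rw [hv]
  rw [map_sum]
  simp only [map_smul, smul_eq_mul, sum_apply, smul_apply]
  refine Finset.sum_congr rfl fun i _ => ?_
  rw [partialD_eq_fderiv hu]
  simp [mul_comm]

lemma norm_fderiv_le_sum_partialD {u : EucSp d → ℝ} {x : EucSp d} (hu : DifferentiableAt ℝ u x) :
    ‖fderiv ℝ u x‖ ≤ ∑ i, |partialD i u x| := by
  rw [fderiv_eq_sum_partialD hu]
  refine (norm_sum_le _ _).trans (Finset.sum_le_sum fun i _ => ?_)
  rw [norm_smul, Real.norm_eq_abs]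
  refine mul_le_of_le_one_right (abs_nonneg _) ?_
  refine ContinuousLinearMap.opNorm_le_bound _ zero_le_one fun v => ?_
  simpa using EuclideanSpace.norm_eq v ▸ (PiLp.norm_apply_le v i)

lemma contDiff_succ_of_partialD {n : ℕ} {u : EucSp d → ℝ} (hu : Differentiable ℝ u)
    (h : ∀ i, ContDiff ℝ n (partialD i u)) : ContDiff ℝ (n + 1 : ℕ) u := by
  have : ContDiff ℝ ((n : WithTop ℕ∞) + 1) u := by
    rw [contDiff_succ_iff_fderiv]
    refine ⟨hu, by simp, ?_⟩
    have : fderiv ℝ u = fun x =>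
        ∑ i, partialD i u x • (EuclideanSpace.proj i : EucSp d →L[ℝ] ℝ) := by
      funext x; exact fderiv_eq_sum_partialD (hu x)
    rw [this]
    exact ContDiff.sum fun i _ => (h i).smul contDiff_const
  exact_mod_cast this

end ListD
end

noncomputable section

/-! ### Families of smooth functions and integration over a parameter. -/

section ParametricIntegral

variable {X Y F : Type*} [TopologicalSpace X] [TopologicalSpace Y] [MeasurableSpace Y]
  [OpensMeasurableSpace Y] [SecondCountableTopology Y] [NormedAddCommGroup F] [NormedSpace ℝ F]

/-- Joint continuity of an integral over a compact set, without local compactness of the parameter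
space. -/
lemma continuous_setIntegral_of_compact [FirstCountableTopology X] {ν : Measure Y}
    [IsFiniteMeasureOnCompacts ν] {f : X → Y → F} (hf : Continuous f.uncurry) {S : Set Y}
    (hS : IsCompact S) (hSm : MeasurableSet S) : Continuous fun x => ∫ y in S, f x y ∂ν := by
  rw [continuous_iff_continuousAt]
  intro x₀
  obtain ⟨M, hM⟩ := (hS.image (f := f x₀) (by fun_prop)).isBounded.exists_norm_le
  have hopen : IsOpen {z : X × Y | ‖f.uncurry z‖ < M + 1} :=
    isOpen_lt hf.norm continuous_const
  -- The tube lemma turns the bound `M` on `S` at `x₀` into the bound `M + 1` on `S` for all nearby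
  -- `x`, which is the dominating constant.
  obtain ⟨V, W, hV, -, hxV, hSW, hVW⟩ := generalized_tube_lemma (isCompact_singleton (x := x₀))
    hS hopen (by
      rintro ⟨x, y⟩ ⟨hx, hy⟩
      obtain rfl : x = x₀ := hx
      have := hM _ (mem_image_of_mem _ hy)
      show ‖f x y‖ < M + 1
      linarith)
  have : IsFiniteMeasure (ν.restrict S) := ⟨by simpa using hS.measure_lt_top⟩
  apply continuousAt_of_dominated (bound := fun _ => M + 1)
  · filter_upwards with x
    exact Continuous.aestronglyMeasurable (by fun_prop)
  · filter_upwards [hV.mem_nhds (hxV rfl)] with x hx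
    rw [ae_restrict_iff' hSm]
    filter_upwards with y hy
    exact (show ‖f x y‖ < M + 1 from hVW (mk_mem_prod hx (hSW hy))).le
  · exact integrable_const _
  · filter_upwards with y
    fun_prop

end ParametricIntegral

section NiceFam

variable {d : ℕ} {P P' : Type*} [TopologicalSpace P] [TopologicalSpace P'] {m : ℕ}

/-- A family of `C^m` functions whose derivatives up to order `m` depend continuously on the
parameter and the point. -/
structure NiceFam (m : ℕ) (f : P → EucSp d → ℝ) : Prop where
  contDiff : ∀ q, ContDiff ℝ m (f q)
  continuous : ∀ L : List (Fin d), L.length ≤ m → Continuous fun z : P × EucSp d => listD L (f z.1) z.2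

namespace NiceFam

lemma mono {n : ℕ} {f : P → EucSp d → ℝ} (hf : NiceFam m f) (h : n ≤ m) : NiceFam n f :=
  ⟨fun q => (hf.contDiff q).of_le (by exact_mod_cast h), fun L hL => hf.continuous L (hL.trans h)⟩

lemma comp {f : P → EucSp d → ℝ} (hf : NiceFam m f) {g : P' → P} (hg : Continuous g) :
    NiceFam m fun q => f (g q) :=
  ⟨fun q => hf.contDiff (g q), fun L hL => (hf.continuous L hL).comp
    (by fun_prop : Continuous fun z : P' × EucSp d => (g z.1, z.2))⟩

lemma const_mul {f : P → EucSp d → ℝ} (hf : NiceFam m f) {c : P → ℝ} (hc : Continuous c) :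
    NiceFam m fun q x => c q * f q x :=
  ⟨fun q => contDiff_const.mul (hf.contDiff q), fun L hL => by
    simp only [listD_const_mul]
    exact (by fun_prop : Continuous fun z : P × EucSp d => c z.1).mul (hf.continuous L hL)⟩

lemma mul_const {f : P → EucSp d → ℝ} (hf : NiceFam m f) {c : P → ℝ} (hc : Continuous c) :
    NiceFam m fun q x => f q x * c q := by
  simpa only [mul_comm] using hf.const_mul hc

lemma add {f g : P → EucSp d → ℝ} (hf : NiceFam m f) (hg : NiceFam m g) :
    NiceFam m fun q x => f q x + g q x :=
  ⟨fun q => (hf.contDiff q).add (hg.contDiff q), fun L hL => by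
    have h : (L.length : WithTop ℕ∞) ≤ m := by exact_mod_cast hL
    simp only [fun q => listD_add L ((hf.contDiff q).of_le h) ((hg.contDiff q).of_le h)]
    exact (hf.continuous L hL).add (hg.continuous L hL)⟩

lemma sub {f g : P → EucSp d → ℝ} (hf : NiceFam m f) (hg : NiceFam m g) :
    NiceFam m fun q x => f q x - g q x := by
  simpa [sub_eq_add_neg] using hf.add (hg.const_mul (c := fun _ => -1) continuous_const)

lemma partialD {f : P → EucSp d → ℝ} (hf : NiceFam (m + 1) f) (i : Fin d) :
    NiceFam m fun q => partialD i (f q) :=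
  ⟨fun q => (hf.contDiff q).partialD i, fun L hL => by
    simpa [listD_concat] using hf.continuous (L ++ [i]) (by simpa using hL)⟩

lemma of_contDiff {f : EucSp d → ℝ} (hf : ContDiff ℝ m f) : NiceFam m fun _ : P => f :=
  ⟨fun _ => hf, fun _ hL => (continuous_listD hf hL).comp continuous_snd⟩

lemma continuous_uncurry {f : P → EucSp d → ℝ} (hf : NiceFam m f) :
    Continuous fun z : P × EucSp d => f z.1 z.2 := hf.continuous [] (by simp)

lemma comp_add {f : P → EucSp d → ℝ} (hf : NiceFam m f) {h : P → EucSp d} (hh : Continuous h) :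
    NiceFam m fun q x => f q (x + h q) :=
  ⟨fun q => (hf.contDiff q).comp (contDiff_id.add contDiff_const), fun L hL => by
    simp only [fun q => listD_comp_add_right L (f q) (h q)]
    exact (hf.continuous L hL).comp
      (by fun_prop : Continuous fun z : P × EucSp d => (z.1, z.2 + h z.1))⟩

end NiceFam

section Integral

variable {Y : Type*} [TopologicalSpace Y] [MeasurableSpace Y]
  [OpensMeasurableSpace Y] [SecondCountableTopology Y] {ν : Measure Y}
  [IsFiniteMeasureOnCompacts ν] {S : Set Y}

lemma Continuous.integrableOn_compact {F : Type*} [NormedAddCommGroup F] {f : Y → F}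
    (hf : Continuous f) (hS : IsCompact S) (hSm : MeasurableSet S) : IntegrableOn f S ν := by
  have : IsFiniteMeasure (ν.restrict S) := ⟨by simpa using hS.measure_lt_top⟩
  obtain ⟨M, hM⟩ := (hS.image hf).isBounded.exists_norm_le
  refine Integrable.of_bound hf.aestronglyMeasurable M ?_
  rw [ae_restrict_iff' hSm]
  exact Eventually.of_forall fun y hy => hM _ (mem_image_of_mem _ hy)

/-- The gradient is jointly continuous, hence bounded on the compact product of `S` with the closed
unit ball around `x₀`; this bound dominates. -/
lemma NiceFam.hasFDerivAt_integral {f : Y → EucSp d → ℝ} (hf : NiceFam 1 f)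
    (hS : IsCompact S) (hSm : MeasurableSet S) (x₀ : EucSp d) :
    HasFDerivAt (fun x => ∫ u in S, f u x ∂ν) (∫ u in S, fderiv ℝ (f u) x₀ ∂ν) x₀ := by
  have hd : ∀ u x, DifferentiableAt ℝ (f u) x := fun u x =>
    ((hf.contDiff u).differentiable (by simp)) x
  have hp : ∀ i, Continuous fun z : Y × EucSp d => _root_.partialD i (f z.1) z.2 := fun i =>
    hf.continuous [i] (by simp)
  have hcont : Continuous fun z : Y × EucSp d => fderiv ℝ (f z.1) z.2 := by
    simp only [fun z : Y × EucSp d => fderiv_eq_sum_partialD (hd z.1 z.2)]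
    exact continuous_finsetSum _ fun i _ => (hp i).smul continuous_const
  have h0 := hf.continuous_uncurry
  obtain ⟨M, hM⟩ := ((hS.prod (isCompact_closedBall x₀ 1)).image hcont).isBounded.exists_norm_le
  have : IsFiniteMeasure (ν.restrict S) := ⟨by simpa using hS.measure_lt_top⟩
  refine hasFDerivAt_integral_of_dominated_of_fderiv_le (F' := fun x u => fderiv ℝ (f u) x)
    (s := Metric.closedBall x₀ 1) (bound := fun _ => M)
    (Metric.closedBall_mem_nhds x₀ one_pos) ?_ ?_ ?_ ?_ (integrable_const _) ?_
  · exact Eventually.of_forall fun x => Continuous.aestronglyMeasurable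
      (h0.comp (by fun_prop : Continuous fun u : Y => (u, x)))
  · exact (h0.comp (by fun_prop : Continuous fun u : Y => (u, x₀))).integrableOn_compact hS hSm
  · exact Continuous.aestronglyMeasurable
      (hcont.comp (by fun_prop : Continuous fun u : Y => (u, x₀)))
  · rw [ae_restrict_iff' hSm]
    exact Eventually.of_forall fun u hu x hx => hM _ (mem_image_of_mem _ (mk_mem_prod hu hx))
  · exact Eventually.of_forall fun u x _ => (hd u x).hasFDerivAt

lemma NiceFam.contDiff_integral (hS : IsCompact S) (hSm : MeasurableSet S) :
    ∀ {m : ℕ} {f : Y → EucSp d → ℝ}, NiceFam m f →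
      ContDiff ℝ m (fun x => ∫ u in S, f u x ∂ν) ∧
      ∀ L : List (Fin d), L.length ≤ m → listD L (fun x => ∫ u in S, f u x ∂ν) =
        fun x => ∫ u in S, listD L (f u) x ∂ν := by
  intro m
  induction m with
  | zero =>
    intro f hf
    refine ⟨?_, fun L hL => ?_⟩
    · simp only [Nat.cast_zero, contDiff_zero]
      exact continuous_setIntegral_of_compact (f := fun x u => f u x)
        (hf.continuous_uncurry.comp continuous_swap) hS hSm
    · obtain rfl : L = [] := List.length_eq_zero_iff.mp (by omega)
      rfl
  | succ m ih =>
    intro f hf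
    have hd : ∀ u x, DifferentiableAt ℝ (f u) x := fun u x =>
      ((hf.contDiff u).differentiable (by simp)) x
    have hf1 := (hf.mono (by omega : 1 ≤ m + 1))
    have hpart : ∀ i, _root_.partialD i (fun x => ∫ u in S, f u x ∂ν) =
        fun x => ∫ u in S, _root_.partialD i (f u) x ∂ν := by
      intro i
      funext x
      have h1 := hf1.hasFDerivAt_integral (ν := ν) hS hSm x
      rw [partialD_eq_fderiv h1.differentiableAt, h1.fderiv, ContinuousLinearMap.integral_apply]
      · simp only [partialD_eq_fderiv (hd _ _)]
      · refine Continuous.integrableOn_compact ?_ hS hSm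
        simp only [fun u => fderiv_eq_sum_partialD (hd u x)]
        exact continuous_finsetSum _ fun i _ => ((hf1.continuous [i] (by simp)).comp
          (by fun_prop : Continuous fun u : Y => (u, x))).smul continuous_const
    constructor
    · refine contDiff_succ_of_partialD
        (fun x => (hf1.hasFDerivAt_integral hS hSm x).differentiableAt) fun i => ?_
      rw [hpart i]
      exact (ih (hf.partialD i)).1
    · intro L hL
      -- The innermost derivative is split off, because `hpart` moves it under the integral and
      -- leaves a family to which the induction hypothesis applies.
      rcases List.eq_nil_or_concat L with rfl | ⟨L', i, rfl⟩
      · rfl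
      · simp only [List.concat_eq_append, List.length_append, List.length_singleton] at hL ⊢
        rw [listD_concat, hpart, (ih (hf.partialD i)).2 L' (by omega)]
        simp only [listD_concat]

lemma NiceFam.listD_integral {f : Y → EucSp d → ℝ} (hf : NiceFam m f) (hS : IsCompact S)
    (hSm : MeasurableSet S) {L : List (Fin d)} (hL : L.length ≤ m) (x : EucSp d) :
    listD L (fun x => ∫ u in S, f u x ∂ν) x = ∫ u in S, listD L (f u) x ∂ν :=
  congrFun ((NiceFam.contDiff_integral hS hSm hf).2 L hL) x

lemma NiceFam.integral [FirstCountableTopology P] {f : P × Y → EucSp d → ℝ} (hf : NiceFam m f)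
    (hS : IsCompact S) (hSm : MeasurableSet S) :
    NiceFam m fun (q : P) x => ∫ u in S, f (q, u) x ∂ν := by
  have hq : ∀ q, NiceFam m fun u => f (q, u) := fun q => hf.comp (by fun_prop)
  refine ⟨fun q => (NiceFam.contDiff_integral hS hSm (hq q)).1, fun L hL => ?_⟩
  simp only [fun q => (hq q).listD_integral (ν := ν) hS hSm hL]
  refine continuous_setIntegral_of_compact
    (f := fun (z : P × EucSp d) u => listD L (f (z.1, u)) z.2) ?_ hS hSm
  exact (hf.continuous L hL).comp
    (by fun_prop : Continuous fun w : (P × EucSp d) × Y => ((w.1.1, w.2), w.1.2))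

end Integral

/-- Moving endpoints become parameters of an integral over the fixed compact set `[0,1]`, so the
lemmas on set integrals cover interval integrals of either orientation. -/
lemma intervalIntegral_eq_smul_unit (f : ℝ → ℝ) (a b : ℝ) :
    ∫ u in a..b, f u = (b - a) * ∫ v in Icc (0 : ℝ) 1, f (a + (b - a) * v) := by
  rw [integral_Icc_eq_integral_Ioc, ← intervalIntegral.integral_of_le zero_le_one]
  have := intervalIntegral.smul_integral_comp_add_mul (a := 0) (b := 1) f (b - a) a
  rw [smul_eq_mul] at this
  rw [this]; congr 1 <;> ring

lemma continuous_intervalIntegral_of_continuous [FirstCountableTopology P] {f : P → ℝ → ℝ}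
    (hf : Continuous f.uncurry) {a b : P → ℝ} (ha : Continuous a) (hb : Continuous b) :
    Continuous fun q => ∫ u in a q..b q, f q u := by
  simp only [intervalIntegral_eq_smul_unit]
  refine (hb.sub ha).mul (continuous_setIntegral_of_compact
    (f := fun q v => f q (a q + (b q - a q) * v)) ?_ isCompact_Icc measurableSet_Icc)
  exact hf.comp (by fun_prop : Continuous fun w : P × ℝ => (w.1, a w.1 + (b w.1 - a w.1) * w.2))

lemma NiceFam.listD_intervalIntegral {f : ℝ → EucSp d → ℝ} (hf : NiceFam m f) (a b : ℝ)
    {L : List (Fin d)} (hL : L.length ≤ m) :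
    listD L (fun x => ∫ u in a..b, f u x) = fun x => ∫ u in a..b, listD L (f u) x := by
  funext x
  simp only [intervalIntegral_eq_smul_unit, listD_const_mul]
  congr 1
  exact (hf.comp (by fun_prop : Continuous fun v : ℝ => a + (b - a) * v)).listD_integral
    isCompact_Icc measurableSet_Icc hL x

lemma NiceFam.intervalIntegral [FirstCountableTopology P] {f : P × ℝ → EucSp d → ℝ}
    (hf : NiceFam m f) {a b : P → ℝ} (ha : Continuous a) (hb : Continuous b) :
    NiceFam m fun (q : P) x => ∫ u in a q..b q, f (q, u) x := by
  simp only [intervalIntegral_eq_smul_unit]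
  refine NiceFam.const_mul ?_ (hb.sub ha)
  exact (hf.comp (by fun_prop : Continuous fun w : P × ℝ =>
    (w.1, a w.1 + (b w.1 - a w.1) * w.2))).integral isCompact_Icc measurableSet_Icc

end NiceFam
end

noncomputable section

/-! ### Hölder norms as suprema of linear functionals. -/

/-- A linear combination of two point evaluations of the derivative along `L`. -/
structure HFun (d : ℕ) where
  L : List (Fin d)
  x : EucSp d
  x' : EucSp d
  c : ℝ
  c' : ℝ

namespace HFun

variable {d : ℕ}

/-- The value of the functional. -/
def ev (l : HFun d) (u : EucSp d → ℝ) : ℝ := l.c * listD l.L u l.x + l.c' * listD l.L u l.x'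

/-- The functionals whose supremum is (equivalent to) the `C^θ` norm. -/
def Adm (θ : ℝ) (l : HFun d) : Prop :=
  l.L.length ≤ ⌊θ⌋₊ ∧ ((l.c = 1 ∧ l.c' = 0) ∨ (l.L.length = ⌊θ⌋₊ ∧ l.x ≠ l.x' ∧
    l.c = (‖l.x - l.x'‖ ^ (θ - ⌊θ⌋₊))⁻¹ ∧ l.c' = -(‖l.x - l.x'‖ ^ (θ - ⌊θ⌋₊))⁻¹))

lemma ev_const_mul (l : HFun d) (c : ℝ) (u : EucSp d → ℝ) :
    l.ev (fun x => c * u x) = c * l.ev u := by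
  simp only [ev, listD_const_mul]; ring

lemma ev_mul_const (l : HFun d) (c : ℝ) (u : EucSp d → ℝ) :
    l.ev (fun x => u x * c) = l.ev u * c := by
  simp only [mul_comm _ c, ev_const_mul]

lemma ev_add {θ : ℝ} {l : HFun d} (hl : l.Adm θ) {u v : EucSp d → ℝ} (hu : ContDiff ℝ ⌊θ⌋₊ u)
    (hv : ContDiff ℝ ⌊θ⌋₊ v) : l.ev (fun x => u x + v x) = l.ev u + l.ev v := by
  have h : (l.L.length : WithTop ℕ∞) ≤ ⌊θ⌋₊ := by exact_mod_cast hl.1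
  simp only [ev, listD_add l.L (hu.of_le h) (hv.of_le h)]; ring

lemma ev_sub {θ : ℝ} {l : HFun d} (hl : l.Adm θ) {u v : EucSp d → ℝ} (hu : ContDiff ℝ ⌊θ⌋₊ u)
    (hv : ContDiff ℝ ⌊θ⌋₊ v) : l.ev (fun x => u x - v x) = l.ev u - l.ev v := by
  have h : (l.L.length : WithTop ℕ∞) ≤ ⌊θ⌋₊ := by exact_mod_cast hl.1
  simp only [ev, listD_sub l.L (hu.of_le h) (hv.of_le h)]; ring

lemma ev_zero (l : HFun d) : l.ev (fun _ => 0) = 0 := by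
  simpa using l.ev_const_mul 0 (fun _ => 0)

lemma continuous_ev {P : Type*} [TopologicalSpace P] {m : ℕ} {f : P → EucSp d → ℝ}
    (hf : NiceFam m f) {l : HFun d} (hl : l.L.length ≤ m) : Continuous fun q => l.ev (f q) := by
  unfold ev
  have h := fun x : EucSp d => (hf.continuous l.L hl).comp
    (by fun_prop : Continuous fun q : P => (q, x))
  exact (continuous_const.mul (h l.x)).add (continuous_const.mul (h l.x'))

lemma ev_intervalIntegral {m : ℕ} {f : ℝ → EucSp d → ℝ} (hf : NiceFam m f) {l : HFun d}
    (hl : l.L.length ≤ m) (a b : ℝ) :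
    l.ev (fun x => ∫ u in a..b, f u x) = ∫ u in a..b, l.ev (f u) := by
  have h := fun x : EucSp d => (hf.continuous l.L hl).comp
    (by fun_prop : Continuous fun q : ℝ => (q, x))
  unfold ev
  rw [hf.listD_intervalIntegral a b hl, intervalIntegral.integral_add,
    intervalIntegral.integral_const_mul, intervalIntegral.integral_const_mul]
  · exact (continuous_const.mul (h l.x)).intervalIntegrable _ _
  · exact (continuous_const.mul (h l.x')).intervalIntegrable _ _

lemma abs_ev_le {θ A : ℝ} {u : EucSp d → ℝ}
    (h1 : ∀ L : List (Fin d), L.length ≤ ⌊θ⌋₊ → ∀ x, |listD L u x| ≤ A)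
    (h2 : ∀ L : List (Fin d), L.length = ⌊θ⌋₊ → ∀ x x',
      |listD L u x - listD L u x'| ≤ A * ‖x - x'‖ ^ (θ - ⌊θ⌋₊))
    {l : HFun d} (hl : l.Adm θ) : |l.ev u| ≤ A := by
  obtain ⟨hL, ⟨hc, hc'⟩ | ⟨hL', hx, hc, hc'⟩⟩ := hl
  · simpa [ev, hc, hc'] using h1 l.L hL l.x
  · have hpos : 0 < ‖l.x - l.x'‖ ^ (θ - ⌊θ⌋₊) :=
      Real.rpow_pos_of_pos (norm_pos_iff.mpr (sub_ne_zero.mpr hx)) _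
    have : l.ev u = (listD l.L u l.x - listD l.L u l.x') / ‖l.x - l.x'‖ ^ (θ - ⌊θ⌋₊) := by
      rw [ev, hc, hc']; field_simp; ring
    rw [this, abs_div, abs_of_pos hpos, div_le_iff₀ hpos]
    exact h2 l.L hL' _ _

end HFun

section HSup

variable {d : ℕ}

/-- A norm equivalent to that of `C^θ`. -/
def hsup (θ : ℝ) (u : EucSp d → ℝ) : ℝ≥0∞ := ⨆ (l : HFun d) (_ : l.Adm θ), ‖l.ev u‖ₑ

/-- A norm equivalent to that of `C^{θ,θ}`. -/
def hsup₂ (θ : ℝ) (U : EucSp d → EucSp d → ℝ) : ℝ≥0∞ :=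
  ⨆ (l : HFun d) (_ : l.Adm θ), hsup θ fun z => l.ev fun x => U x z

lemma enorm_ev_le_hsup {θ : ℝ} {l : HFun d} (hl : l.Adm θ) (u : EucSp d → ℝ) :
    ‖l.ev u‖ₑ ≤ hsup θ u := le_iSup₂_of_le (f := fun (l : HFun d) (_ : l.Adm θ) => ‖l.ev u‖ₑ) l hl le_rfl

lemma hsup_le_hsup₂ {θ : ℝ} {l : HFun d} (hl : l.Adm θ) (U : EucSp d → EucSp d → ℝ) :
    hsup θ (fun z => l.ev fun x => U x z) ≤ hsup₂ θ U :=
  le_iSup₂_of_le (f := fun (l : HFun d) (_ : l.Adm θ) => hsup θ fun z => l.ev fun x => U x z)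
    l hl le_rfl

/-- The number of suprema in the definition of the norm of `C^θ`. -/
def holderCount (d : ℕ) (θ : ℝ) : ℕ :=
  (∑ n ∈ Finset.range (⌊θ⌋₊ + 1), (multiIdx d n).card) + (multiIdx d ⌊θ⌋₊).card

lemma adm_point {θ : ℝ} {n : ℕ} (hn : n ∈ Finset.range (⌊θ⌋₊ + 1)) {k : Fin d → ℕ}
    (hk : k ∈ multiIdx d n) (x : EucSp d) : HFun.Adm θ ⟨idxList k, x, x, 1, 0⟩ := by
  refine ⟨?_, Or.inl ⟨rfl, rfl⟩⟩
  simp only [length_idxList_of_mem hk]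
  simpa [Nat.lt_succ_iff] using hn

lemma adm_diff {θ : ℝ} {k : Fin d → ℕ}
    (hk : k ∈ multiIdx d ⌊θ⌋₊) {x x' : EucSp d} (hx : x ≠ x') : HFun.Adm θ
      ⟨idxList k, x, x', (‖x - x'‖ ^ (θ - ⌊θ⌋₊))⁻¹, -(‖x - x'‖ ^ (θ - ⌊θ⌋₊))⁻¹⟩ :=
  ⟨(length_idxList_of_mem hk).le, Or.inr ⟨length_idxList_of_mem hk, hx, rfl, rfl⟩⟩

/-- Each supremum in the norm runs over admissible functionals of one word, and `holderCount` counts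
these suprema. For integral `θ` the difference functionals do not occur in the norm, but admitting
them only strengthens the hypothesis. Only this direction of the comparison is needed later. -/
lemma mixedNorm_le {Y : Type*} {N : (Y → ℝ) → ℝ≥0∞}
    (hN : ∀ (c : ℝ) v, N (fun y => c * v y) = ‖c‖ₑ * N v) {θ : ℝ}
    {U : EucSp d → Y → ℝ} {B : ℝ≥0∞}
    (h : ∀ l : HFun d, l.Adm θ → N (fun y => l.ev fun x => U x y) ≤ B) :
    mixedNorm N θ U ≤ holderCount d θ * B := by
  unfold mixedNorm holderCount
  push_cast
  rw [add_mul]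
  gcongr ?_ + ?_
  · rw [Finset.sum_mul]
    refine Finset.sum_le_sum fun n hn => ?_
    rw [← nsmul_eq_mul]
    refine Finset.sum_le_card_nsmul _ _ _ fun k hk => iSup_le fun x => ?_
    simpa [HFun.ev, multiD_eq_listD] using h _ (adm_point hn hk x)
  · split_ifs
    · exact zero_le
    · rw [← nsmul_eq_mul]
      refine Finset.sum_le_card_nsmul _ _ _ fun k hk => iSup_le fun x => iSup_le fun x' =>
        iSup_le fun hx => ?_
      have hpos : 0 < ‖x - x'‖ ^ (θ - ⌊θ⌋₊) :=
        Real.rpow_pos_of_pos (norm_pos_iff.mpr (sub_ne_zero.mpr hx)) _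
      have h1 := h _ (adm_diff hk hx)
      have h2 : (fun y => (HFun.mk (idxList k) x x' (‖x - x'‖ ^ (θ - ⌊θ⌋₊))⁻¹
          (-(‖x - x'‖ ^ (θ - ⌊θ⌋₊))⁻¹)).ev fun x => U x y) = fun y =>
          (‖x - x'‖ ^ (θ - ⌊θ⌋₊))⁻¹ *
            (multiD k (fun x => U x y) x - multiD k (fun x => U x y) x') := by
        funext y; simp only [HFun.ev, multiD_eq_listD]; ring
      rw [h2, hN, mul_comm] at h1
      rw [div_eq_mul_inv, ← ENNReal.ofReal_inv_of_pos hpos]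
      rwa [Real.enorm_eq_ofReal (inv_nonneg.mpr hpos.le)] at h1

lemma holderNorm_eq_mixedNorm (θ : ℝ) (u : EucSp d → ℝ) :
    holderNorm θ u = mixedNorm (fun v : Unit → ℝ => ‖v ()‖ₑ) θ fun x _ => u x := rfl

lemma holderNorm_le_hsup (θ : ℝ) (u : EucSp d → ℝ) :
    holderNorm θ u ≤ holderCount d θ * hsup θ u := by
  rw [holderNorm_eq_mixedNorm]
  exact mixedNorm_le (fun c v => enorm_mul _ _) fun l hl => enorm_ev_le_hsup hl u

lemma hsup_const_mul (θ : ℝ) (c : ℝ) (u : EucSp d → ℝ) :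
    hsup θ (fun x => c * u x) = ‖c‖ₑ * hsup θ u := by
  simp only [hsup, HFun.ev_const_mul, enorm_mul, ENNReal.mul_iSup]

lemma mixedNorm_mono {Y : Type*} {N N' : (Y → ℝ) → ℝ≥0∞} (hN : ∀ v, N v ≤ N' v) (θ : ℝ)
    (U : EucSp d → Y → ℝ) : mixedNorm N θ U ≤ mixedNorm N' θ U := by
  unfold mixedNorm
  gcongr
  · exact hN _
  · split_ifs
    · exact le_rfl
    · gcongr; exact hN _

/-- The comparison is made once in each variable: first inside, by monotonicity of `mixedNorm` in
`N`, then outside. Hence the squared count. -/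
lemma holderNorm₂_le_hsup₂ (θ : ℝ) (U : EucSp d → EucSp d → ℝ) :
    holderNorm₂ θ U ≤ holderCount d θ * (holderCount d θ * hsup₂ θ U) := by
  refine (mixedNorm_mono (holderNorm_le_hsup θ) θ U).trans (mixedNorm_le ?_ fun l hl => ?_)
  · intro c v
    rw [hsup_const_mul]; ring
  · gcongr
    exact hsup_le_hsup₂ hl U

lemma hsup_add_le {θ : ℝ} {u v : EucSp d → ℝ} (hu : ContDiff ℝ ⌊θ⌋₊ u)
    (hv : ContDiff ℝ ⌊θ⌋₊ v) : hsup θ (fun x => u x + v x) ≤ hsup θ u + hsup θ v := by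
  refine iSup₂_le fun l hl => ?_
  rw [HFun.ev_add hl hu hv]
  exact (enorm_add_le _ _).trans (add_le_add (enorm_ev_le_hsup hl u) (enorm_ev_le_hsup hl v))

end HSup

/-! ### Lower semicontinuity of the norms, and families of functions of two variables. -/

section LowerSemicontinuous

variable {d : ℕ} {P : Type*} [TopologicalSpace P] {m : ℕ}

lemma LowerSemicontinuous.ennreal_div_const {f : P → ℝ≥0∞} (hf : LowerSemicontinuous f) {c : ℝ≥0∞}
    (hc : c ≠ 0) : LowerSemicontinuous fun q => f q / c :=
  (ENNReal.continuous_div_const c hc).comp_lowerSemicontinuous hf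
    fun _ _ h => ENNReal.div_le_div_right h c

/-- Arbitrary suprema preserve lower semicontinuity, though not measurability. This is how
uncountable suprema over points and times stay measurable. -/
lemma lowerSemicontinuous_mixedNorm {Y : Type*} {N : (Y → ℝ) → ℝ≥0∞} {θ : ℝ}
    {U : P → EucSp d → Y → ℝ}
    (h1 : ∀ L : List (Fin d), L.length ≤ ⌊θ⌋₊ → ∀ x,
      LowerSemicontinuous fun q => N fun y => listD L (fun x => U q x y) x)
    (h2 : ∀ L : List (Fin d), L.length ≤ ⌊θ⌋₊ → ∀ x x',
      LowerSemicontinuous fun q => N fun y =>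
        listD L (fun x => U q x y) x - listD L (fun x => U q x y) x') :
    LowerSemicontinuous fun q => mixedNorm N θ (U q) := by
  unfold mixedNorm
  refine LowerSemicontinuous.add ?_ ?_
  · refine lowerSemicontinuous_sum fun n hn => lowerSemicontinuous_sum fun k hk =>
      lowerSemicontinuous_iSup fun x => ?_
    simp only [multiD_eq_listD]
    refine h1 _ ?_ x
    rw [length_idxList_of_mem hk]
    simpa [Nat.lt_succ_iff] using hn
  · split_ifs
    · exact lowerSemicontinuous_const
    · refine lowerSemicontinuous_sum fun k hk => lowerSemicontinuous_iSup fun x =>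
        lowerSemicontinuous_iSup fun x' => lowerSemicontinuous_iSup fun hx => ?_
      simp only [multiD_eq_listD]
      refine (h2 _ (length_idxList_of_mem hk).le x x').ennreal_div_const ?_
      have hpos : 0 < ‖x - x'‖ ^ (θ - ⌊θ⌋₊) :=
        Real.rpow_pos_of_pos (norm_pos_iff.mpr (sub_ne_zero.mpr hx)) _
      simpa using hpos

lemma lowerSemicontinuous_holderNorm {θ : ℝ} {f : P → EucSp d → ℝ} (hf : NiceFam ⌊θ⌋₊ f) :
    LowerSemicontinuous fun q => holderNorm θ (f q) := by
  simp only [holderNorm_eq_mixedNorm]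
  have h := fun (L : List (Fin d)) (hL : L.length ≤ ⌊θ⌋₊) (x : EucSp d) => (hf.continuous L hL).comp
    (by fun_prop : Continuous fun q : P => (q, x))
  refine lowerSemicontinuous_mixedNorm (fun L hL x => ?_) fun L hL x x' => ?_
  · exact (h L hL x).enorm.lowerSemicontinuous
  · exact ((h L hL x).sub (h L hL x')).enorm.lowerSemicontinuous

lemma lowerSemicontinuous_hsup {θ : ℝ} {f : P → EucSp d → ℝ} (hf : NiceFam ⌊θ⌋₊ f) :
    LowerSemicontinuous fun q => hsup θ (f q) :=
  lowerSemicontinuous_iSup fun _ => lowerSemicontinuous_iSup fun hl =>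
    (HFun.continuous_ev hf hl.1).enorm.lowerSemicontinuous

/-- A family of functions of two variables with mixed derivatives, of orders up to `m` in each
variable, depending continuously on the parameter and the points. -/
structure NiceFam₂ (m : ℕ) (U : P → EucSp d → EucSp d → ℝ) : Prop where
  fst : NiceFam m fun (w : P × EucSp d) x => U w.1 x w.2
  snd : ∀ L : List (Fin d), L.length ≤ m →
    NiceFam m fun (w : P × EucSp d) z => listD L (fun x => U w.1 x z) w.2

namespace NiceFam₂

lemma comp {P' : Type*} [TopologicalSpace P'] {U : P → EucSp d → EucSp d → ℝ}
    (hU : NiceFam₂ m U) {g : P' → P} (hg : Continuous g) : NiceFam₂ m fun q => U (g q) :=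
  ⟨hU.fst.comp (by fun_prop : Continuous fun w : P' × EucSp d => (g w.1, w.2)), fun L hL =>
    (hU.snd L hL).comp (by fun_prop : Continuous fun w : P' × EucSp d => (g w.1, w.2))⟩

lemma contDiff_fst {U : P → EucSp d → EucSp d → ℝ} (hU : NiceFam₂ m U) (q : P) (z : EucSp d) :
    ContDiff ℝ m fun x => U q x z := hU.fst.contDiff (q, z)

lemma const_mul {U : P → EucSp d → EucSp d → ℝ} (hU : NiceFam₂ m U) {c : P → ℝ}
    (hc : Continuous c) : NiceFam₂ m fun q x z => c q * U q x z :=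
  ⟨hU.fst.const_mul (c := fun w => c w.1) (by fun_prop), fun L hL => by
    simp only [listD_const_mul]
    exact (hU.snd L hL).const_mul (c := fun w : P × EucSp d => c w.1) (by fun_prop)⟩

lemma add {U V : P → EucSp d → EucSp d → ℝ} (hU : NiceFam₂ m U) (hV : NiceFam₂ m V) :
    NiceFam₂ m fun q x z => U q x z + V q x z :=
  ⟨hU.fst.add hV.fst, fun L hL => by
    have h : (L.length : WithTop ℕ∞) ≤ m := by exact_mod_cast hL
    simp only [fun q z => listD_add L ((hU.contDiff_fst q z).of_le h)
      ((hV.contDiff_fst q z).of_le h)]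
    exact (hU.snd L hL).add (hV.snd L hL)⟩

lemma sum {ι : Type*} (s : Finset ι) {U : ι → P → EucSp d → EucSp d → ℝ}
    (hU : ∀ i ∈ s, NiceFam₂ m (U i)) : NiceFam₂ m fun q x z => ∑ i ∈ s, U i q x z := by
  classical
  induction s using Finset.induction_on with
  | empty =>
    simp only [Finset.sum_empty]
    refine ⟨NiceFam.of_contDiff contDiff_const, fun L _ => ?_⟩
    have : ∀ x : EucSp d, listD L (fun _ => 0) x = 0 := fun x => by
      simpa using congrFun (listD_const_mul L 0 fun _ => 0) x
    simp only [this]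
    exact NiceFam.of_contDiff contDiff_const
  | insert i s hi ih =>
    simp only [Finset.sum_insert hi]
    exact (hU i (by simp)).add (ih fun j hj => hU j (by simp [hj]))

lemma mul {F G : P → EucSp d → ℝ} (hF : NiceFam m F) (hG : NiceFam m G) :
    NiceFam₂ m fun q x z => F q x * G q z :=
  ⟨(hF.comp (g := fun w : P × EucSp d => w.1) continuous_fst).mul_const hG.continuous_uncurry,
    fun L hL => by
      simp only [mul_comm (F _ _), listD_const_mul]
      exact (hG.comp (g := fun w : P × EucSp d => w.1) continuous_fst).mul_const
        (hF.continuous L hL)⟩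

/-- Since the integrand is a product, derivatives in the first variable fall on `F` alone and those
in the second on `G` alone. No joint differentiability in the pair of variables is involved. -/
lemma intervalIntegral [FirstCountableTopology P] {F G : P × ℝ → EucSp d → ℝ}
    (hF : NiceFam m F) (hG : NiceFam m G) {a b : P → ℝ} (ha : Continuous a) (hb : Continuous b) :
    NiceFam₂ m fun q x z => ∫ r in a q..b q, F (q, r) x * G (q, r) z := by
  refine ⟨?_, fun L hL => ?_⟩
  · refine NiceFam.intervalIntegral (P := P × EucSp d)
      (f := fun w x => F (w.1.1, w.2) x * G (w.1.1, w.2) w.1.2)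
      (a := fun w => a w.1) (b := fun w => b w.1) ?_ (by fun_prop) (by fun_prop)
    exact (hF.comp (by fun_prop : Continuous fun w : (P × EucSp d) × ℝ => (w.1.1, w.2))).mul_const
      (hG.continuous_uncurry.comp
        (by fun_prop : Continuous fun w : (P × EucSp d) × ℝ => ((w.1.1, w.2), w.1.2)))
  · have h : ∀ q z, listD L (fun x => ∫ r in a q..b q, F (q, r) x * G (q, r) z) =
        fun x => ∫ r in a q..b q, listD L (F (q, r)) x * G (q, r) z := by
      intro q z
      have := (hF.comp (by fun_prop : Continuous fun r : ℝ => (q, r))).mul_const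
        (hG.continuous_uncurry.comp (by fun_prop : Continuous fun r : ℝ => ((q, r), z)))
      refine (this.listD_intervalIntegral (a q) (b q) hL).trans ?_
      simp only [mul_comm _ (G _ _), listD_const_mul, Function.comp_def]
    simp only [h]
    refine NiceFam.intervalIntegral (P := P × EucSp d)
      (f := fun w z => listD L (F (w.1.1, w.2)) w.1.2 * G (w.1.1, w.2) z)
      (a := fun w => a w.1) (b := fun w => b w.1) ?_ (by fun_prop) (by fun_prop)
    exact (hG.comp (by fun_prop : Continuous fun w : (P × EucSp d) × ℝ => (w.1.1, w.2))).const_mul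
      ((hF.continuous L hL).comp
        (by fun_prop : Continuous fun w : (P × EucSp d) × ℝ => ((w.1.1, w.2), w.1.2)))

lemma niceFam_ev {U : P → EucSp d → EucSp d → ℝ} (hU : NiceFam₂ m U) {l : HFun d}
    (hl : l.L.length ≤ m) : NiceFam m fun q z => l.ev fun x => U q x z := by
  unfold HFun.ev
  have h := fun x : EucSp d => (hU.snd l.L hl).comp (by fun_prop : Continuous fun q : P => (q, x))
  exact ((h l.x).const_mul continuous_const).add ((h l.x').const_mul continuous_const)

lemma lowerSemicontinuous_holderNorm₂ {θ : ℝ} {U : P → EucSp d → EucSp d → ℝ}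
    (hU : NiceFam₂ ⌊θ⌋₊ U) : LowerSemicontinuous fun q => holderNorm₂ θ (U q) := by
  have h := fun (L : List (Fin d)) (hL : L.length ≤ ⌊θ⌋₊) (x : EucSp d) =>
    (hU.snd L hL).comp (by fun_prop : Continuous fun q : P => (q, x))
  exact lowerSemicontinuous_mixedNorm (fun L hL x => lowerSemicontinuous_holderNorm (h L hL x))
    fun L hL x x' => lowerSemicontinuous_holderNorm ((h L hL x).sub (h L hL x'))

lemma lowerSemicontinuous_hsup₂ {θ : ℝ} {U : P → EucSp d → EucSp d → ℝ}
    (hU : NiceFam₂ ⌊θ⌋₊ U) : LowerSemicontinuous fun q => hsup₂ θ (U q) :=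
  lowerSemicontinuous_iSup fun _ => lowerSemicontinuous_iSup fun hl =>
    lowerSemicontinuous_hsup (hU.niceFam_ev hl.1)

end NiceFam₂

end LowerSemicontinuous

section HSupTwo

variable {d : ℕ} {θ : ℝ}

lemma hsup₂_add_le {U V : EucSp d → EucSp d → ℝ} (hU : NiceFam₂ ⌊θ⌋₊ fun _ : Unit => U)
    (hV : NiceFam₂ ⌊θ⌋₊ fun _ : Unit => V) :
    hsup₂ θ (fun x z => U x z + V x z) ≤ hsup₂ θ U + hsup₂ θ V := by
  refine iSup₂_le fun l hl => ?_
  simp only [fun z => HFun.ev_add hl (hU.contDiff_fst () z) (hV.contDiff_fst () z)]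
  refine (hsup_add_le ((hU.niceFam_ev hl.1).contDiff ()) ((hV.niceFam_ev hl.1).contDiff ())).trans ?_
  exact add_le_add (hsup_le_hsup₂ hl U) (hsup_le_hsup₂ hl V)

lemma hsup₂_const_mul (c : ℝ) (U : EucSp d → EucSp d → ℝ) :
    hsup₂ θ (fun x z => c * U x z) = ‖c‖ₑ * hsup₂ θ U := by
  simp only [hsup₂, HFun.ev_const_mul, hsup_const_mul, ENNReal.mul_iSup]

lemma hsup₂_mul_le (u v : EucSp d → ℝ) :
    hsup₂ θ (fun x z => u x * v z) ≤ hsup θ u * hsup θ v := by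
  refine iSup₂_le fun l hl => ?_
  simp only [HFun.ev_mul_const, hsup_const_mul]
  gcongr
  exact enorm_ev_le_hsup hl u

end HSupTwo
end

/-! ### Mollifiers and their scaling. -/

noncomputable section

/-! ### A mollifier -/

/-- A smooth bump supported in the unit ball, of integral one. -/
def mollBump (d : ℕ) : EucSp d → ℝ :=
  (⟨1 / 2, 1, by norm_num, by norm_num⟩ : ContDiffBump (0 : EucSp d)).normed volume

section MollBump

variable {d : ℕ}

lemma contDiff_mollBump (n : ℕ) : ContDiff ℝ n (mollBump d) :=
  (ContDiffBump.contDiff_normed _ (n := n)).of_le (by simp)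

lemma mollBump_nonneg (x : EucSp d) : 0 ≤ mollBump d x := ContDiffBump.nonneg_normed _ _

lemma mollBump_neg (x : EucSp d) : mollBump d (-x) = mollBump d x := ContDiffBump.normed_neg _ _

lemma support_mollBump : Function.support (mollBump d) = Metric.ball 0 1 :=
  ContDiffBump.support_normed_eq _

lemma mollBump_eq_zero {x : EucSp d} (hx : 1 ≤ ‖x‖) : mollBump d x = 0 := by
  by_contra h
  have : x ∈ Metric.ball (0 : EucSp d) 1 := support_mollBump ▸ (show x ∈ Function.support _ from h)
  simp at this
  linarith

lemma integral_mollBump : ∫ x, mollBump d x = 1 := ContDiffBump.integral_normed _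

lemma setIntegral_mollBump_mul (f : EucSp d → ℝ) :
    ∫ h in Metric.closedBall (0 : EucSp d) 1, mollBump d h * f h = ∫ h, mollBump d h * f h := by
  refine setIntegral_eq_integral_of_forall_compl_eq_zero fun x hx => ?_
  rw [mollBump_eq_zero, zero_mul]
  simp at hx
  exact hx.le

lemma setIntegral_mollBump :
    ∫ h in Metric.closedBall (0 : EucSp d) 1, mollBump d h = 1 := by
  simpa [integral_mollBump] using setIntegral_mollBump_mul (d := d) fun _ => 1

lemma listD_eq_zero_of_eventually {u : EucSp d → ℝ} {x : EucSp d} (L : List (Fin d))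
    (h : ∀ᶠ y in 𝓝 x, u y = 0) : listD L u x = 0 := by
  suffices ∀ᶠ y in 𝓝 x, listD L u y = 0 from this.self_of_nhds
  induction L with
  | nil => exact h
  | cons i L ih =>
    rw [← eventually_eventually_nhds] at ih
    filter_upwards [ih] with y hy
    rw [listD_cons, partialD]
    have : listD L u =ᶠ[𝓝 y] 0 := hy
    rw [this.lineDeriv_eq]
    simp [lineDeriv]

lemma listD_eq_zero_of_lt {u : EucSp d → ℝ} {R : ℝ} (h : ∀ y, R < ‖y‖ → u y = 0)
    (L : List (Fin d)) {x : EucSp d} (hx : R < ‖x‖) : listD L u x = 0 :=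
  listD_eq_zero_of_eventually L
    ((isOpen_lt continuous_const continuous_norm).eventually_mem hx |>.mono fun y hy => h y hy)

/-- Interpolation: the linear bound serves for `t ≤ 1`, the constant one for `t ≥ 1`. -/
lemma abs_le_mul_rpow {a A B t β : ℝ} (hA : |a| ≤ A) (hB : |a| ≤ B * t) (ht : 0 ≤ t) (hβ₀ : 0 ≤ β)
    (hβ₁ : β ≤ 1) (hB0 : 0 ≤ B) : |a| ≤ (A + B) * t ^ β := by
  have hA0 : 0 ≤ A := (abs_nonneg a).trans hA
  have htβ : 0 ≤ t ^ β := Real.rpow_nonneg ht _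
  rcases le_total t 1 with h | h
  · rcases ht.eq_or_lt with rfl | ht'
    · rw [mul_zero] at hB
      exact hB.trans (by positivity)
    · have : t ≤ t ^ β := by
        simpa using Real.rpow_le_rpow_of_exponent_ge ht' h hβ₁
      nlinarith
  · have : 1 ≤ t ^ β := Real.one_le_rpow h hβ₀
    nlinarith

lemma abs_sub_le_of_partialD {u : EucSp d → ℝ} (hu : Differentiable ℝ u) {A : ℝ}
    (h : ∀ i x, |partialD i u x| ≤ A) (x x' : EucSp d) : |u x - u x'| ≤ d * A * ‖x - x'‖ := by
  have := Convex.norm_image_sub_le_of_norm_fderiv_le (𝕜 := ℝ) (f := u) (s := univ) (x := x')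
    (y := x) (C := d * A) (fun y _ => hu y) (fun y _ => ?_) convex_univ trivial trivial
  · simpa using this
  · refine (norm_fderiv_le_sum_partialD (hu y)).trans ?_
    refine (Finset.sum_le_sum fun i _ => h i y).trans ?_
    simp

lemma sub_floor_mem {θ : ℝ} (hθ : 0 ≤ θ) : 0 ≤ θ - ⌊θ⌋₊ ∧ θ - ⌊θ⌋₊ ≤ 1 :=
  ⟨by linarith [Nat.floor_le hθ], by linarith [Nat.lt_floor_add_one θ]⟩

lemma exists_listD_mollBump_le (m : ℕ) :
    ∃ A : ℝ, 0 ≤ A ∧ ∀ L : List (Fin d), L.length ≤ m → ∀ x, |listD L (mollBump d) x| ≤ A := by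
  have h1 : ∀ L : List (Fin d), ∃ A : ℝ, 0 ≤ A ∧ ∀ x, |listD L (mollBump d) x| ≤ A := by
    intro L
    have hc : Continuous (listD L (mollBump d)) := continuous_listD (contDiff_mollBump _) le_rfl
    obtain ⟨A, hA⟩ := ((isCompact_closedBall (0 : EucSp d) 1).image hc).isBounded.exists_norm_le
    refine ⟨max A 0, le_max_right _ _, fun x => ?_⟩
    by_cases hx : x ∈ Metric.closedBall (0 : EucSp d) 1
    · exact (hA _ (mem_image_of_mem _ hx)).trans (le_max_left _ _)
    · rw [listD_eq_zero_of_lt (fun y hy => mollBump_eq_zero hy.le) L (by simpa using hx)]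
      simp
  choose A hA0 hA using h1
  have hfin : {L : List (Fin d) | L.length ≤ m}.Finite := List.finite_length_le _ _
  refine ⟨∑ L ∈ hfin.toFinset, A L, Finset.sum_nonneg fun L _ => hA0 L, fun L hL x => ?_⟩
  exact (hA L x).trans (Finset.single_le_sum (f := A) (fun L _ => hA0 L) (by simpa using hL))

/-- Bound on the functionals of order `θ` evaluated at a rescaled bump. -/
lemma exists_ev_mollBump_le {θ : ℝ} (hθ : 0 ≤ θ) (r₀ : ℝ) :
    ∃ A : ℝ, 0 ≤ A ∧ ∀ r, 0 < r → r ≤ r₀ → ∀ (h : EucSp d) (l : HFun d), l.Adm θ →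
      |l.ev fun x => mollBump d (r⁻¹ • (x + h))| ≤ A * r ^ (-θ) := by
  obtain ⟨A, hA0, hA⟩ := exists_listD_mollBump_le (d := d) (⌊θ⌋₊ + 1)
  obtain ⟨hβ0, hβ1⟩ := sub_floor_mem hθ
  -- A derivative of order `|L| ≤ θ` of the rescaled bump costs `r^{-|L|}`. For `r ≤ r₀` this is at
  -- most `R^θ r^{-θ}`, so `R` compensates for scales above one.
  set R := max 1 r₀ with hR
  have hR1 : 1 ≤ R := le_max_left _ _
  refine ⟨A * R ^ θ + (2 * A + d * A), by positivity, fun r hr hr₀ h l hl => ?_⟩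
  have hD : ∀ L : List (Fin d), listD L (fun x => mollBump d (r⁻¹ • (x + h))) =
      fun x => r⁻¹ ^ L.length * listD L (mollBump d) (r⁻¹ • (x + h)) := by
    intro L
    rw [listD_comp_add_right L (fun x => mollBump d (r⁻¹ • x)) h,
      listD_comp_smul L (contDiff_mollBump _)]
  have hrθ : 0 < r ^ (-θ) := Real.rpow_pos_of_pos hr _
  refine HFun.abs_ev_le (θ := θ) (fun L hL x => ?_) (fun L hL x x' => ?_) hl
  · rw [hD, abs_mul, abs_of_nonneg (by positivity)]
    have h1 : r⁻¹ ^ L.length ≤ R ^ θ * r ^ (-θ) := by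
      have h2 : r⁻¹ ^ L.length = r ^ (θ - L.length) * r ^ (-θ) := by
        rw [← Real.rpow_add hr, ← Real.rpow_natCast, Real.inv_rpow hr.le, ← Real.rpow_neg hr.le]
        congr 1; ring
      have hLθ : (L.length : ℝ) ≤ θ := (Nat.cast_le.mpr hL).trans (Nat.floor_le hθ)
      rw [h2]
      gcongr
      calc r ^ (θ - L.length) ≤ R ^ (θ - L.length) := by
            gcongr
            exact hr₀.trans (le_max_right _ _)
        _ ≤ R ^ θ := Real.rpow_le_rpow_of_exponent_le hR1 (by linarith [Nat.cast_nonneg (α := ℝ) L.length])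
    calc _ ≤ (R ^ θ * r ^ (-θ)) * A := by gcongr; exact hA L (by omega) _
      _ ≤ _ := by nlinarith [mul_nonneg hA0 hrθ.le, Nat.cast_nonneg (α := ℝ) d]
  · have h3 := abs_le_mul_rpow (a := listD L (mollBump d) (r⁻¹ • (x + h)) -
        listD L (mollBump d) (r⁻¹ • (x' + h))) (A := 2 * A) (B := d * A) (t := r⁻¹ * ‖x - x'‖)
        (β := θ - ⌊θ⌋₊) ?_ ?_ (by positivity) hβ0 hβ1 (by positivity)
    · rw [hD, ← mul_sub, abs_mul, abs_of_nonneg (by positivity)]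
      rw [Real.mul_rpow (by positivity) (by positivity)] at h3
      have h4 : r⁻¹ ^ L.length * r⁻¹ ^ (θ - ⌊θ⌋₊) = r ^ (-θ) := by
        rw [← Real.rpow_natCast, ← Real.rpow_add (by positivity), hL, Real.inv_rpow hr.le,
          ← Real.rpow_neg hr.le]
        congr 1; ring
      have h5 : 0 ≤ R ^ θ := by positivity
      have h6 : 0 ≤ ‖x - x'‖ ^ (θ - ⌊θ⌋₊) := by positivity
      calc _ ≤ r⁻¹ ^ L.length * ((2 * A + d * A) * (r⁻¹ ^ (θ - ⌊θ⌋₊) * ‖x - x'‖ ^ (θ - ⌊θ⌋₊))) := by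
            gcongr
        _ = (2 * A + d * A) * r ^ (-θ) * ‖x - x'‖ ^ (θ - ⌊θ⌋₊) := by rw [← h4]; ring
        _ ≤ _ := by
          have : 0 ≤ A * R ^ θ := by positivity
          exact mul_le_mul_of_nonneg_right (mul_le_mul_of_nonneg_right (by linarith) hrθ.le) h6
    · have a1 := hA L (by omega) (r⁻¹ • (x + h))
      have a2 := hA L (by omega) (r⁻¹ • (x' + h))
      rw [abs_le] at *
      constructor <;> linarith [a1.1, a1.2, a2.1, a2.2]
    · have h1 := abs_sub_le_of_partialD (u := listD L (mollBump d)) (A := A)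
        ((ContDiff.listD (n := 1) L (contDiff_mollBump _)).differentiable (by simp))
        (fun i x => hA (i :: L) (by simp [hL]) x) (r⁻¹ • (x + h)) (r⁻¹ • (x' + h))
      rw [← smul_sub, norm_smul, add_sub_add_right_eq_sub, Real.norm_of_nonneg (by positivity)] at h1
      exact h1

end MollBump

/-! ### Mollification -/

section Moll

variable {d : ℕ}

/-- Mollification at scale `r`. -/
def moll (r : ℝ) (f : EucSp d → ℝ) (x : EucSp d) : ℝ :=
  ∫ h in Metric.closedBall (0 : EucSp d) 1, mollBump d h * f (x + r • h)

lemma continuous_mollBump : Continuous (mollBump d) := (contDiff_mollBump 0).continuous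

/-- The scale is one of the continuous variables and `0` is a permitted value. With `moll_zero`, the
approximate identity property becomes plain continuity at scale `0`. -/
lemma continuous_moll_family {P : Type*} [TopologicalSpace P] [FirstCountableTopology P]
    {f : P → EucSp d → ℝ} (hf : Continuous f.uncurry) :
    Continuous fun w : P × ℝ × EucSp d => moll w.2.1 (f w.1) w.2.2 := by
  have := continuous_mollBump (d := d)
  refine continuous_setIntegral_of_compact (f := fun (w : P × ℝ × EucSp d) h =>
    mollBump d h * f w.1 (w.2.2 + w.2.1 • h)) ?_ (isCompact_closedBall _ _) measurableSet_closedBall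
  have h2 := hf.comp (by fun_prop : Continuous fun v : (P × ℝ × EucSp d) × EucSp d =>
    (v.1.1, v.1.2.2 + v.1.2.1 • v.2))
  exact (this.comp continuous_snd).mul h2

lemma continuous_moll {f : EucSp d → ℝ} (hf : Continuous f) (r : ℝ) : Continuous (moll r f) :=
  (continuous_moll_family (P := Unit) (f := fun _ => f) (hf.comp continuous_snd)).comp
    (by fun_prop : Continuous fun x : EucSp d => ((), r, x))

lemma integrableOn_moll {f : EucSp d → ℝ} (hf : Continuous f) (r : ℝ) (x : EucSp d) :
    IntegrableOn (fun h => mollBump d h * f (x + r • h)) (Metric.closedBall (0 : EucSp d) 1) :=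
  (continuous_mollBump.mul (by fun_prop)).integrableOn_compact (isCompact_closedBall _ _)
    measurableSet_closedBall

lemma niceFam_moll_integrand {m : ℕ} {f : EucSp d → ℝ} (hf : ContDiff ℝ m f) (r : ℝ) :
    NiceFam m fun (h : EucSp d) x => mollBump d h * f (x + r • h) :=
  ((NiceFam.of_contDiff hf).comp_add (by fun_prop)).const_mul continuous_mollBump

lemma contDiff_moll {m : ℕ} {f : EucSp d → ℝ} (hf : ContDiff ℝ m f) (r : ℝ) :
    ContDiff ℝ m (moll r f) :=
  (NiceFam.contDiff_integral (isCompact_closedBall _ _) measurableSet_closedBall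
    (niceFam_moll_integrand hf r)).1

lemma listD_moll {m : ℕ} {f : EucSp d → ℝ} (hf : ContDiff ℝ m f) (r : ℝ) {L : List (Fin d)}
    (hL : L.length ≤ m) : listD L (moll r f) = moll r (listD L f) := by
  funext x
  refine ((niceFam_moll_integrand hf r).listD_integral (isCompact_closedBall _ _)
    measurableSet_closedBall hL x).trans ?_
  simp only [listD_const_mul, listD_comp_add_right]
  rfl

lemma moll_comm {f : EucSp d → ℝ} (hf : Continuous f) (r s : ℝ) :
    moll r (moll s f) = moll s (moll r f) := by
  funext x
  simp only [moll, ← integral_const_mul]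
  rw [integral_integral_swap]
  · simp only [mul_left_comm, add_right_comm]
  · have := continuous_mollBump (d := d)
    rw [Measure.prod_restrict]
    refine Continuous.integrableOn_compact (ν := (volume : Measure (EucSp d)).prod volume) ?_
      ((isCompact_closedBall _ _).prod (isCompact_closedBall _ _))
      (measurableSet_closedBall.prod measurableSet_closedBall)
    simp only [Function.uncurry_def]
    fun_prop

lemma moll_sum {ι : Type*} (s : Finset ι) (c : ι → ℝ) {f : ι → EucSp d → ℝ}
    (hf : ∀ i ∈ s, Continuous (f i)) (r : ℝ) (x : EucSp d) :
    moll r (fun x => ∑ i ∈ s, c i * f i x) x = ∑ i ∈ s, c i * moll r (f i) x := by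
  simp only [moll, Finset.mul_sum, ← integral_const_mul]
  rw [integral_finsetSum]
  · simp only [mul_left_comm]
  · intro i hi
    simp only [mul_left_comm _ (c i)]
    exact Integrable.const_mul (μ := volume.restrict _) (integrableOn_moll (hf i hi) r x) _

lemma moll_sub {f g : EucSp d → ℝ} (hf : Continuous f) (hg : Continuous g) (r : ℝ) (x : EucSp d) :
    moll r (fun x => f x - g x) x = moll r f x - moll r g x := by
  simp only [moll, mul_sub]
  exact integral_sub (μ := volume.restrict _) (integrableOn_moll hf r x) (integrableOn_moll hg r x)

lemma moll_zero (f : EucSp d → ℝ) : moll 0 f = f := by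
  funext x
  simp [moll, integral_mul_const, setIntegral_mollBump]

lemma abs_moll_le {f : EucSp d → ℝ} {A : ℝ} (hA : ∀ x, |f x| ≤ A) (r : ℝ) (x : EucSp d) :
    |moll r f x| ≤ A := by
  have hint : IntegrableOn (fun h : EucSp d => mollBump d h * A) (Metric.closedBall 0 1) :=
    Continuous.integrableOn_compact (continuous_mollBump.mul continuous_const)
      (isCompact_closedBall _ _) measurableSet_closedBall
  rw [moll, ← Real.norm_eq_abs]
  calc _ ≤ ∫ h in Metric.closedBall (0 : EucSp d) 1, mollBump d h * A := by
        refine norm_integral_le_of_norm_le (μ := volume.restrict _) hint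
          (Eventually.of_forall fun h => ?_)
        rw [norm_mul, Real.norm_of_nonneg (mollBump_nonneg _)]
        exact mul_le_mul_of_nonneg_left (hA _) (mollBump_nonneg _)
    _ = A := by rw [integral_mul_const, setIntegral_mollBump, one_mul]

lemma moll_eq_zero {f : EucSp d → ℝ} {R : ℝ} (hf : ∀ x, R < ‖x‖ → f x = 0) {r : ℝ} {x : EucSp d}
    (hx : R + |r| < ‖x‖) : moll r f x = 0 := by
  refine setIntegral_eq_zero_of_forall_eq_zero (μ := volume) fun h hh => ?_
  rw [hf, mul_zero]
  have h1 : ‖r • h‖ ≤ |r| := by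
    rw [norm_smul, Real.norm_eq_abs]
    exact mul_le_of_le_one_right (abs_nonneg _) (by simpa using hh)
  have h2 := norm_sub_le (x + r • h) (r • h)
  rw [add_sub_cancel_right] at h2
  linarith

/-- A change of variables moves the base point into the bump, so that derivatives cost powers of the
scale rather than regularity of `f`. -/
lemma moll_eq_integral_kernel {r : ℝ} (hr : 0 < r) (f : EucSp d → ℝ) (x : EucSp d) :
    moll r f x = (r ^ d)⁻¹ * ∫ h, mollBump d (r⁻¹ • (x + -h)) * f h := by
  have h1 := Measure.integral_comp_smul (volume : Measure (EucSp d))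
    (fun y => mollBump d (r⁻¹ • y) * f (x + y)) r
  have h2 := integral_add_left_eq_self (μ := (volume : Measure (EucSp d)))
    (fun y => mollBump d (r⁻¹ • (y - x)) * f y) x
  rw [moll, setIntegral_mollBump_mul fun h => f (x + r • h)]
  simp only [smul_smul, inv_mul_cancel₀ hr.ne', one_smul, add_sub_cancel_left] at h1 h2
  rw [h1, h2, smul_eq_mul, abs_of_pos (by positivity)]
  simp only [finrank_euclideanSpace, Fintype.card_fin]
  congr 2
  funext h
  rw [← mollBump_neg, ← smul_neg, neg_sub, sub_eq_add_neg]

end Moll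
end

noncomputable section

/-! ### Bernstein-type estimates and the Besov bound. -/

section ENNRealAux

lemma lintegral_rpow_le_measure_mul {α : Type*} [MeasurableSpace α] {μ : Measure α} {q : ℝ}
    (hq : 1 < q) {f : α → ℝ≥0∞} (hf : AEMeasurable f μ) :
    ∫⁻ a, f a ∂μ ≤ μ univ ^ (1 - 1 / q) * (∫⁻ a, f a ^ q ∂μ) ^ (1 / q) := by
  have hc : q.HolderConjugate (q / (q - 1)) := Real.HolderConjugate.conjExponent hq
  have h := ENNReal.lintegral_mul_le_Lp_mul_Lq μ hc hf (aemeasurable_const (b := (1 : ℝ≥0∞)))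
  simp only [Pi.mul_apply, mul_one, ENNReal.one_rpow, lintegral_const, one_mul] at h
  rw [mul_comm]
  convert h using 3
  have h1 : q - 1 ≠ 0 := by linarith
  have h2 : q ≠ 0 := by linarith
  field_simp

/-- Passage from an `ℓ¹` sum to an `ℓ^q` sum: every weighted term is at most the full `ℓ^q` norm,
and the inverse weights form a convergent geometric series. The price is an arbitrarily small
exponent `δ`. -/
lemma exists_tsum_rpow_le {δ q : ℝ} (hδ : 0 < δ) (hq : 0 < q) :
    ∃ C : ℝ≥0∞, C ≠ ∞ ∧ ∀ X : ℕ → ℝ≥0∞,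
      (∑' n, X n) ^ q ≤ C * ∑' n : ℕ, (ENNReal.ofReal (2 ^ (δ * n)) * X n) ^ q := by
  set K : ℝ≥0∞ := ∑' n : ℕ, ENNReal.ofReal (((2 : ℝ) ^ (-δ)) ^ n) with hKdef
  have hK : K ≠ ∞ := by
    rw [hKdef, ← ENNReal.ofReal_tsum_of_nonneg (fun n => by positivity)
      (summable_geometric_of_lt_one (by positivity)
        (Real.rpow_lt_one_of_one_lt_of_neg one_lt_two (by linarith)))]
    exact ENNReal.ofReal_ne_top
  refine ⟨K ^ q, ENNReal.rpow_ne_top_of_nonneg hq.le hK, fun X => ?_⟩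
  set Y := ∑' n : ℕ, (ENNReal.ofReal (2 ^ (δ * n)) * X n) ^ q
  have h1 : ∀ n : ℕ, X n ≤ ENNReal.ofReal (((2 : ℝ) ^ (-δ)) ^ n) * Y ^ (1 / q) := by
    intro n
    have h2 : ENNReal.ofReal (2 ^ (δ * n)) * X n ≤ Y ^ (1 / q) := by
      rw [one_div, ENNReal.le_rpow_inv_iff hq]
      exact ENNReal.le_tsum n
    calc X n = ENNReal.ofReal (((2 : ℝ) ^ (-δ)) ^ n) * (ENNReal.ofReal (2 ^ (δ * n)) * X n) := by
          rw [← mul_assoc, ← ENNReal.ofReal_mul (by positivity), ← Real.rpow_natCast,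
            ← Real.rpow_mul (by positivity), ← Real.rpow_add (by positivity)]
          simp
      _ ≤ _ := by gcongr
  calc (∑' n, X n) ^ q ≤ (∑' n : ℕ, ENNReal.ofReal (((2 : ℝ) ^ (-δ)) ^ n) * Y ^ (1 / q)) ^ q := by
        gcongr with n; exact h1 n
    _ = K ^ q * Y := by
        rw [ENNReal.tsum_mul_right, ENNReal.mul_rpow_of_nonneg _ _ hq.le, ← ENNReal.rpow_mul,
          one_div_mul_cancel hq.ne', ENNReal.rpow_one]

end ENNRealAux

section EvMoll

variable {d : ℕ}

lemma HFun.ev_setIntegral {m : ℕ} {f : EucSp d → EucSp d → ℝ} (hf : NiceFam m f) {l : HFun d}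
    (hl : l.L.length ≤ m) {S : Set (EucSp d)} (hS : IsCompact S) (hSm : MeasurableSet S) :
    l.ev (fun x => ∫ h in S, f h x) = ∫ h in S, l.ev (f h) := by
  have h := fun x : EucSp d => (hf.continuous l.L hl).comp
    (by fun_prop : Continuous fun q : EucSp d => (q, x))
  unfold HFun.ev
  rw [hf.listD_integral hS hSm hl, hf.listD_integral hS hSm hl, integral_add,
    integral_const_mul, integral_const_mul]
  · exact Continuous.integrableOn_compact (ν := volume) (continuous_const.mul (h l.x)) hS hSm
  · exact Continuous.integrableOn_compact (ν := volume) (continuous_const.mul (h l.x')) hS hSm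

lemma ev_mollBump_eq_zero {r : ℝ} (hr : 0 < r) (h : EucSp d) (l : HFun d)
    (hh : h ∉ Metric.closedBall l.x r ∪ Metric.closedBall l.x' r) :
    (l.ev fun x => mollBump d (r⁻¹ • (x + -h))) = 0 := by
  have h0 : ∀ x, h ∉ Metric.closedBall x r →
      listD l.L (fun x => mollBump d (r⁻¹ • (x + -h))) x = 0 := by
    intro x hx
    rw [listD_comp_add_right l.L (fun x => mollBump d (r⁻¹ • x)) (-h),
      listD_comp_smul l.L (contDiff_mollBump _)]
    simp only
    rw [listD_eq_zero_of_lt (R := 1) (fun y hy => mollBump_eq_zero hy.le), mul_zero]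
    rw [norm_smul, Real.norm_of_nonneg (by positivity), ← sub_eq_add_neg, ← dist_eq_norm,
      lt_inv_mul_iff₀ hr, mul_one, dist_comm]
    simpa using hx
  simp only [mem_union, not_or] at hh
  simp only [HFun.ev]
  rw [h0 _ hh.1, h0 _ hh.2]
  simp

/-- A Bernstein inequality: on functions smoothed at scale `r`, a functional of order `θ` costs
`r^{-θ}` and the passage from `L^q` to pointwise values costs `r^{-d/q}`. Compact support of `g`
serves only to write the mollification as an integral over a compact set. -/
lemma exists_enorm_ev_moll_le {θ q : ℝ} (hθ : 0 ≤ θ) (hq : 1 < q) (r₀ : ℝ) :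
    ∃ C : ℝ≥0∞, C ≠ ∞ ∧ ∀ r, 0 < r → r ≤ r₀ → ∀ (g : EucSp d → ℝ), Continuous g →
      (∃ R : ℝ, ∀ x, R < ‖x‖ → g x = 0) → ∀ l : HFun d, l.Adm θ →
      ‖l.ev (moll r g)‖ₑ ≤ C * ENNReal.ofReal (r ^ (-(θ + d / q))) *
        (∫⁻ x, ‖g x‖ₑ ^ q) ^ (1 / q) := by
  obtain ⟨A, hA0, hA⟩ := exists_ev_mollBump_le (d := d) hθ r₀
  set ω : ℝ≥0∞ := volume (Metric.ball (0 : EucSp d) 1)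
  have hω : ω ≠ ∞ := measure_ball_lt_top.ne
  have hexp : 0 ≤ 1 - 1 / q := by
    rw [sub_nonneg, div_le_one (by linarith)]; exact hq.le
  refine ⟨ENNReal.ofReal A * (2 * ω) ^ (1 - 1 / q), ENNReal.mul_ne_top ENNReal.ofReal_ne_top
    (ENNReal.rpow_ne_top_of_nonneg hexp (ENNReal.mul_ne_top (by simp) hω)),
    fun r hr hr₀ g hg ⟨R, hR⟩ l hl => ?_⟩
  set S := Metric.closedBall (0 : EucSp d) R
  -- The functional sees the bump only at its two base points, so its kernel vanishes off the two
  -- balls of radius `r` around them.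
  set B := Metric.closedBall l.x r ∪ Metric.closedBall l.x' r
  have hBm : MeasurableSet B := measurableSet_closedBall.union measurableSet_closedBall
  have hBv : volume B ≤ 2 * ω * ENNReal.ofReal (r ^ (d : ℝ)) := by
    refine (measure_union_le _ _).trans_eq ?_
    rw [Measure.addHaar_closedBall _ _ hr.le, Measure.addHaar_closedBall _ _ hr.le]
    simp only [finrank_euclideanSpace, Fintype.card_fin, Real.rpow_natCast]
    ring
  set k : EucSp d → ℝ := fun h => l.ev fun x => mollBump d (r⁻¹ • (x + -h))
  have hnice : NiceFam ⌊θ⌋₊ fun (h : EucSp d) x => mollBump d (r⁻¹ • (x + -h)) * g h := by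
    refine NiceFam.mul_const ?_ hg
    exact (NiceFam.of_contDiff (f := fun x => mollBump d (r⁻¹ • x))
      ((contDiff_mollBump _).comp (contDiff_const_smul _))).comp_add (by fun_prop)
  have h1 : l.ev (moll r g) = (r ^ d)⁻¹ * ∫ h in S, k h * g h := by
    have : moll r g = fun x => (r ^ d)⁻¹ * ∫ h in S, mollBump d (r⁻¹ • (x + -h)) * g h := by
      funext x
      rw [moll_eq_integral_kernel hr, setIntegral_eq_integral_of_forall_compl_eq_zero]
      intro h hh
      rw [hR h (by simpa [S] using hh), mul_zero]
    rw [this, HFun.ev_const_mul, HFun.ev_setIntegral hnice hl.1 (isCompact_closedBall _ _)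
      measurableSet_closedBall]
    simp only [HFun.ev_mul_const, k, S]
  have h2 : ‖∫ h in S, k h * g h‖ₑ ≤
      ENNReal.ofReal (A * r ^ (-θ)) * ∫⁻ h in B, ‖g h‖ₑ := by
    refine (enorm_integral_le_lintegral_enorm _).trans ((setLIntegral_le_lintegral _ _).trans ?_)
    rw [← lintegral_const_mul' _ _ ENNReal.ofReal_ne_top, ← lintegral_indicator hBm]
    refine lintegral_mono fun h => ?_
    by_cases hh : h ∈ B
    · rw [indicator_of_mem hh, enorm_mul]
      gcongr
      rw [← ofReal_norm]
      exact ENNReal.ofReal_le_ofReal (hA r hr hr₀ (-h) l hl)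
    · have : k h = 0 := ev_mollBump_eq_zero hr h l hh
      simp [indicator_of_notMem hh, this]
  -- Hölder's inequality on `B`, of volume at most a multiple of `r^d`, gains `r^{d(1-1/q)}`.
  -- Against the factor `r^{-d}` of the kernel this leaves `r^{-d/q}`.
  have h3 : ∫⁻ h in B, ‖g h‖ₑ ≤ (2 * ω) ^ (1 - 1 / q) * ENNReal.ofReal (r ^ ((d : ℝ) * (1 - 1 / q))) *
      (∫⁻ x, ‖g x‖ₑ ^ q) ^ (1 / q) := by
    refine (lintegral_rpow_le_measure_mul hq hg.enorm.measurable.aemeasurable).trans ?_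
    rw [Measure.restrict_apply_univ]
    gcongr
    · calc volume B ^ (1 - 1 / q) ≤ (2 * ω * ENNReal.ofReal (r ^ (d : ℝ))) ^ (1 - 1 / q) := by gcongr
        _ = _ := by
          rw [ENNReal.mul_rpow_of_nonneg _ _ hexp, ENNReal.ofReal_rpow_of_nonneg (by positivity) hexp,
            ← Real.rpow_mul hr.le]
    · exact Measure.restrict_le_self
  rw [h1, enorm_mul, Real.enorm_eq_ofReal (by positivity)]
  calc _ ≤ ENNReal.ofReal ((r ^ d)⁻¹) * (ENNReal.ofReal (A * r ^ (-θ)) *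
        ((2 * ω) ^ (1 - 1 / q) * ENNReal.ofReal (r ^ ((d : ℝ) * (1 - 1 / q))) *
      (∫⁻ x, ‖g x‖ₑ ^ q) ^ (1 / q))) := by gcongr; exact h2.trans (by gcongr)
    _ = ENNReal.ofReal A * (2 * ω) ^ (1 - 1 / q) * ENNReal.ofReal ((r ^ d)⁻¹ * r ^ (-θ) *
        r ^ ((d : ℝ) * (1 - 1 / q))) * (∫⁻ x, ‖g x‖ₑ ^ q) ^ (1 / q) := by
        rw [ENNReal.ofReal_mul hA0, ENNReal.ofReal_mul (by positivity),
          ENNReal.ofReal_mul (by positivity)]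
        ring
    _ = _ := by
        congr 3
        rw [← Real.rpow_natCast, ← Real.rpow_neg hr.le, ← Real.rpow_add hr, ← Real.rpow_add hr]
        congr 1; ring

end EvMoll

section QMoll

variable {d : ℕ} {M : ℕ}

/-- Coefficients of the combination of mollifications with many vanishing moments. -/
def qcoef (M j : ℕ) : ℝ := (-1) ^ j * M.choose (j + 1)

/-- A combination of mollifications at scale `s` approximating to order `M`. -/
def qmoll (M : ℕ) (s : ℝ) (f : EucSp d → ℝ) (x : EucSp d) : ℝ :=
  ∑ j ∈ Finset.range M, qcoef M j * moll ((j + 1) * s) f x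

/-- The dyadic blocks `Q_n - Q_{n-1}`, where `Q_n = qmoll M 2⁻ⁿ` and `Q_{-1} = 0`. -/
def qblock (M : ℕ) : ℕ → (EucSp d → ℝ) → EucSp d → ℝ
  | 0, f, x => qmoll M 1 f x
  | n + 1, f, x => qmoll M ((1 / 2) ^ (n + 1)) f x - qmoll M ((1 / 2) ^ n) f x

lemma sum_qcoef (hM : M ≠ 0) : ∑ j ∈ Finset.range M, qcoef M j = 1 := by
  have h := Int.alternating_sum_range_choose_of_ne hM
  rw [Finset.sum_range_succ'] at h
  have h' : ∑ j ∈ Finset.range M, ((-1 : ℤ)) ^ j * M.choose (j + 1) = 1 := by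
    simp only [pow_succ, mul_neg_one, neg_mul, Finset.sum_neg_distrib, pow_zero, Nat.choose_zero_right] at h
    push_cast at h
    linarith
  unfold qcoef
  exact_mod_cast h'

lemma qmoll_zero (hM : M ≠ 0) (f : EucSp d → ℝ) : qmoll M 0 f = f := by
  funext x
  simp [qmoll, moll_zero, ← Finset.sum_mul, sum_qcoef hM]

lemma continuous_qmoll_family {P : Type*} [TopologicalSpace P] [FirstCountableTopology P]
    {f : P → EucSp d → ℝ} (hf : Continuous f.uncurry) :
    Continuous fun w : P × ℝ × EucSp d => qmoll M w.2.1 (f w.1) w.2.2 :=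
  continuous_finsetSum _ fun _ _ => continuous_const.mul ((continuous_moll_family hf).comp
    (by fun_prop : Continuous fun w : P × ℝ × EucSp d => (w.1, _ * w.2.1, w.2.2)))

lemma continuous_qmoll {f : EucSp d → ℝ} (hf : Continuous f) (s : ℝ) : Continuous (qmoll M s f) :=
  continuous_finsetSum _ fun _ _ => continuous_const.mul (continuous_moll hf _)

lemma contDiff_qmoll {m : ℕ} {f : EucSp d → ℝ} (hf : ContDiff ℝ m f) (s : ℝ) :
    ContDiff ℝ m (qmoll M s f) :=
  ContDiff.sum fun _ _ => contDiff_const.mul (contDiff_moll hf _)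

lemma listD_sum {ι : Type*} {L : List (Fin d)} (s : Finset ι) {f : ι → EucSp d → ℝ}
    (hf : ∀ i ∈ s, ContDiff ℝ L.length (f i)) :
    listD L (fun x => ∑ i ∈ s, f i x) = fun x => ∑ i ∈ s, listD L (f i) x := by
  classical
  induction s using Finset.induction_on with
  | empty => simpa using listD_const_mul L 0 fun _ => 0
  | insert i s hi ih =>
    simp only [Finset.sum_insert hi]
    rw [listD_add L (hf i (by simp)) (ContDiff.sum fun j hj => hf j (by simp [hj])),
      ih fun j hj => hf j (by simp [hj])]

lemma HFun.ev_sum {θ : ℝ} {l : HFun d} (hl : l.Adm θ) {ι : Type*} (s : Finset ι)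
    {f : ι → EucSp d → ℝ} (hf : ∀ i ∈ s, ContDiff ℝ ⌊θ⌋₊ (f i)) :
    l.ev (fun x => ∑ i ∈ s, f i x) = ∑ i ∈ s, l.ev (f i) := by
  have h : (l.L.length : WithTop ℕ∞) ≤ ⌊θ⌋₊ := by exact_mod_cast hl.1
  simp only [HFun.ev, listD_sum s fun i hi => (hf i hi).of_le h, Finset.mul_sum,
    Finset.sum_add_distrib]

lemma listD_qmoll {m : ℕ} {f : EucSp d → ℝ} (hf : ContDiff ℝ m f) (s : ℝ) {L : List (Fin d)}
    (hL : L.length ≤ m) : listD L (qmoll M s f) = qmoll M s (listD L f) := by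
  have h : (L.length : WithTop ℕ∞) ≤ m := by exact_mod_cast hL
  unfold qmoll
  rw [listD_sum _ fun j _ => contDiff_const.mul (contDiff_moll (hf.of_le h) _)]
  simp only [listD_const_mul, listD_moll hf _ hL]

lemma qmoll_comm {f : EucSp d → ℝ} (hf : Continuous f) (s t : ℝ) :
    qmoll M s (qmoll M t f) = qmoll M t (qmoll M s f) := by
  funext x
  have h : ∀ s t, qmoll M s (qmoll M t f) x = ∑ j ∈ Finset.range M, ∑ k ∈ Finset.range M,
      qcoef M j * qcoef M k * moll ((j + 1) * s) (moll ((k + 1) * t) f) x := by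
    intro s t
    simp only [qmoll]
    refine Finset.sum_congr rfl fun j _ => ?_
    have := moll_sum (Finset.range M) (qcoef M) (f := fun k => moll ((k + 1) * t) f)
      (fun k _ => continuous_moll hf _) ((j + 1) * s) x
    rw [show moll ((j + 1) * s) (qmoll M t f) x = _ from this, Finset.mul_sum]
    exact Finset.sum_congr rfl fun k _ => by ring
  rw [h, h, Finset.sum_comm]
  refine Finset.sum_congr rfl fun j _ => Finset.sum_congr rfl fun k _ => ?_
  rw [moll_comm hf]; ring

lemma qmoll_sub {f g : EucSp d → ℝ} (hf : Continuous f) (hg : Continuous g) (s : ℝ) (x : EucSp d) :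
    qmoll M s (fun x => f x - g x) x = qmoll M s f x - qmoll M s g x := by
  simp only [qmoll, moll_sub hf hg, mul_sub, Finset.sum_sub_distrib]

lemma qmoll_eq_zero {f : EucSp d → ℝ} {R : ℝ} (hf : ∀ x, R < ‖x‖ → f x = 0) {s : ℝ} (hs₀ : 0 ≤ s)
    (hs₁ : s ≤ 1) {x : EucSp d} (hx : R + M < ‖x‖) : qmoll M s f x = 0 := by
  refine Finset.sum_eq_zero fun j hj => ?_
  rw [moll_eq_zero hf, mul_zero]
  refine lt_of_le_of_lt ?_ hx
  rw [abs_of_nonneg (by positivity)]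
  have : (j : ℝ) + 1 ≤ M := by exact_mod_cast Finset.mem_range.mp hj
  nlinarith

lemma contDiff_qblock {m : ℕ} {f : EucSp d → ℝ} (hf : ContDiff ℝ m f) (n : ℕ) :
    ContDiff ℝ m (qblock M n f) := by
  cases n with
  | zero => exact contDiff_qmoll hf _
  | succ n => exact (contDiff_qmoll hf _).sub (contDiff_qmoll hf _)

lemma qblock_eq_zero {f : EucSp d → ℝ} {R : ℝ} (hf : ∀ x, R < ‖x‖ → f x = 0) (n : ℕ)
    {x : EucSp d} (hx : R + M < ‖x‖) : qblock M n f x = 0 := by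
  have h : ∀ n : ℕ, ((1 : ℝ) / 2) ^ n ≤ 1 := fun n => pow_le_one₀ (by norm_num) (by norm_num)
  cases n with
  | zero => exact qmoll_eq_zero hf zero_le_one le_rfl hx
  | succ n =>
    simp only [qblock]
    rw [qmoll_eq_zero hf (by positivity) (h _) hx, qmoll_eq_zero hf (by positivity) (h _) hx, sub_zero]

/-- Derivatives commute with `qmoll`, so this is continuity of the doubly smoothed derivative at
scale `0`, where `qmoll` is the identity. -/
lemma tendsto_ev_qmoll_qmoll {θ : ℝ} (hM : M ≠ 0) {f : EucSp d → ℝ} (hf : ContDiff ℝ ⌊θ⌋₊ f)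
    {l : HFun d} (hl : l.Adm θ) :
    Tendsto (fun N : ℕ => l.ev (qmoll M ((1 / 2) ^ N) (qmoll M ((1 / 2) ^ N) f))) atTop
      (𝓝 (l.ev f)) := by
  have hs : Tendsto (fun N : ℕ => ((1 : ℝ) / 2) ^ N) atTop (𝓝 0) :=
    tendsto_pow_atTop_nhds_zero_of_lt_one (by norm_num) (by norm_num)
  have key : ∀ x, Tendsto (fun N : ℕ =>
      listD l.L (qmoll M ((1 / 2) ^ N) (qmoll M ((1 / 2) ^ N) f)) x) atTop (𝓝 (listD l.L f x)) := by
    intro x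
    have hg : Continuous (listD l.L f) := continuous_listD hf hl.1
    simp only [listD_qmoll (contDiff_qmoll hf _) _ hl.1, listD_qmoll hf _ hl.1]
    generalize listD l.L f = g at hg ⊢
    have h1 := (continuous_qmoll_family (M := M) (P := Unit) (f := fun _ => g)
      (hg.comp continuous_snd)).comp (by fun_prop : Continuous fun w : ℝ × EucSp d => ((), w.1, w.2))
    have h2 := (continuous_qmoll_family (M := M) (f := fun s => qmoll M s g) h1).comp
      (by fun_prop : Continuous fun s : ℝ => (s, s, x))
    have h3 := (h2.tendsto 0).comp hs
    simp only [Function.comp_def, qmoll_zero hM] at h3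
    exact h3
  exact ((key l.x).const_mul _).add ((key l.x').const_mul _)

lemma exists_enorm_ev_qmoll_le {θ q : ℝ} (hθ : 0 ≤ θ) (hq : 1 < q) (M : ℕ) :
    ∃ C : ℝ≥0∞, C ≠ ∞ ∧ ∀ (n : ℕ) (g : EucSp d → ℝ), ContDiff ℝ ⌊θ⌋₊ g →
      (∃ R : ℝ, ∀ x, R < ‖x‖ → g x = 0) → ∀ l : HFun d, l.Adm θ →
      ‖l.ev (qmoll M ((1 / 2) ^ n) g)‖ₑ ≤ C * (ENNReal.ofReal (2 ^ ((θ + d / q) * n)) *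
        (∫⁻ x, ‖g x‖ₑ ^ q) ^ (1 / q)) := by
  obtain ⟨C, hC, h⟩ := exists_enorm_ev_moll_le (d := d) hθ hq M
  refine ⟨∑ j ∈ Finset.range M, ‖qcoef M j‖ₑ * C, ENNReal.sum_ne_top.mpr fun j _ =>
    ENNReal.mul_ne_top enorm_ne_top hC, fun n g hg hR l hl => ?_⟩
  unfold qmoll
  rw [HFun.ev_sum hl _ fun j _ => contDiff_const.mul (contDiff_moll hg _), Finset.sum_mul]
  refine (enorm_sum_le _ _).trans (Finset.sum_le_sum fun j hj => ?_)
  rw [HFun.ev_const_mul, enorm_mul, mul_assoc, ← mul_assoc C]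
  gcongr
  have hj' : (j : ℝ) + 1 ≤ M := by exact_mod_cast Finset.mem_range.mp hj
  have hpow : ((1 : ℝ) / 2) ^ n ≤ 1 := pow_le_one₀ (by norm_num) (by norm_num)
  have hpos : (0 : ℝ) < (1 / 2) ^ n := by positivity
  refine (h _ (by positivity) (by nlinarith) g hg.continuous hR l hl).trans ?_
  gcongr
  have hσ : 0 ≤ θ + d / q := by positivity
  have h2 : (2 : ℝ) ^ ((θ + d / q) * n) = ((1 / 2) ^ n) ^ (-(θ + d / q)) := by
    rw [← Real.rpow_natCast, ← Real.rpow_mul (by norm_num), one_div, Real.inv_rpow (by norm_num),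
      ← Real.rpow_neg (by norm_num)]
    congr 1; ring
  rw [h2]
  refine Real.rpow_le_rpow_of_nonpos hpos ?_ (by linarith)
  have : (0 : ℝ) ≤ j := Nat.cast_nonneg j
  nlinarith

/-- A Besov-type bound for the functionals of order `θ` in terms of the `L^q` norms of the dyadic
blocks. -/
lemma exists_enorm_ev_rpow_le {θ q θ' : ℝ} (hθ : 0 ≤ θ) (hq : 1 < q) (hθ' : θ + d / q < θ')
    (hM : M ≠ 0) :
    ∃ C : ℝ≥0∞, C ≠ ∞ ∧ ∀ f : EucSp d → ℝ, ContDiff ℝ ⌊θ⌋₊ f →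
      (∃ R : ℝ, ∀ x, R < ‖x‖ → f x = 0) → ∀ l : HFun d, l.Adm θ →
      ‖l.ev f‖ₑ ^ q ≤ C * ∑' n : ℕ, ENNReal.ofReal (2 ^ (θ' * q * n)) *
        ∫⁻ x, ‖qblock M n f x‖ₑ ^ q := by
  have hq0 : 0 < q := by linarith
  obtain ⟨C, hC, hev⟩ := exists_enorm_ev_qmoll_le (d := d) hθ hq M
  obtain ⟨K, hK, hsum⟩ := exists_tsum_rpow_le (δ := θ' - (θ + d / q)) (by linarith) hq0
  refine ⟨(2 * C) ^ q * K, ENNReal.mul_ne_top (ENNReal.rpow_ne_top_of_nonneg hq0.le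
    (ENNReal.mul_ne_top (by simp) hC)) hK, fun f hf ⟨R, hR⟩ l hl => ?_⟩
  have hfc := hf.continuous
  set X : ℕ → ℝ≥0∞ := fun n => ENNReal.ofReal (2 ^ ((θ + d / q) * n)) *
        (∫⁻ x, ‖qblock M n f x‖ₑ ^ q) ^ (1 / q) with hX
  have hB : ∀ n, ∃ R : ℝ, ∀ x, R < ‖x‖ → qblock M n f x = 0 :=
    fun n => ⟨R + M, fun x hx => qblock_eq_zero hR n hx⟩
  have hN : ∀ N : ℕ, ‖l.ev (qmoll M ((1 / 2) ^ N) (qmoll M ((1 / 2) ^ N) f))‖ₑ ≤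
      ∑ n ∈ Finset.range (N + 1), 2 * C * X n := by
    intro N
    induction N with
    | zero =>
      have h0 := hev 0 (qblock M 0 f) (contDiff_qblock hf 0) (hB 0) l hl
      simp only [zero_add, Finset.range_one, Finset.sum_singleton]
      calc _ ≤ C * X 0 := by
            have : qblock M 0 f = qmoll M ((1 / 2) ^ 0) f := by funext x; simp [qblock]
            rw [this] at h0
            simpa only [hX, this] using h0
        _ ≤ 2 * (C * X 0) := le_mul_of_one_le_left (by simp) (by norm_num)
        _ = _ := by ring
    | succ N ih =>
      set a : ℝ := (1 / 2) ^ N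
      set b : ℝ := (1 / 2) ^ (N + 1)
      -- As `Q_a` and `Q_b` commute, `Q_b² - Q_a² = (Q_b + Q_a)(Q_b - Q_a)`. Squaring the
      -- approximation thus leaves each dyadic block under one further mollification, to which the
      -- Bernstein inequality applies. The two terms account for the factor `2`.
      have hdec : qmoll M b (qmoll M b f) = fun x => qmoll M a (qmoll M a f) x +
          (qmoll M b (qblock M (N + 1) f) x + qmoll M a (qblock M (N + 1) f) x) := by
        funext x
        have e : qblock M (N + 1) f = fun x => qmoll M b f x - qmoll M a f x := rfl
        rw [e, qmoll_sub (continuous_qmoll hfc _) (continuous_qmoll hfc _),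
          qmoll_sub (continuous_qmoll hfc _) (continuous_qmoll hfc _), qmoll_comm hfc b a]
        ring
      have hc := contDiff_qblock (M := M) hf (N + 1)
      rw [hdec, HFun.ev_add hl (contDiff_qmoll (contDiff_qmoll hf _) _)
        ((contDiff_qmoll hc _).add (contDiff_qmoll hc _)),
        HFun.ev_add hl (contDiff_qmoll hc _) (contDiff_qmoll hc _), Finset.sum_range_succ]
      refine (enorm_add_le _ _).trans (add_le_add ih ?_)
      refine (enorm_add_le _ _).trans ?_
      calc _ ≤ C * X (N + 1) + C * X (N + 1) := by
            refine add_le_add (hev (N + 1) _ hc (hB _) l hl)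
              ((hev N _ hc (hB _) l hl).trans ?_)
            simp only [hX]
            gcongr
            · norm_num
            · simp
        _ = _ := by ring
  have hlim : ‖l.ev f‖ₑ ≤ 2 * C * ∑' n, X n := by
    refine le_of_tendsto' (tendsto_ev_qmoll_qmoll hM hf hl).enorm fun N => (hN N).trans ?_
    rw [← Finset.mul_sum]
    gcongr
    exact ENNReal.sum_le_tsum _
  calc ‖l.ev f‖ₑ ^ q ≤ (2 * C * ∑' n, X n) ^ q := by gcongr
    _ = (2 * C) ^ q * (∑' n, X n) ^ q := ENNReal.mul_rpow_of_nonneg _ _ hq0.le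
    _ ≤ (2 * C) ^ q * (K * _) := by gcongr; exact hsum X
    _ = _ := by
      rw [← mul_assoc]
      congr 2
      funext n
      simp only [hX]
      rw [← mul_assoc, ← ENNReal.ofReal_mul (by positivity), ENNReal.mul_rpow_of_nonneg _ _ hq0.le,
        ← ENNReal.rpow_mul, one_div_mul_cancel hq0.ne', ENNReal.rpow_one,
        ENNReal.ofReal_rpow_of_nonneg (by positivity) hq0.le, ← Real.rpow_add (by norm_num),
        ← Real.rpow_mul (by norm_num)]
      congr 3; ring

end QMoll
end

noncomputable section

/-! ### Besov bounds for the full norms in one and two variables. -/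

section BesovNorm

variable {d M : ℕ} {θ q θ' : ℝ}

lemma ENNReal.iSup₂_rpow_le {ι : Type*} {p : ι → Prop} {f : ι → ℝ≥0∞} {q : ℝ} (hq : 0 < q)
    {B : ℝ≥0∞} (h : ∀ i, p i → f i ^ q ≤ B) : (⨆ (i) (_ : p i), f i) ^ q ≤ B := by
  rw [← ENNReal.le_rpow_inv_iff hq]
  exact iSup₂_le fun i hi => (ENNReal.le_rpow_inv_iff hq).mpr (h i hi)

lemma exists_hsup_rpow_le (hθ : 0 ≤ θ) (hq : 1 < q) (hθ' : θ + d / q < θ') (hM : M ≠ 0) :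
    ∃ C : ℝ≥0∞, C ≠ ∞ ∧ ∀ f : EucSp d → ℝ, ContDiff ℝ ⌊θ⌋₊ f →
      (∃ R : ℝ, ∀ x, R < ‖x‖ → f x = 0) →
      hsup θ f ^ q ≤ C * ∑' n : ℕ, ENNReal.ofReal (2 ^ (θ' * q * n)) *
        ∫⁻ x, ‖qblock M n f x‖ₑ ^ q := by
  obtain ⟨C, hC, h⟩ := exists_enorm_ev_rpow_le (d := d) hθ hq hθ' hM
  exact ⟨C, hC, fun f hf hR => ENNReal.iSup₂_rpow_le (by linarith) fun l hl => h f hf hR l hl⟩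

lemma NiceFam₂.niceFam_moll_integrand {m : ℕ} {U : EucSp d → EucSp d → ℝ}
    (hU : NiceFam₂ m fun _ : Unit => U) (r : ℝ) (z : EucSp d) :
    NiceFam m fun (h : EucSp d) x => mollBump d h * U x (z + r • h) :=
  (hU.fst.comp (by fun_prop : Continuous fun h : EucSp d => ((), z + r • h))).const_mul
    continuous_mollBump

lemma NiceFam₂.contDiff_moll {m : ℕ} {U : EucSp d → EucSp d → ℝ}
    (hU : NiceFam₂ m fun _ : Unit => U) (r : ℝ) (z : EucSp d) :
    ContDiff ℝ m fun x => moll r (U x) z :=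
  (NiceFam.contDiff_integral (isCompact_closedBall _ _) measurableSet_closedBall
    (hU.niceFam_moll_integrand r z)).1

lemma NiceFam₂.contDiff_qmoll {m : ℕ} {U : EucSp d → EucSp d → ℝ}
    (hU : NiceFam₂ m fun _ : Unit => U) (s : ℝ) (z : EucSp d) :
    ContDiff ℝ m fun x => qmoll M s (U x) z :=
  ContDiff.sum fun _ _ => contDiff_const.mul (hU.contDiff_moll _ z)

lemma NiceFam₂.contDiff_qblock {m : ℕ} {U : EucSp d → EucSp d → ℝ}
    (hU : NiceFam₂ m fun _ : Unit => U) (n : ℕ) (z : EucSp d) :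
    ContDiff ℝ m fun x => qblock M n (U x) z := by
  cases n with
  | zero => exact hU.contDiff_qmoll _ z
  | succ n => exact (hU.contDiff_qmoll _ z).sub (hU.contDiff_qmoll _ z)

lemma moll_ev {U : EucSp d → EucSp d → ℝ} (hU : NiceFam₂ ⌊θ⌋₊ fun _ : Unit => U) {l : HFun d}
    (hl : l.Adm θ) (r : ℝ) (z : EucSp d) :
    moll r (fun z => l.ev fun x => U x z) z = l.ev fun x => moll r (U x) z := by
  have := HFun.ev_setIntegral (hU.niceFam_moll_integrand r z) hl.1
    (isCompact_closedBall (0 : EucSp d) 1) measurableSet_closedBall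
  simp only [HFun.ev_const_mul] at this
  exact this.symm

lemma qmoll_ev {U : EucSp d → EucSp d → ℝ} (hU : NiceFam₂ ⌊θ⌋₊ fun _ : Unit => U) {l : HFun d}
    (hl : l.Adm θ) (s : ℝ) (z : EucSp d) :
    qmoll M s (fun z => l.ev fun x => U x z) z = l.ev fun x => qmoll M s (U x) z := by
  unfold qmoll
  rw [HFun.ev_sum hl _ fun j _ => contDiff_const.mul (hU.contDiff_moll _ z)]
  simp only [HFun.ev_const_mul, moll_ev hU hl]

lemma qblock_ev {U : EucSp d → EucSp d → ℝ} (hU : NiceFam₂ ⌊θ⌋₊ fun _ : Unit => U) {l : HFun d}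
    (hl : l.Adm θ) (n : ℕ) (z : EucSp d) :
    qblock M n (fun z => l.ev fun x => U x z) z = l.ev fun x => qblock M n (U x) z := by
  cases n with
  | zero => exact qmoll_ev hU hl _ z
  | succ n =>
    simp only [qblock, qmoll_ev hU hl]
    rw [HFun.ev_sub hl (hU.contDiff_qmoll _ z) (hU.contDiff_qmoll _ z)]

lemma qblock_zero_fun (n : ℕ) (x : EucSp d) : qblock M n (fun _ => 0) x = 0 := by
  cases n <;> simp [qblock, qmoll, moll]

/-- The one-variable bound is iterated, first in `z` for a fixed functional in `x`, then in `x`. -/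
lemma exists_hsup₂_rpow_le (hθ : 0 ≤ θ) (hq : 1 < q) (hθ' : θ + d / q < θ') (hM : M ≠ 0) :
    ∃ C : ℝ≥0∞, C ≠ ∞ ∧ ∀ U : EucSp d → EucSp d → ℝ, NiceFam₂ ⌊θ⌋₊ (fun _ : Unit => U) →
      (∃ R : ℝ, ∀ x z, R < ‖x‖ → U x z = 0) → (∃ R : ℝ, ∀ x z, R < ‖z‖ → U x z = 0) →
      hsup₂ θ U ^ q ≤ C * ∑' n : ℕ, ENNReal.ofReal (2 ^ (θ' * q * n)) *
        ∫⁻ z, ∑' k : ℕ, ENNReal.ofReal (2 ^ (θ' * q * k)) *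
          ∫⁻ x, ‖qblock M k (fun x => qblock M n (U x) z) x‖ₑ ^ q := by
  obtain ⟨C, hC, h⟩ := exists_hsup_rpow_le (d := d) hθ hq hθ' hM
  refine ⟨C * C, ENNReal.mul_ne_top hC hC, fun U hU ⟨R, hR⟩ ⟨R', hR'⟩ => ?_⟩
  refine ENNReal.iSup₂_rpow_le (by linarith) fun l hl => ?_
  refine (h _ ((hU.niceFam_ev hl.1).contDiff ()) ⟨R', fun z hz => ?_⟩).trans ?_
  · simp only [fun x => hR' x z hz, HFun.ev_zero]
  rw [mul_assoc]
  refine mul_le_mul' le_rfl ?_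
  rw [← ENNReal.tsum_mul_left]
  refine ENNReal.tsum_le_tsum fun n => ?_
  rw [mul_left_comm]
  refine mul_le_mul' le_rfl ?_
  rw [← lintegral_const_mul' _ _ hC]
  refine lintegral_mono fun z => ?_
  simp only
  -- The block in `z` commutes with the functional in `x`, which can then be bounded by `hsup` of
  -- the partially smoothed function.
  rw [qblock_ev hU hl]
  refine le_trans ?_ (h _ (hU.contDiff_qblock n z) ⟨R, fun x hx => ?_⟩)
  · gcongr
    exact enorm_ev_le_hsup hl _
  · have : U x = fun _ => 0 := by funext z; exact hR x z hx
    rw [this, qblock_zero_fun]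

end BesovNorm

/-! ### Finite differences and the decay of dyadic blocks. -/

section FiniteDifferences

variable {d : ℕ}

lemma differentiable_fwdDiff_iter {f : EucSp d → ℝ} (hf : Differentiable ℝ f) (h : EucSp d) (n : ℕ) :
    Differentiable ℝ ((fwdDiff h)^[n] f) := by
  induction n with
  | zero => exact hf
  | succ n ih =>
    rw [Function.iterate_succ_apply']
    exact (ih.comp (differentiable_id.add_const h)).sub ih

lemma partialD_fwdDiff_iter {f : EucSp d → ℝ} (hf : Differentiable ℝ f) (h : EucSp d) (n : ℕ)
    (i : Fin d) : partialD i ((fwdDiff h)^[n] f) = (fwdDiff h)^[n] (partialD i f) := by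
  induction n with
  | zero => rfl
  | succ n ih =>
    rw [Function.iterate_succ_apply', Function.iterate_succ_apply', ← ih]
    have hd := differentiable_fwdDiff_iter hf h n
    have h1 := partialD_add (u := fun x => (fwdDiff h)^[n] f (x + h)) (v := fun x => -1 * (fwdDiff h)^[n] f x)
      (hd.comp (differentiable_id.add_const h)) (hd.const_mul _) i
    have h2 := listD_comp_add_right [i] ((fwdDiff h)^[n] f) h
    simp only [listD_cons, listD_nil] at h2
    rw [partialD_const_mul, h2] at h1
    have e : ∀ g : EucSp d → ℝ, (fwdDiff h) g = fun x => g (x + h) + -1 * g x := by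
      intro g; funext x; simp [fwdDiff, sub_eq_add_neg]
    rw [e, e, h1]

/-- By induction: one difference is traded for a derivative times `‖h‖` by the mean value
inequality, and differences commute with derivatives. The last difference uses the Hölder bound.
Bounding the gradient by the sum of its entries costs a factor `d` at each step. -/
lemma abs_fwdDiff_iter_le {A β : ℝ} (hβ : 0 ≤ β) (h : EucSp d) :
    ∀ (m : ℕ) {f : EucSp d → ℝ}, ContDiff ℝ m f →
      (∀ L : List (Fin d), L.length = m → ∀ x x',
        |listD L f x - listD L f x'| ≤ A * ‖x - x'‖ ^ β) →
      ∀ x, |(fwdDiff h)^[m + 1] f x| ≤ d ^ m * A * ‖h‖ ^ (m + β)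
  | 0, f, _, hH, x => by
    simpa [fwdDiff] using hH [] rfl (x + h) x
  | m + 1, f, hf, hH, x => by
    have hfd : Differentiable ℝ f := hf.differentiable (by simp)
    have h1 : ∀ i y, |partialD i ((fwdDiff h)^[m + 1] f) y| ≤ d ^ m * A * ‖h‖ ^ (m + β) := by
      intro i y
      rw [partialD_fwdDiff_iter hfd]
      refine abs_fwdDiff_iter_le hβ h m (hf.partialD i) (fun L hL x x' => ?_) y
      have := hH (L ++ [i]) (by simp [hL]) x x'
      rwa [listD_concat] at this
    have h2 := abs_sub_le_of_partialD (differentiable_fwdDiff_iter hfd h (m + 1)) h1 (x + h) x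
    rw [Function.iterate_succ_apply']
    refine h2.trans_eq ?_
    have : ‖h‖ ^ (((m + 1 : ℕ) : ℝ) + β) = ‖h‖ ^ (m + β) * ‖h‖ := by
      rw [← Real.rpow_add_one' (norm_nonneg _) (by positivity)]
      congr 1; push_cast; ring
    rw [this, add_sub_cancel_left]
    ring

/-- This identity dictates the choice of `qcoef`: the coefficients are those of the binomial
expansion of the `M`-th difference without its zeroth term, normalised in sign. It yields high order
approximation without Taylor expansion. -/
lemma sub_sum_qcoef_eq (M : ℕ) (f : EucSp d → ℝ) (x h : EucSp d) :
    f x - ∑ j ∈ Finset.range M, qcoef M j * f (x + ((j : ℝ) + 1) • h) =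
      (-1) ^ M * (fwdDiff h)^[M] f x := by
  rw [fwdDiff_iter_eq_sum_shift, Finset.sum_range_succ', mul_add, add_comm, Finset.mul_sum,
    sub_eq_add_neg, ← Finset.sum_neg_distrib]
  congr 1
  · simp [← mul_assoc, ← pow_add, ← two_mul, pow_mul]
  · refine Finset.sum_congr rfl fun j hj => ?_
    have hj' : j + 1 ≤ M := Finset.mem_range.mp hj
    have h1 : (-1 : ℝ) ^ M * (-1) ^ (M - (j + 1)) = -(-1) ^ j := by
      obtain ⟨k, rfl⟩ := Nat.exists_eq_add_of_le hj'
      rw [Nat.add_sub_cancel_left, ← pow_add, show j + 1 + k + k = j + 1 + 2 * k by ring, pow_add,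
        pow_mul, pow_succ]
      simp
    have h2 : x + ((j : ℝ) + 1) • h = x + (j + 1) • h := by
      rw [← Nat.cast_smul_eq_nsmul ℝ]; push_cast; rfl
    rw [h2, zsmul_eq_mul, ← mul_assoc]
    push_cast
    rw [← mul_assoc, h1, qcoef]
    ring

/-- The error is the average of the difference of order `m + 1` with step `s • h` against the bump.
Since `‖h‖ ≤ 1`, the step has length at most `s`. -/
lemma abs_sub_qmoll_le {m : ℕ} {A β : ℝ} (hβ : 0 ≤ β) (hA : 0 ≤ A) {f : EucSp d → ℝ}
    (hf : ContDiff ℝ m f) (hH : ∀ L : List (Fin d), L.length = m → ∀ x x',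
        |listD L f x - listD L f x'| ≤ A * ‖x - x'‖ ^ β) {s : ℝ} (hs : 0 ≤ s) (x : EucSp d) :
    |f x - qmoll (m + 1) s f x| ≤ d ^ m * A * s ^ (m + β) := by
  have hfc := hf.continuous
  have hint : ∀ j : ℕ, IntegrableOn (fun h : EucSp d => qcoef (m + 1) j *
      (mollBump d h * f (x + (((j : ℝ) + 1) * s) • h))) (Metric.closedBall 0 1) := fun j =>
    Continuous.integrableOn_compact (continuous_const.mul (continuous_mollBump.mul (by fun_prop)))
      (isCompact_closedBall _ _) measurableSet_closedBall
  have e : f x - qmoll (m + 1) s f x = ∫ h in Metric.closedBall (0 : EucSp d) 1,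
      mollBump d h * ((-1) ^ (m + 1) * (fwdDiff (s • h))^[m + 1] f x) := by
    simp only [← sub_sum_qcoef_eq, mul_sub, Finset.mul_sum, smul_smul]
    rw [integral_sub, integral_mul_const, setIntegral_mollBump, one_mul, integral_finsetSum]
    · congr 1
      refine Finset.sum_congr rfl fun j _ => ?_
      rw [moll, ← integral_const_mul]
      simp only [mul_left_comm]
    · intro j _
      simpa only [mul_left_comm, IntegrableOn] using hint j
    · exact Continuous.integrableOn_compact (ν := volume) (continuous_mollBump.mul continuous_const)
        (isCompact_closedBall _ _) measurableSet_closedBall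
    · refine integrable_finsetSum _ fun j _ => ?_
      simpa only [mul_left_comm, IntegrableOn] using hint j
  set B := (d : ℝ) ^ m * A * s ^ (m + β)
  have hB : 0 ≤ B := by positivity
  have hb : IntegrableOn (fun h : EucSp d => mollBump d h * B) (Metric.closedBall 0 1) :=
    Continuous.integrableOn_compact (continuous_mollBump.mul continuous_const)
      (isCompact_closedBall _ _) measurableSet_closedBall
  rw [e, ← Real.norm_eq_abs]
  calc _ ≤ ∫ h in Metric.closedBall (0 : EucSp d) 1, mollBump d h * B := by
        refine norm_integral_le_of_norm_le (μ := volume.restrict _) hb ?_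
        rw [ae_restrict_iff' measurableSet_closedBall]
        refine Eventually.of_forall fun h hh => ?_
        rw [norm_mul, Real.norm_of_nonneg (mollBump_nonneg _), norm_mul]
        refine mul_le_mul_of_nonneg_left ?_ (mollBump_nonneg _)
        simp only [norm_pow, norm_neg, norm_one, one_pow, one_mul, Real.norm_eq_abs]
        refine (abs_fwdDiff_iter_le hβ (s • h) m hf hH x).trans ?_
        have : ‖s • h‖ ≤ s := by
          rw [norm_smul, Real.norm_of_nonneg hs]
          exact mul_le_of_le_one_right hs (by simpa using hh)
        simp only [B]
        gcongr
    _ = B := by rw [integral_mul_const, setIntegral_mollBump, one_mul]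

/-- Decay of the dyadic blocks of a Hölder function. -/
lemma exists_abs_qblock_le (d : ℕ) {α : ℝ} (hα : 0 ≤ α) :
    ∃ C : ℝ, 0 ≤ C ∧ ∀ (A : ℝ) (f : EucSp d → ℝ), ContDiff ℝ ⌊α⌋₊ f → (∀ x, |f x| ≤ A) →
      (∀ L : List (Fin d), L.length = ⌊α⌋₊ → ∀ x x',
        |listD L f x - listD L f x'| ≤ A * ‖x - x'‖ ^ (α - ⌊α⌋₊)) →
      ∀ n x, |qblock (⌊α⌋₊ + 1) n f x| ≤ C * A * 2 ^ (-(α * n)) := by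
  set m := ⌊α⌋₊
  refine ⟨(∑ j ∈ Finset.range (m + 1), |qcoef (m + 1) j|) + d ^ m * (1 + 2 ^ α), by positivity,
    fun A f hf hA hH n x => ?_⟩
  have hA0 : 0 ≤ A := (abs_nonneg _).trans (hA 0)
  have hS : 0 ≤ ∑ j ∈ Finset.range (m + 1), |qcoef (m + 1) j| := by positivity
  have hs : ∀ n : ℕ, ((1 : ℝ) / 2) ^ n = 2 ^ (-(n : ℝ)) := fun n => by
    rw [Real.rpow_neg (by norm_num), Real.rpow_natCast, one_div, inv_pow]
  have key : ∀ n : ℕ, |f x - qmoll (m + 1) ((1 / 2) ^ n) f x| ≤ d ^ m * A * 2 ^ (-(α * n)) := by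
    intro n
    refine (abs_sub_qmoll_le (sub_floor_mem hα).1 hA0 hf hH (by positivity) x).trans_eq ?_
    rw [hs, ← Real.rpow_mul (by norm_num)]
    congr 2; ring
  cases n with
  | zero =>
    -- The block of index `0` is not a difference, so it is bounded through the supremum of `f`.
    simp only [qblock, CharP.cast_eq_zero, mul_zero, neg_zero, Real.rpow_zero, mul_one]
    calc |qmoll (m + 1) 1 f x| ≤ ∑ j ∈ Finset.range (m + 1), |qcoef (m + 1) j| * A := by
          refine (Finset.abs_sum_le_sum_abs _ _).trans (Finset.sum_le_sum fun j _ => ?_)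
          rw [abs_mul]
          gcongr
          exact abs_moll_le hA _ _
      _ ≤ _ := by
          rw [← Finset.sum_mul]
          have : 0 ≤ (d : ℝ) ^ m * (1 + 2 ^ α) := by positivity
          gcongr
          linarith
  | succ n =>
    simp only [qblock]
    have h1 := key n
    have h2 := key (n + 1)
    -- The approximation error at the coarser of the two scales is larger by `2^α`, whence the
    -- factor `1 + 2^α` in the constant.
    have h3 : (2 : ℝ) ^ (-(α * n)) = 2 ^ α * 2 ^ (-(α * ((n + 1 : ℕ) : ℝ))) := by
      rw [← Real.rpow_add (by norm_num)]; congr 1; push_cast; ring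
    rw [h3] at h1
    have h4 : 0 ≤ (∑ j ∈ Finset.range (m + 1), |qcoef (m + 1) j|) * A *
      (2 : ℝ) ^ (-(α * ((n + 1 : ℕ) : ℝ))) := by positivity
    rw [abs_le] at *
    constructor <;> nlinarith [h1.1, h1.2, h2.1, h2.2]

end FiniteDifferences
end

noncomputable section

/-! ### Mean zero Hölder observables and uniform boundedness. -/

section HolderBall

variable {Ω : Type*} [MetricSpace Ω] [MeasurableSpace Ω] {μ : Measure Ω} {κ : ℝ}

/-- Mean zero functions that are bounded by `A` and `κ`-Hölder with constant `A`. -/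
structure HolderBall (μ : Measure Ω) (κ A : ℝ) (v : Ω → ℝ) : Prop where
  bound : ∀ y, |v y| ≤ A
  holder : ∀ y y', |v y - v y'| ≤ A * dist y y' ^ κ
  mean : ∫ y, v y ∂μ = 0

namespace HolderBall

lemma continuous (hκ : 0 < κ) {A : ℝ} {v : Ω → ℝ} (hv : HolderBall μ κ A v) : Continuous v := by
  rw [continuous_iff_continuousAt]
  intro y
  rw [ContinuousAt, tendsto_iff_dist_tendsto_zero]
  have h : Tendsto (fun y' => A * dist y' y ^ κ) (𝓝 y) (𝓝 0) := by
    have h1 : ContinuousAt (fun y' => A * dist y' y ^ κ) y :=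
      continuousAt_const.mul (ContinuousAt.rpow_const (by fun_prop) (Or.inr hκ.le))
    simpa [ContinuousAt, Real.zero_rpow hκ.ne'] using h1
  exact squeeze_zero (fun _ => dist_nonneg) (fun y' => hv.holder y' y) h

lemma memHolderZero {A : ℝ} {v : Ω → ℝ} (hv : HolderBall μ κ A v) : MemHolderZero μ κ v := by
  refine ⟨?_, hv.mean⟩
  refine lt_of_le_of_lt (b := ENNReal.ofReal A + ENNReal.ofReal A) (add_le_add ?_ ?_)
    (by simp)
  · refine iSup_le fun y => ?_
    rw [← ofReal_norm]
    exact ENNReal.ofReal_le_ofReal (hv.bound y)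
  · refine iSup_le fun y => iSup_le fun y' => iSup_le fun hy => ?_
    have hpos : 0 < dist y y' ^ κ := Real.rpow_pos_of_pos (dist_pos.mpr hy) _
    rw [← ofReal_norm, ← ENNReal.ofReal_div_of_pos hpos]
    refine ENNReal.ofReal_le_ofReal ?_
    rw [div_le_iff₀ hpos]
    exact hv.holder y y'

lemma const_mul {A : ℝ} {v : Ω → ℝ} (hv : HolderBall μ κ A v) (c : ℝ) :
    HolderBall μ κ (|c| * A) fun y => c * v y where
  bound y := by rw [abs_mul]; gcongr; exact hv.bound y
  holder y y' := by
    rw [← mul_sub, abs_mul, mul_assoc]; gcongr; exact hv.holder y y'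
  mean := by rw [integral_const_mul, hv.mean, mul_zero]

lemma add [IsFiniteMeasure μ] [OpensMeasurableSpace Ω] (hκ : 0 < κ) {A B : ℝ} {v w : Ω → ℝ}
    (hv : HolderBall μ κ A v) (hw : HolderBall μ κ B w) :
    HolderBall μ κ (A + B) fun y => v y + w y where
  bound y := (abs_add_le _ _).trans (add_le_add (hv.bound y) (hw.bound y))
  holder y y' := by
    rw [add_sub_add_comm, add_mul]
    exact (abs_add_le _ _).trans (add_le_add (hv.holder y y') (hw.holder y y'))
  mean := by
    rw [integral_add, hv.mean, hw.mean, add_zero]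
    · exact Integrable.of_bound (hv.continuous hκ).measurable.aestronglyMeasurable A
        (Eventually.of_forall hv.bound)
    · exact Integrable.of_bound (hw.continuous hκ).measurable.aestronglyMeasurable B
        (Eventually.of_forall hw.bound)

lemma mono {A B : ℝ} {v : Ω → ℝ} (hv : HolderBall μ κ A v) (h : A ≤ B) : HolderBall μ κ B v where
  bound y := (hv.bound y).trans h
  holder y y' := (hv.holder y y').trans (by gcongr)
  mean := hv.mean

end HolderBall

-- Bounds between finitely many values survive pointwise limits, and the mean survives by dominated
-- convergence. The Hölder ball is therefore complete in the sup metric, the metric used with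
-- Baire's theorem.
open BoundedContinuousFunction in
lemma isClosed_holderBall [IsFiniteMeasure μ] [OpensMeasurableSpace Ω] :
    IsClosed {v : Ω →ᵇ ℝ | HolderBall μ κ 1 v} := by
  have : {v : Ω →ᵇ ℝ | HolderBall μ κ 1 v} = (⋂ y, {v : Ω →ᵇ ℝ | |v y| ≤ 1}) ∩
      (⋂ y, ⋂ y', {v : Ω →ᵇ ℝ | |v y - v y'| ≤ 1 * dist y y' ^ κ}) ∩
      {v : Ω →ᵇ ℝ | ∫ y, v y ∂μ = 0} := by
    ext v
    simp only [mem_ofPred_eq, mem_inter_iff, mem_iInter]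
    exact ⟨fun h => ⟨⟨h.1, h.2⟩, h.3⟩, fun h => ⟨h.1.1, h.1.2, h.2⟩⟩
  rw [this]
  refine ((isClosed_iInter fun y => ?_).inter (isClosed_iInter fun y => isClosed_iInter fun y' => ?_)).inter ?_
  · exact isClosed_le (continuous_eval_const y).abs continuous_const
  · exact isClosed_le ((continuous_eval_const y).sub (continuous_eval_const y')).abs
      continuous_const
  · refine isClosed_eq ?_ continuous_const
    refine continuous_iff_continuousAt.mpr fun v => ?_
    have hM : ∀ v : Ω →ᵇ ℝ, AEStronglyMeasurable v μ := fun v =>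
      v.continuous.measurable.aestronglyMeasurable
    refine continuousAt_of_dominated (bound := fun _ => ‖v‖ + 1)
      (Eventually.of_forall hM) ?_ (integrable_const _)
      (Eventually.of_forall fun y => (continuous_eval_const y).continuousAt)
    filter_upwards [Metric.ball_mem_nhds v one_pos] with w hw
    refine Eventually.of_forall fun y => (w.norm_coe_le_norm y).trans ?_
    have h1 := norm_le_norm_add_norm_sub' w v
    rw [mem_ball_iff_norm] at hw
    linarith

open BoundedContinuousFunction in
/-- The uniform boundedness principle for families of seminorms on mean zero Hölder functions. -/
lemma exists_uniform_bound_of_pointwise [IsProbabilityMeasure μ] [OpensMeasurableSpace Ω]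
    (hκ : 0 < κ) {ι : Type*} (N : ι → (Ω → ℝ) → ℝ≥0∞)
    (hadd : ∀ i v w A B, HolderBall μ κ A v → HolderBall μ κ B w → ∀ c : ℝ,
      N i (fun y => v y + c * w y) ≤ N i v + ‖c‖ₑ * N i w)
    (hsup : ∀ i, ∃ C : ℝ≥0∞, C ≠ ∞ ∧ ∀ v A a, HolderBall μ κ A v → (∀ y, |v y| ≤ a) →
      N i v ≤ C * ENNReal.ofReal a)
    (hpt : ∀ v, HolderBall μ κ 1 v → ∃ K : ℝ≥0∞, K ≠ ∞ ∧ ∀ i, N i v ≤ K) :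
    ∃ K : ℝ≥0∞, K ≠ ∞ ∧ ∀ i v, HolderBall μ κ 1 v → N i v ≤ K := by
  let X := {v : Ω →ᵇ ℝ // HolderBall μ κ 1 v}
  have : CompleteSpace X := (isClosed_holderBall (μ := μ) (κ := κ)).completeSpace_coe
  have hX0 : HolderBall μ κ 1 (0 : Ω →ᵇ ℝ) :=
    ⟨fun y => by simp, fun y y' => by simp; positivity, by simp⟩
  have : Nonempty X := ⟨⟨0, hX0⟩⟩
  let F : ℕ → Set X := fun K => ⋂ i, {v : X | N i v.1 ≤ K}
  have hFc : ∀ K, IsClosed (F K) := by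
    intro K
    refine isClosed_iInter fun i => isClosed_of_closure_subset fun v hv => ?_
    -- For each fixed index, subadditivity and the sup norm bound give lower semicontinuity of `N
    -- i`. The constant `C` may depend on `i`, since only closedness is at stake.
    obtain ⟨C, hC, hCb⟩ := hsup i
    have hle : ∀ δ : ℝ, 0 < δ → N i v.1 ≤ K + C * ENNReal.ofReal δ := by
      intro δ hδ
      obtain ⟨w, hw, hd⟩ := Metric.mem_closure_iff.mp hv δ hδ
      have h1 := hadd i _ _ _ _ w.2 ((v.2.add hκ (w.2.const_mul (-1)))) 1
      have h2 := hCb _ _ δ (v.2.add hκ (w.2.const_mul (-1))) fun y => by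
        have := (v.1 - w.1).norm_coe_le_norm y
        have hd' : ‖v.1 - w.1‖ < δ := by rwa [← dist_eq_norm]
        simp only [coe_sub, Pi.sub_apply, Real.norm_eq_abs] at this
        rw [show v.1 y + -1 * w.1 y = v.1 y - w.1 y by ring]
        linarith
      calc N i v.1 = N i (fun y => w.1 y + 1 * (v.1 y + -1 * w.1 y)) := by congr 1; funext y; ring
        _ ≤ _ := h1
        _ ≤ _ := by
          refine add_le_add hw ?_
          simpa using h2
    have hlim : Tendsto (fun δ : ℝ => (K : ℝ≥0∞) + C * ENNReal.ofReal δ) (𝓝[>] 0) (𝓝 K) := by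
      have h3 : Tendsto (fun δ : ℝ => ENNReal.ofReal δ) (𝓝[>] 0) (𝓝 0) := by
        simpa using (ENNReal.continuous_ofReal.tendsto 0).mono_left nhdsWithin_le_nhds
      simpa using (ENNReal.Tendsto.const_mul h3 (Or.inr hC)).const_add (K : ℝ≥0∞)
    exact ge_of_tendsto hlim (eventually_mem_nhdsWithin.mono fun δ hδ => hle δ hδ)
  have hFU : ⋃ K, F K = univ := by
    rw [eq_univ_iff_forall]
    intro v
    obtain ⟨K, hK, hKb⟩ := hpt _ v.2
    obtain ⟨n, hn⟩ := ENNReal.exists_nat_gt hK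
    exact mem_iUnion.mpr ⟨n, mem_iInter.mpr fun i => (hKb i).trans hn.le⟩
  obtain ⟨K, v₀, hv₀⟩ := nonempty_interior_of_iUnion_of_closed hFc hFU
  obtain ⟨r, hr, hball⟩ := Metric.mem_nhds_iff.mp (mem_interior_iff_mem_nhds.mp hv₀)
  -- Two elements of the ball are at distance at most `2`, so moving from `v₀` a fraction `c ≤ r/4`
  -- of the way towards any `v` stays within the Baire ball of radius `r`. As `c ≤ 1`, the new point
  -- is a convex combination and remains in the Hölder ball.
  set c : ℝ := min (1 / 2) (r / 4)
  have hc0 : 0 < c := by positivity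
  have hc1 : c ≤ 1 / 2 := min_le_left _ _
  have hcr : c ≤ r / 4 := min_le_right _ _
  refine ⟨K + ‖c⁻¹‖ₑ * (K + ‖(-1 : ℝ)‖ₑ * K), ?_, fun i v hv => ?_⟩
  · exact ENNReal.add_ne_top.mpr ⟨ENNReal.natCast_ne_top _, ENNReal.mul_ne_top enorm_ne_top
      (ENNReal.add_ne_top.mpr ⟨ENNReal.natCast_ne_top _,
        ENNReal.mul_ne_top enorm_ne_top (ENNReal.natCast_ne_top _)⟩)⟩
  · let vb : Ω →ᵇ ℝ := BoundedContinuousFunction.ofNormedAddCommGroup v (hv.continuous hκ) 1 hv.bound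
    have hv1 : HolderBall μ κ 1 (v₀.1 + c • (vb - v₀.1) : Ω →ᵇ ℝ) := by
      have h := ((v₀.2.const_mul (1 - c)).add hκ (hv.const_mul c)).mono (B := 1) (by
        rw [abs_of_nonneg (by linarith), abs_of_pos hc0]; linarith)
      convert h using 1
      funext y
      simp [vb]; ring
    let v₁ : X := ⟨v₀.1 + c • (vb - v₀.1), hv1⟩
    have hd : dist v₁ v₀ < r := by
      have h1 : dist v₁ v₀ = ‖c • (vb - v₀.1)‖ := by
        rw [Subtype.dist_eq, dist_eq_norm]; simp [v₁]
      have h2 : ‖vb‖ ≤ 1 := BoundedContinuousFunction.norm_ofNormedAddCommGroup_le _ zero_le_one hv.bound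
      have h3 : ‖v₀.1‖ ≤ 1 := (BoundedContinuousFunction.norm_le zero_le_one).mpr v₀.2.bound
      rw [h1, norm_smul, Real.norm_of_nonneg hc0.le]
      have h4 := norm_sub_le vb v₀.1
      nlinarith
    have hm1 : N i v₁.1 ≤ K := mem_iInter.mp (hball hd) i
    have hm0 : N i v₀.1 ≤ K := mem_iInter.mp (interior_subset hv₀) i
    -- Solving the convex combination for `v` costs `c⁻¹`, which depends only on `r`.
    have e : v = fun y => v₀.1 y + c⁻¹ * (v₁.1 y + -1 * v₀.1 y) := by
      funext y
      simp only [v₁, vb, BoundedContinuousFunction.coe_add, Pi.add_apply,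
        BoundedContinuousFunction.coe_smul, BoundedContinuousFunction.coe_sub, Pi.sub_apply,
        smul_eq_mul, BoundedContinuousFunction.coe_ofNormedAddCommGroup]
      field_simp
      ring
    have s1 := hadd i _ _ _ _ v₀.2 (v₁.2.add hκ (v₀.2.const_mul (-1))) c⁻¹
    have s2 := hadd i _ _ _ _ v₁.2 v₀.2 (-1)
    rw [e]
    refine s1.trans ?_
    gcongr
    exact s2.trans (by gcongr)

end HolderBall
end

noncomputable section

/-! ### Moments of time integrals along the flow. -/

section UniformMoments

variable {Ω : Type*} [MetricSpace Ω] [MeasurableSpace Ω] {μ : Measure Ω} {κ : ℝ}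

/-- Dividing by the expected growth `D i` turns moment bounds at all times into one pointwise
bounded family of seminorms. -/
lemma exists_uniform_eLpNorm_bound [IsProbabilityMeasure μ] [OpensMeasurableSpace Ω]
    (hκ : 0 < κ) {ι : Type*} {P : ℝ≥0∞} (hP : 1 ≤ P) (T : ι → (Ω → ℝ) → Ω → ℝ) (D : ι → ℝ≥0∞)
    (hD : ∀ i, D i ≠ 0) (hD' : ∀ i, D i ≠ ∞)
    (hmeas : ∀ i v A, HolderBall μ κ A v → AEStronglyMeasurable (T i v) μ)
    (hlin : ∀ i v w A B, HolderBall μ κ A v → HolderBall μ κ B w → ∀ c : ℝ,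
      T i (fun y => v y + c * w y) = fun y => T i v y + c * T i w y)
    (hsup : ∀ i, ∃ C : ℝ, 0 ≤ C ∧ ∀ v A a, HolderBall μ κ A v → (∀ y, |v y| ≤ a) →
      ∀ y, |T i v y| ≤ C * a)
    (hpt : ∀ v, HolderBall μ κ 1 v → ∃ K : ℝ≥0∞, K ≠ ∞ ∧ ∀ i, eLpNorm (T i v) P μ ≤ K * D i) :
    ∃ K : ℝ≥0∞, K ≠ ∞ ∧ ∀ i v, HolderBall μ κ 1 v → eLpNorm (T i v) P μ ≤ K * D i := by
  suffices ∃ K : ℝ≥0∞, K ≠ ∞ ∧ ∀ i v, HolderBall μ κ 1 v → eLpNorm (T i v) P μ / D i ≤ K by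
    obtain ⟨K, hK, h⟩ := this
    exact ⟨K, hK, fun i v hv => (ENNReal.div_le_iff (hD i) (hD' i)).mp (h i v hv)⟩
  refine exists_uniform_bound_of_pointwise (μ := μ) hκ
    (fun i v => eLpNorm (T i v) P μ / D i) (fun i v w A B hv hw c => ?_) (fun i => ?_)
    (fun v hv => ?_)
  · simp only [hlin i v w A B hv hw c]
    rw [← mul_div_assoc, ← ENNReal.add_div]
    gcongr
    refine (eLpNorm_add_le (hmeas i v A hv) ((hmeas i w B hw).const_mul c) hP).trans_eq ?_
    congr 1
    exact eLpNorm_const_smul c _ _ _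
  · obtain ⟨C, hC0, hC⟩ := hsup i
    refine ⟨ENNReal.ofReal C / D i, ENNReal.div_ne_top ENNReal.ofReal_ne_top (hD i),
      fun v A a hv ha => ?_⟩
    have h1 := eLpNorm_le_of_ae_bound (p := P) (μ := μ) (f := T i v)
      (Eventually.of_forall fun y => hC v A a hv ha y)
    simp only [measure_univ, ENNReal.one_rpow, one_mul] at h1
    rw [ENNReal.ofReal_mul hC0] at h1
    calc _ ≤ (ENNReal.ofReal C * ENNReal.ofReal a) / D i := by gcongr
      _ = _ := by simp only [div_eq_mul_inv]; ring
  · obtain ⟨K, hK, h⟩ := hpt v hv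
    exact ⟨K, hK, fun i => (ENNReal.div_le_iff (hD i) (hD' i)).mpr (h i)⟩

end UniformMoments

section FlowInt

variable {Ω : Type*} [MetricSpace Ω]

/-- The time integral of an observable along the flow. -/
def flowInt (φ : Flow ℝ Ω) (v : Ω → ℝ) (t : ℝ) (y : Ω) : ℝ := ∫ s in (0 : ℝ)..t, v (φ s y)

/-- The iterated time integral of a pair of observables along the flow. -/
def flowInt₂ (φ : Flow ℝ Ω) (v w : Ω → ℝ) (t : ℝ) (y : Ω) : ℝ :=
  ∫ s in (0 : ℝ)..t, ∫ r in (0 : ℝ)..s, v (φ r y) * w (φ s y)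

variable {φ : Flow ℝ Ω}

lemma continuous_flow_uncurry (φ : Flow ℝ Ω) : Continuous fun z : ℝ × Ω => φ z.1 z.2 := φ.cont'

lemma continuous_flow_time (φ : Flow ℝ Ω) (y : Ω) : Continuous fun s : ℝ => φ s y :=
  (continuous_flow_uncurry φ).comp (by fun_prop : Continuous fun s : ℝ => (s, y))

lemma continuous_flowInt {v : Ω → ℝ} (hv : Continuous v) :
    Continuous fun z : ℝ × Ω => flowInt φ v z.1 z.2 :=
  continuous_intervalIntegral_of_continuous (f := fun (z : ℝ × Ω) s => v (φ s z.2))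
    (hv.comp ((continuous_flow_uncurry φ).comp
      (by fun_prop : Continuous fun w : (ℝ × Ω) × ℝ => (w.2, w.1.2))))
    continuous_const continuous_fst

lemma flowInt₂_eq (v w : Ω → ℝ) (t : ℝ) (y : Ω) :
    flowInt₂ φ v w t y = ∫ s in (0 : ℝ)..t, flowInt φ v s y * w (φ s y) := by
  simp only [flowInt₂, flowInt, intervalIntegral.integral_mul_const]

lemma continuous_flowInt₂_integrand {v w : Ω → ℝ} (hv : Continuous v) (hw : Continuous w) :
    Continuous fun z : ℝ × Ω => flowInt φ v z.1 z.2 * w (φ z.1 z.2) :=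
  (continuous_flowInt hv).mul (hw.comp (continuous_flow_uncurry φ))

lemma continuous_flowInt₂ {v w : Ω → ℝ} (hv : Continuous v) (hw : Continuous w) (t : ℝ) :
    Continuous (flowInt₂ φ v w t) := by
  have : flowInt₂ φ v w t = fun y => ∫ s in (0 : ℝ)..t, flowInt φ v s y * w (φ s y) := by
    funext y; exact flowInt₂_eq v w t y
  rw [this]
  exact continuous_intervalIntegral_of_continuous
    (f := fun (y : Ω) s => flowInt φ v s y * w (φ s y))
    ((continuous_flowInt₂_integrand hv hw).comp
      (by fun_prop : Continuous fun w : Ω × ℝ => (w.2, w.1))) continuous_const continuous_const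

lemma intervalIntegrable_flow {v : Ω → ℝ} (hv : Continuous v) (y : Ω) (a b : ℝ) :
    IntervalIntegrable (fun s => v (φ s y)) volume a b :=
  (hv.comp (continuous_flow_time φ y)).intervalIntegrable _ _

lemma intervalIntegrable_flowInt₂ {v w : Ω → ℝ} (hv : Continuous v) (hw : Continuous w) (y : Ω)
    (a b : ℝ) : IntervalIntegrable (fun s => flowInt φ v s y * w (φ s y)) volume a b :=
  ((continuous_flowInt₂_integrand hv hw).comp
    (by fun_prop : Continuous fun s : ℝ => (s, y))).intervalIntegrable _ _

lemma flowInt_add_mul {v w : Ω → ℝ} (hv : Continuous v) (hw : Continuous w) (c t : ℝ) (y : Ω) :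
    flowInt φ (fun y => v y + c * w y) t y = flowInt φ v t y + c * flowInt φ w t y := by
  unfold flowInt
  rw [intervalIntegral.integral_add (intervalIntegrable_flow hv y _ _)
    ((intervalIntegrable_flow hw y _ _).const_mul c), intervalIntegral.integral_const_mul]

lemma abs_flowInt_le {v : Ω → ℝ} {a : ℝ} (hv : ∀ y, |v y| ≤ a) {t : ℝ} (ht : 0 ≤ t) (y : Ω) :
    |flowInt φ v t y| ≤ t * a := by
  have := intervalIntegral.norm_integral_le_of_norm_le_const (a := 0) (b := t) (C := a)
    (f := fun s => v (φ s y)) fun s _ => hv _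
  rw [sub_zero, abs_of_nonneg ht, mul_comm] at this
  exact this

lemma abs_flowInt₂_le {v w : Ω → ℝ} {a c : ℝ} (hv : ∀ y, |v y| ≤ a) (hw : ∀ y, |w y| ≤ c)
    {t : ℝ} (ht : 0 ≤ t) (y : Ω) : |flowInt₂ φ v w t y| ≤ t * t * a * c := by
  have ha : 0 ≤ a := (abs_nonneg _).trans (hv y)
  rw [flowInt₂_eq]
  have := intervalIntegral.norm_integral_le_of_norm_le_const (a := 0) (b := t) (C := t * a * c)
    (f := fun s => flowInt φ v s y * w (φ s y)) fun s hs => by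
      rw [uIoc_of_le ht] at hs
      rw [norm_mul]
      exact mul_le_mul ((abs_flowInt_le hv hs.1.le y).trans (by gcongr; exact hs.2)) (hw _)
        (norm_nonneg _) (by positivity)
  rw [sub_zero, abs_of_nonneg ht] at this
  exact this.trans_eq (by ring)

lemma flowInt_const_mul (c : ℝ) (v : Ω → ℝ) (t : ℝ) (y : Ω) :
    flowInt φ (fun y => c * v y) t y = c * flowInt φ v t y :=
  intervalIntegral.integral_const_mul _ _

lemma flowInt₂_const_mul (c c' : ℝ) (v w : Ω → ℝ) (t : ℝ) (y : Ω) :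
    flowInt₂ φ (fun y => c * v y) (fun y => c' * w y) t y = c * c' * flowInt₂ φ v w t y := by
  simp only [flowInt₂_eq, flowInt_const_mul]
  rw [← intervalIntegral.integral_const_mul]
  congr 1; funext s; ring

/-- By the group property of the flow, the integral over `[s,t]` is one over `[0, (t-s)/ε²]` from
the shifted initial condition. An invariant measure does not see the shift. -/
lemma intervalIntegral_fast_eq (φ : Flow ℝ Ω) {ε : ℝ} (hε : 0 < ε) (v : Ω → ℝ) (s t : ℝ) (y : Ω) :
    ∫ r in s..t, v (φ (r / ε ^ 2) y) =
      ε ^ 2 * flowInt φ v ((t - s) / ε ^ 2) (φ (s / ε ^ 2) y) := by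
  have h1 := intervalIntegral.integral_comp_div (a := s) (b := t) (fun r => v (φ r y))
    (c := ε ^ 2) (by positivity)
  have h2 := intervalIntegral.integral_comp_add_right (a := 0) (b := (t - s) / ε ^ 2)
    (fun r => v (φ r y)) (s / ε ^ 2)
  rw [h1, smul_eq_mul, flowInt]
  simp only [φ.map_add] at h2
  rw [h2]
  congr 2 <;> ring

/-- The inner integral starts at `s` rather than `0`, which is what makes the shifted expression an
iterated integral from time zero. The two time changes give the fourth power of `ε`. -/
lemma intervalIntegral_fast_eq₂ (φ : Flow ℝ Ω) {ε : ℝ} (hε : 0 < ε) (v w : Ω → ℝ) (s t : ℝ)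
    (y : Ω) :
    ∫ r in s..t, (∫ u in s..r, v (φ (u / ε ^ 2) y)) * w (φ (r / ε ^ 2) y) =
      (ε ^ 2) ^ 2 * flowInt₂ φ v w ((t - s) / ε ^ 2) (φ (s / ε ^ 2) y) := by
  simp only [intervalIntegral_fast_eq φ hε]
  have h1 := intervalIntegral.integral_comp_div (a := s) (b := t)
    (fun r => ε ^ 2 * flowInt φ v (r - s / ε ^ 2) (φ (s / ε ^ 2) y) * w (φ r y))
    (c := ε ^ 2) (by positivity)
  have h2 := intervalIntegral.integral_comp_add_right (a := 0) (b := (t - s) / ε ^ 2)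
    (fun r => ε ^ 2 * flowInt φ v (r - s / ε ^ 2) (φ (s / ε ^ 2) y) * w (φ r y)) (s / ε ^ 2)
  simp only [sub_div]
  simp only [φ.map_add, add_sub_cancel_right, mul_assoc, intervalIntegral.integral_const_mul,
    smul_eq_mul] at h1 h2
  rw [intervalIntegral.integral_congr (g := fun x => ε ^ 2 *
    (flowInt φ v (x / ε ^ 2 - s / ε ^ 2) (φ (s / ε ^ 2) y) * w (φ (x / ε ^ 2) y)))
    (fun x _ => by simp only; ring), intervalIntegral.integral_const_mul, h1, flowInt₂_eq]
  have h3 : (t - s) / ε ^ 2 + s / ε ^ 2 = t / ε ^ 2 := by ring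
  rw [zero_add, h3] at h2
  have h4 : ε ^ 2 ≠ 0 := by positivity
  have h5 := mul_left_cancel₀ h4 h2
  rw [← sub_div, h5]
  ring

end FlowInt

section UniformMoments

lemma lintegral_enorm_rpow_of_eLpNorm {Ω : Type*} [MeasurableSpace Ω] {μ : Measure Ω} {f : Ω → ℝ} {p : ℝ} (hp : 0 < p) {B : ℝ≥0∞}
    (h : eLpNorm f (ENNReal.ofReal p) μ ≤ B) : ∫⁻ y, ‖f y‖ₑ ^ p ∂μ ≤ B ^ p := by
  rw [eLpNorm_eq_lintegral_rpow_enorm_toReal (by simpa using hp) ENNReal.ofReal_ne_top, ENNReal.toReal_ofReal hp.le,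
    one_div, ENNReal.rpow_inv_le_iff hp] at h
  exact h

variable {Ω : Type*} [MetricSpace Ω] [MeasurableSpace Ω] {μ : Measure Ω} {κ : ℝ}
  [BorelSpace Ω] {φ : Flow ℝ Ω}

/-- The moment bounds hold uniformly for observables in the unit ball. -/
lemma FlowMoments.exists_uniform [IsProbabilityMeasure μ] {p : ℝ} (hp : 1 ≤ p) (hκ : 0 < κ)
    (h : FlowMoments φ μ κ p) : ∃ K : ℝ≥0∞, K ≠ ∞ ∧
    (∀ v, HolderBall μ κ 1 v → ∀ t : ℝ, 0 < t →
      eLpNorm (flowInt φ v t) (ENNReal.ofReal (2 * p)) μ ≤ K * ENNReal.ofReal (t ^ (1 / 2 : ℝ))) ∧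
    (∀ v w, HolderBall μ κ 1 v → HolderBall μ κ 1 w → ∀ t : ℝ, 0 < t →
      eLpNorm (flowInt₂ φ v w t) (ENNReal.ofReal p) μ ≤ K * ENNReal.ofReal t) := by
  have hP : 1 ≤ ENNReal.ofReal p := by simpa using hp
  have hP2 : 1 ≤ ENNReal.ofReal (2 * p) := by
    rw [ENNReal.one_le_ofReal]; linarith
  obtain ⟨K₁, hK₁, h₁⟩ := exists_uniform_eLpNorm_bound (μ := μ) hκ hP2
    (ι := {t : ℝ // 0 < t}) (fun t v => flowInt φ v t)
    (fun t => ENNReal.ofReal (t.1 ^ (1 / 2 : ℝ)))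
    (fun t => by simpa using Real.rpow_pos_of_pos t.2 _) (fun t => ENNReal.ofReal_ne_top)
    (fun t v A hv => ((continuous_flowInt (hv.continuous hκ)).comp
      (by fun_prop : Continuous fun y : Ω => (t.1, y))).measurable.aestronglyMeasurable)
    (fun t v w A B hv hw c => by
      funext y; exact flowInt_add_mul (hv.continuous hκ) (hw.continuous hκ) c t y)
    (fun t => ⟨t, t.2.le, fun v A a _ ha y => abs_flowInt_le ha t.2.le y⟩)
    (fun v hv => by
      obtain ⟨K, hK, hb⟩ := h v v hv.memHolderZero hv.memHolderZero
      refine ⟨ENNReal.ofReal K, ENNReal.ofReal_ne_top, fun t => ?_⟩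
      rw [← ENNReal.ofReal_mul hK.le]
      exact (hb t t.2.le).1)
  -- The bilinear functional is handled one argument at a time. For fixed `w` the bound is made
  -- uniform in `v`; then `v` joins the index set and uniformity in `w` follows.
  have hS : ∀ w, HolderBall μ κ 1 w → ∃ K : ℝ≥0∞, K ≠ ∞ ∧ ∀ (t : {t : ℝ // 0 < t}) v,
      HolderBall μ κ 1 v → eLpNorm (flowInt₂ φ v w t) (ENNReal.ofReal p) μ ≤
        K * ENNReal.ofReal t := by
    intro w hw
    have hwc := hw.continuous hκ
    refine exists_uniform_eLpNorm_bound (μ := μ) hκ hP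
      (ι := {t : ℝ // 0 < t}) (fun t v => flowInt₂ φ v w t) (fun t => ENNReal.ofReal t.1)
      (fun t => by simpa using t.2) (fun t => ENNReal.ofReal_ne_top)
      (fun t v A hv => (continuous_flowInt₂ (hv.continuous hκ) hwc t).measurable.aestronglyMeasurable)
      (fun t v v' A B hv hv' c => ?_)
      (fun t => ⟨t * t, mul_nonneg t.2.le t.2.le, fun v A a _ ha y => ?_⟩)
      (fun v hv => ?_)
    · funext y
      simp only [flowInt₂_eq, flowInt_add_mul (hv.continuous hκ) (hv'.continuous hκ), add_mul,
        mul_assoc]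
      rw [intervalIntegral.integral_add (intervalIntegrable_flowInt₂ (hv.continuous hκ) hwc y _ _)
        ((intervalIntegrable_flowInt₂ (hv'.continuous hκ) hwc y _ _).const_mul c),
        intervalIntegral.integral_const_mul]
    · simpa using abs_flowInt₂_le ha hw.bound t.2.le y
    · obtain ⟨K, hK, hb⟩ := h v w hv.memHolderZero hw.memHolderZero
      refine ⟨ENNReal.ofReal K, ENNReal.ofReal_ne_top, fun t => ?_⟩
      rw [← ENNReal.ofReal_mul hK.le]
      exact (hb t t.2.le).2
  obtain ⟨K₂, hK₂, h₂⟩ := exists_uniform_eLpNorm_bound (μ := μ) hκ hP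
    (ι := {t : ℝ // 0 < t} × {v : Ω → ℝ // HolderBall μ κ 1 v})
    (fun i w => flowInt₂ φ i.2.1 w i.1) (fun i => ENNReal.ofReal i.1.1)
    (fun i => by simpa using i.1.2) (fun i => ENNReal.ofReal_ne_top)
    (fun i w A hw => (continuous_flowInt₂ (i.2.2.continuous hκ)
      (hw.continuous hκ) i.1).measurable.aestronglyMeasurable)
    (fun i w w' A B hw hw' c => by
      have hvc := i.2.2.continuous hκ
      funext y
      simp only [flowInt₂_eq, mul_add, mul_left_comm _ c]
      rw [intervalIntegral.integral_add (intervalIntegrable_flowInt₂ hvc (hw.continuous hκ) y _ _)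
        ((intervalIntegrable_flowInt₂ hvc (hw'.continuous hκ) y _ _).const_mul c),
        intervalIntegral.integral_const_mul])
    (fun i => ⟨i.1 * i.1, mul_nonneg i.1.2.le i.1.2.le, fun w A a _ ha y => by
      simpa using abs_flowInt₂_le i.2.2.bound ha i.1.2.le y⟩)
    (fun w hw => by
      obtain ⟨K, hK, hb⟩ := hS w hw
      exact ⟨K, hK, fun i => hb i.1 i.2.1 i.2.2⟩)
  refine ⟨K₁ + K₂, ENNReal.add_ne_top.mpr ⟨hK₁, hK₂⟩, fun v hv t ht => ?_, fun v w hv hw t ht => ?_⟩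
  · exact (h₁ ⟨t, ht⟩ v hv).trans (by gcongr; exact le_self_add)
  · exact (h₂ (⟨t, ht⟩, ⟨v, hv⟩) w hw).trans (by gcongr; exact le_add_self)

/-- Moments of the rescaled integrals, with the dependence on the observables. -/
lemma FlowMoments.exists_fast [IsProbabilityMeasure μ] {p : ℝ} (hp : 1 ≤ p) (hκ : 0 < κ)
    (hμ : ∀ t, MeasurePreserving (φ t) μ μ)
    (h : FlowMoments φ μ κ p) : ∃ K : ℝ≥0∞, K ≠ ∞ ∧
    (∀ v A, HolderBall μ κ A v → ∀ ε : ℝ, 0 < ε → ∀ s t : ℝ, s ≤ t →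
      ∫⁻ y, ‖ε⁻¹ * ∫ r in s..t, v (φ (r / ε ^ 2) y)‖ₑ ^ (2 * p) ∂μ ≤
        K * ENNReal.ofReal (A ^ (2 * p) * (t - s) ^ p)) ∧
    (∀ v w A B, HolderBall μ κ A v → HolderBall μ κ B w → ∀ ε : ℝ, 0 < ε → ∀ s t : ℝ, s ≤ t →
      ∫⁻ y, ‖(ε ^ 2)⁻¹ * ∫ r in s..t, (∫ u in s..r, v (φ (u / ε ^ 2) y)) *
          w (φ (r / ε ^ 2) y)‖ₑ ^ p ∂μ ≤
        K * ENNReal.ofReal (A ^ p * B ^ p * (t - s) ^ p)) := by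
  have hp0 : 0 < p := by linarith
  obtain ⟨K, hK, h1, h2⟩ := h.exists_uniform hp hκ
  have hunit : ∀ v A, 0 < A → HolderBall μ κ A v → ∃ v', HolderBall μ κ 1 v' ∧ v = fun y => A * v' y := by
    intro v A hA hv
    refine ⟨fun y => A⁻¹ * v y, ?_, ?_⟩
    · have := hv.const_mul A⁻¹
      rwa [abs_of_pos (by positivity), inv_mul_cancel₀ hA.ne'] at this
    · funext y; rw [mul_inv_cancel_left₀ hA.ne']
  have hnonneg : ∀ v A, HolderBall μ κ A v → 0 < A ∨ v = fun _ => 0 := by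
    intro v A hv
    rcases lt_or_ge 0 A with hA | hA
    · exact Or.inl hA
    · right; funext y
      exact abs_nonpos_iff.mp ((hv.bound y).trans hA)
  refine ⟨K ^ (2 * p) + K ^ p, ENNReal.add_ne_top.mpr ⟨ENNReal.rpow_ne_top_of_nonneg (by linarith) hK,
    ENNReal.rpow_ne_top_of_nonneg (by linarith) hK⟩, fun v A hv ε hε s t hst => ?_,
    fun v w A B hv hw ε hε s t hst => ?_⟩
  · rcases hst.eq_or_lt with rfl | hst
    · simp [hp0]
    rcases hnonneg v A hv with hA | rfl
    swap
    · simp [hp0]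
    obtain ⟨v', hv', rfl⟩ := hunit v A hA hv
    set τ := (t - s) / ε ^ 2
    have hτ : 0 < τ := div_pos (by linarith) (by positivity)
    have h3 := lintegral_enorm_rpow_of_eLpNorm (by linarith : 0 < 2 * p) (h1 v' hv' τ hτ)
    have e := fun y => intervalIntegral_fast_eq φ hε (fun y => A * v' y) s t y
    simp only [e, flowInt_const_mul]
    have hc : Measurable fun y => ‖flowInt φ v' τ y‖ₑ ^ (2 * p) :=
      ((((continuous_flowInt (hv'.continuous hκ)).comp
        (by fun_prop : Continuous fun y : Ω => (τ, y))).enorm).measurable).pow_const _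
    have hr : 0 ≤ ε⁻¹ * ε ^ 2 * A := by positivity
    -- Invariance removes the shift of the initial condition, and the powers of `ε` cancel: `ε⁻¹ ·
    -- ε² · τ^{1/2} = (t - s)^{1/2}`.
    calc _ = ∫⁻ y, ENNReal.ofReal ((ε⁻¹ * ε ^ 2 * A) ^ (2 * p)) *
          ‖flowInt φ v' τ (φ (s / ε ^ 2) y)‖ₑ ^ (2 * p) ∂μ := by
          refine lintegral_congr fun y => ?_
          rw [← ENNReal.ofReal_rpow_of_nonneg hr (by linarith),
            ← ENNReal.mul_rpow_of_nonneg _ _ (by linarith), ← Real.enorm_eq_ofReal hr, ← enorm_mul]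
          congr 2; ring
      _ = ENNReal.ofReal ((ε⁻¹ * ε ^ 2 * A) ^ (2 * p)) * ∫⁻ y, ‖flowInt φ v' τ y‖ₑ ^ (2 * p) ∂μ := by
          rw [lintegral_const_mul' _ _ ENNReal.ofReal_ne_top, (hμ (s / ε ^ 2)).lintegral_comp hc]
      _ ≤ ENNReal.ofReal ((ε⁻¹ * ε ^ 2 * A) ^ (2 * p)) *
          (K * ENNReal.ofReal (τ ^ (1 / 2 : ℝ))) ^ (2 * p) := by gcongr
      _ = K ^ (2 * p) * ENNReal.ofReal (A ^ (2 * p) * (t - s) ^ p) := by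
          rw [ENNReal.mul_rpow_of_nonneg _ _ (by linarith),
            ENNReal.ofReal_rpow_of_nonneg (by positivity) (by linarith), mul_left_comm,
            ← ENNReal.ofReal_mul (by positivity), ← Real.rpow_mul hτ.le]
          congr 2
          rw [show (1 / 2 : ℝ) * (2 * p) = p by ring,
            show ε⁻¹ * ε ^ 2 * A = A * ε by field_simp, Real.mul_rpow hA.le hε.le, mul_assoc]
          congr 1
          rw [Real.rpow_mul hε.le, ← Real.mul_rpow (by positivity) hτ.le]
          congr 1
          simp only [τ]
          rw [Real.rpow_two]; field_simp
      _ ≤ _ := by gcongr; exact le_self_add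
  · rcases hst.eq_or_lt with rfl | hst
    · simp [hp0]
    rcases hnonneg v A hv with hA | rfl
    swap
    · simp [hp0]
    rcases hnonneg w B hw with hB | rfl
    swap
    · simp [hp0]
    obtain ⟨v', hv', rfl⟩ := hunit v A hA hv
    obtain ⟨w', hw', rfl⟩ := hunit w B hB hw
    set τ := (t - s) / ε ^ 2
    have hτ : 0 < τ := div_pos (by linarith) (by positivity)
    have h3 := lintegral_enorm_rpow_of_eLpNorm hp0 (h2 v' w' hv' hw' τ hτ)
    have e := fun y => intervalIntegral_fast_eq₂ φ hε (fun y => A * v' y) (fun y => B * w' y) s t y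
    simp only [e]
    simp only [flowInt₂_const_mul]
    have hc : Measurable fun y => ‖flowInt₂ φ v' w' τ y‖ₑ ^ p :=
      ((continuous_flowInt₂ (hv'.continuous hκ) (hw'.continuous hκ) τ).enorm.measurable).pow_const _
    have hr : 0 ≤ ε ^ 2 * A * B := by positivity
    -- Same cancellation at second order: `ε⁻² · ε⁴ · τ = ε² τ = t - s`.
    calc _ = ∫⁻ y, ENNReal.ofReal ((ε ^ 2 * A * B) ^ p) *
          ‖flowInt₂ φ v' w' τ (φ (s / ε ^ 2) y)‖ₑ ^ p ∂μ := by
          refine lintegral_congr fun y => ?_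
          rw [← ENNReal.ofReal_rpow_of_nonneg hr (by linarith),
            ← ENNReal.mul_rpow_of_nonneg _ _ (by linarith), ← Real.enorm_eq_ofReal hr, ← enorm_mul]
          congr 2
          field_simp
          try ring
      _ = ENNReal.ofReal ((ε ^ 2 * A * B) ^ p) * ∫⁻ y, ‖flowInt₂ φ v' w' τ y‖ₑ ^ p ∂μ := by
          rw [lintegral_const_mul' _ _ ENNReal.ofReal_ne_top, (hμ (s / ε ^ 2)).lintegral_comp hc]
      _ ≤ ENNReal.ofReal ((ε ^ 2 * A * B) ^ p) * (K * ENNReal.ofReal τ) ^ p := by gcongr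
      _ = K ^ p * ENNReal.ofReal (A ^ p * B ^ p * (t - s) ^ p) := by
          rw [ENNReal.mul_rpow_of_nonneg _ _ hp0.le,
            ENNReal.ofReal_rpow_of_nonneg hτ.le hp0.le, mul_left_comm,
            ← ENNReal.ofReal_mul (by positivity)]
          congr 2
          rw [← Real.mul_rpow (by positivity) hτ.le, ← Real.mul_rpow hA.le hB.le,
            ← Real.mul_rpow (by positivity) (by linarith)]
          congr 1
          simp only [τ]
          field_simp
      _ ≤ _ := by gcongr; exact le_add_self

end UniformMoments
end

noncomputable section

/-! ### Dyadic chaining in time. -/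

section Chaining

/-- The dyadic grid points of `[0, T]`. -/
def dyadicPt (T : ℝ) (k i : ℕ) : ℝ := T * (i / 2 ^ k)

/-- The index of the dyadic point of level `k` below `x`. -/
def dyadicIdx (T : ℝ) (k : ℕ) (x : ℝ) : ℕ := ⌊2 ^ k * (x / T)⌋₊

variable {T : ℝ}

lemma dyadicPt_succ (k i : ℕ) : dyadicPt T (k + 1) (2 * i) = dyadicPt T k i := by
  simp only [dyadicPt]; push_cast; rw [pow_succ]; field_simp

lemma dyadicIdx_le (hT : 0 < T) (k : ℕ) {x : ℝ} (hx : x ≤ T) : dyadicIdx T k x ≤ 2 ^ k := by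
  refine Nat.floor_le_of_le ?_
  push_cast
  exact mul_le_of_le_one_right (by positivity) ((div_le_one hT).mpr hx)

lemma dyadicIdx_bounds (hT : 0 < T) (k : ℕ) {x : ℝ} (hx : 0 ≤ x) :
    (dyadicIdx T k x : ℝ) ≤ 2 ^ k * (x / T) ∧ 2 ^ k * (x / T) < dyadicIdx T k x + 1 :=
  ⟨Nat.floor_le (by positivity), Nat.lt_floor_add_one _⟩

lemma dyadicIdx_succ (hT : 0 < T) (k : ℕ) {x : ℝ} (hx : 0 ≤ x) :
    dyadicIdx T (k + 1) x = 2 * dyadicIdx T k x ∨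
      dyadicIdx T (k + 1) x = 2 * dyadicIdx T k x + 1 := by
  obtain ⟨h1, h2⟩ := dyadicIdx_bounds hT k hx
  obtain ⟨h3, h4⟩ := dyadicIdx_bounds hT (k + 1) hx
  rw [pow_succ] at h3 h4
  have h5 : 2 * dyadicIdx T k x < dyadicIdx T (k + 1) x + 1 := by
    have : (2 : ℝ) * dyadicIdx T k x < dyadicIdx T (k + 1) x + 1 := by linarith
    exact_mod_cast this
  have h6 : dyadicIdx T (k + 1) x < 2 * dyadicIdx T k x + 2 := by
    have : (dyadicIdx T (k + 1) x : ℝ) < 2 * dyadicIdx T k x + 2 := by linarith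
    exact_mod_cast this
  omega

lemma abs_sub_dyadicPt_le (hT : 0 < T) (k : ℕ) {x : ℝ} (hx : 0 ≤ x) :
    |x - dyadicPt T k (dyadicIdx T k x)| ≤ T * (1 / 2) ^ k := by
  obtain ⟨h1, h2⟩ := dyadicIdx_bounds hT k hx
  have e : x - dyadicPt T k (dyadicIdx T k x) =
      T * (1 / 2) ^ k * (2 ^ k * (x / T) - dyadicIdx T k x) := by
    rw [dyadicPt, one_div, inv_pow]; field_simp
  rw [e, abs_mul, abs_of_nonneg (by positivity : 0 ≤ T * (1 / 2) ^ k),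
    abs_of_nonneg (by linarith)]
  exact mul_le_of_le_one_right (by positivity) (by linarith)

/-- A Kolmogorov type bound for a pseudo-metric on `[0, T]` in terms of its increments along
dyadic points. -/
lemma exists_chaining_bound (hT : 0 < T) {γ q : ℝ} (hγ : 0 < γ) (hq : 0 < q) :
    ∃ K : ℝ≥0∞, K ≠ ∞ ∧ ∀ D : ℝ → ℝ → ℝ≥0∞, (∀ s, D s s = 0) → (∀ s t, D s t = D t s) →
      (∀ s t u, D s u ≤ D s t + D t u) →
      (∃ C : ℝ≥0∞, C ≠ ∞ ∧ ∀ s ∈ Icc 0 T, ∀ t ∈ Icc 0 T, D s t ≤ C * ENNReal.ofReal |t - s|) →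
      ∀ s ∈ Icc 0 T, ∀ t ∈ Icc 0 T, s ≠ t → (D s t / ENNReal.ofReal (|t - s| ^ γ)) ^ q ≤
        K * ∑' k : ℕ, ∑ i ∈ Finset.range (2 ^ k), ENNReal.ofReal (2 ^ (γ * q * k)) *
          D (dyadicPt T k i) (dyadicPt T k (i + 1)) ^ q := by
  set G : ℝ≥0∞ := ∑' j : ℕ, ENNReal.ofReal (((2 : ℝ) ^ (-γ)) ^ j) with hGdef
  have hG : G ≠ ∞ := by
    rw [hGdef, ← ENNReal.ofReal_tsum_of_nonneg (fun n => by positivity)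
      (summable_geometric_of_lt_one (by positivity)
        (Real.rpow_lt_one_of_one_lt_of_neg one_lt_two (by linarith)))]
    exact ENNReal.ofReal_ne_top
  set c : ℝ≥0∞ := (G + (1 + G)) * ENNReal.ofReal ((2 / T) ^ γ) with hc
  have hcfin : c ≠ ∞ := ENNReal.mul_ne_top (ENNReal.add_ne_top.mpr ⟨hG,
    ENNReal.add_ne_top.mpr ⟨ENNReal.one_ne_top, hG⟩⟩) ENNReal.ofReal_ne_top
  refine ⟨c ^ q, ENNReal.rpow_ne_top_of_nonneg hq.le hcfin,
    fun D hself hsymm htri ⟨C, hC, hcont⟩ => ?_⟩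
  set S := ∑' k : ℕ, ∑ i ∈ Finset.range (2 ^ k), ENNReal.ofReal (2 ^ (γ * q * k)) *
          D (dyadicPt T k i) (dyadicPt T k (i + 1)) ^ q
  set e : ℕ → ℝ≥0∞ := fun k => ENNReal.ofReal (((2 : ℝ) ^ (-γ)) ^ k) * S ^ (1 / q) with he
  -- A single dyadic increment is bounded by the whole weighted sum, so a supremum over all
  -- increments of a level is replaced by a sum whose expectation can be computed.
  have hstep : ∀ k i, i < 2 ^ k → D (dyadicPt T k i) (dyadicPt T k (i + 1)) ≤ e k := by
    intro k i hi
    have h1 : ENNReal.ofReal (2 ^ (γ * q * k)) *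
        D (dyadicPt T k i) (dyadicPt T k (i + 1)) ^ q ≤ S :=
      (Finset.single_le_sum (f := fun i => ENNReal.ofReal (2 ^ (γ * q * k)) *
        D (dyadicPt T k i) (dyadicPt T k (i + 1)) ^ q) (fun _ _ => zero_le)
        (Finset.mem_range.mpr hi)).trans
      (ENNReal.le_tsum (f := fun k : ℕ => ∑ i ∈ Finset.range (2 ^ k),
        ENNReal.ofReal (2 ^ (γ * q * k)) * D (dyadicPt T k i) (dyadicPt T k (i + 1)) ^ q) k)
    have h2 : ENNReal.ofReal (2 ^ (γ * k)) * D (dyadicPt T k i) (dyadicPt T k (i + 1)) ≤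
        S ^ (1 / q) := by
      rw [one_div, ENNReal.le_rpow_inv_iff hq, ENNReal.mul_rpow_of_nonneg _ _ hq.le,
        ENNReal.ofReal_rpow_of_nonneg (by positivity) hq.le, ← Real.rpow_mul (by norm_num)]
      rwa [show γ * k * q = γ * q * k by ring]
    calc _ = ENNReal.ofReal (((2 : ℝ) ^ (-γ)) ^ k) *
          (ENNReal.ofReal (2 ^ (γ * k)) * D (dyadicPt T k i) (dyadicPt T k (i + 1))) := by
          rw [← mul_assoc, ← ENNReal.ofReal_mul (by positivity), ← Real.rpow_natCast,
            ← Real.rpow_mul (by positivity), ← Real.rpow_add (by positivity)]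
          simp
      _ ≤ _ := by simp only [he]; gcongr
  set g : ℕ → ℝ → ℝ := fun k x => dyadicPt T k (dyadicIdx T k x)
  have hgs : ∀ k, ∀ x ∈ Icc 0 T, D (g k x) (g (k + 1) x) ≤ e (k + 1) := by
    intro k x hx
    rcases dyadicIdx_succ hT k hx.1 with h | h
    · simp only [g, h, dyadicPt_succ, hself, zero_le]
    · have hlt : 2 * dyadicIdx T k x < 2 ^ (k + 1) := by
        have := dyadicIdx_le hT (k + 1) hx.2
        omega
      have := hstep (k + 1) (2 * dyadicIdx T k x) hlt
      rwa [← h, dyadicPt_succ] at this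
  have hgI : ∀ k, ∀ x ∈ Icc 0 T, g k x ∈ Icc 0 T := by
    intro k x hx
    refine ⟨by simp only [g, dyadicPt]; positivity, ?_⟩
    refine mul_le_of_le_one_right hT.le ((div_le_one (by positivity)).mpr ?_)
    exact_mod_cast dyadicIdx_le hT k hx.2
  have hchain : ∀ n j, ∀ x ∈ Icc 0 T, D (g n x) (g (n + j) x) ≤
      ∑ i ∈ Finset.range j, e (n + i + 1) := by
    intro n j x hx
    induction j with
    | zero => simp [hself]
    | succ j ih =>
      rw [Finset.sum_range_succ]
      exact (htri _ (g (n + j) x) _).trans (add_le_add ih (hgs (n + j) x hx))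
  have hsum : ∀ n j, ∑ i ∈ Finset.range j, e (n + i + 1) ≤ G * e n := by
    intro n j
    have h1 : ∀ i, e (n + i + 1) = ENNReal.ofReal (((2 : ℝ) ^ (-γ)) ^ (i + 1)) * e n := by
      intro i
      simp only [he]
      rw [← mul_assoc, ← ENNReal.ofReal_mul (by positivity), ← pow_add]
      congr 3; ring
    simp only [h1]
    rw [← Finset.sum_mul]
    gcongr
    calc _ ≤ ∑ i ∈ Finset.range (j + 1), ENNReal.ofReal (((2 : ℝ) ^ (-γ)) ^ i) := by
          rw [Finset.sum_range_succ']; exact le_self_add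
      _ ≤ G := ENNReal.sum_le_tsum _
  -- The Lipschitz bound on `D` is used only to let the dyadic approximations converge. Its constant
  -- disappears as `j → ∞` and does not enter the final estimate, which matters because it blows up
  -- with `ε`.
  have hlim : ∀ n, ∀ x ∈ Icc 0 T, D (g n x) x ≤ G * e n := by
    intro n x hx
    have hb : ∀ j : ℕ, D (g n x) x ≤ G * e n +
        C * ENNReal.ofReal (T * (1 / 2) ^ (n + j)) := by
      intro j
      refine (htri _ (g (n + j) x) _).trans (add_le_add ((hchain n j x hx).trans (hsum n j)) ?_)
      refine (hcont _ (hgI _ x hx) x hx).trans ?_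
      gcongr
      exact abs_sub_dyadicPt_le hT (n + j) hx.1
    have ht : Tendsto (fun j : ℕ => G * e n + C * ENNReal.ofReal (T * (1 / 2) ^ (n + j))) atTop
        (𝓝 (G * e n + C * ENNReal.ofReal (T * 0))) := by
      refine (ENNReal.Tendsto.const_mul (ENNReal.tendsto_ofReal (Tendsto.const_mul _ ?_))
        (Or.inr hC)).const_add _
      exact (tendsto_pow_atTop_nhds_zero_of_lt_one (by norm_num) (by norm_num)).comp
        (tendsto_add_atTop_nat n |>.congr fun j => add_comm j n)
    have := ge_of_tendsto' ht hb
    simpa using this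
  have main : ∀ s ∈ Icc 0 T, ∀ t ∈ Icc 0 T, s < t →
      (D s t / ENNReal.ofReal (|t - s| ^ γ)) ^ q ≤ c ^ q * S := by
    intro s hs t ht hst
    -- Here `2^{-(n+1)} < (t-s)/T ≤ 2⁻ⁿ`. The upper bound makes the level `n` points below `s` and
    -- `t` equal or adjacent; the lower one compares `2^{-γn}` with `|t-s|^γ`.
    obtain ⟨n, hn1, hn2⟩ := exists_nat_pow_near_of_lt_one (x := (t - s) / T) (y := 1 / 2)
      (div_pos (by linarith) hT) ((div_le_one hT).mpr (by linarith [hs.1, ht.2])) (by norm_num)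
      (by norm_num)
    have hmid : D (g n s) (g n t) ≤ e n := by
      obtain ⟨a1, a2⟩ := dyadicIdx_bounds hT n hs.1
      obtain ⟨b1, b2⟩ := dyadicIdx_bounds hT n ht.1
      have h1 : 2 ^ n * (t / T) - 2 ^ n * (s / T) ≤ 1 := by
        calc 2 ^ n * (t / T) - 2 ^ n * (s / T) = 2 ^ n * ((t - s) / T) := by ring
          _ ≤ 2 ^ n * (1 / 2) ^ n := by gcongr
          _ = 1 := by rw [← mul_pow]; norm_num
      have h2 : dyadicIdx T n t < dyadicIdx T n s + 2 := by
        have : (dyadicIdx T n t : ℝ) < dyadicIdx T n s + 2 := by linarith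
        exact_mod_cast this
      have h3 : dyadicIdx T n s ≤ dyadicIdx T n t := by
        refine Nat.floor_le_floor ?_
        gcongr
      rcases (by omega : dyadicIdx T n t = dyadicIdx T n s ∨
        dyadicIdx T n t = dyadicIdx T n s + 1) with h | h
      · simp only [g, h, hself, zero_le]
      · have := hstep n (dyadicIdx T n s) (by have := dyadicIdx_le hT n ht.2; omega)
        rwa [← h] at this
    have h1 : D s t ≤ (G + (1 + G)) * e n := by
      calc D s t ≤ D s (g n s) + (D (g n s) (g n t) + D (g n t) t) :=
            (htri _ (g n s) _).trans (by gcongr; exact htri _ _ _)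
        _ ≤ G * e n + (e n + G * e n) := by
            gcongr
            · rw [hsymm]; exact hlim n s hs
            · exact hlim n t ht
        _ = _ := by ring
    have hts : 0 < |t - s| ^ γ := Real.rpow_pos_of_pos (abs_pos.mpr (by linarith)) _
    have h2 : ((2 : ℝ) ^ (-γ)) ^ n ≤ (2 / T) ^ γ * |t - s| ^ γ := by
      have h3 : ((2 : ℝ) ^ (-γ)) ^ n = ((1 / 2) ^ n) ^ γ := by
        rw [← Real.rpow_natCast, ← Real.rpow_natCast, ← Real.rpow_mul (by norm_num),
          ← Real.rpow_mul (by norm_num), one_div, Real.inv_rpow (by norm_num),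
          ← Real.rpow_neg (by norm_num)]
        congr 1; ring
      rw [h3, ← Real.mul_rpow (by positivity) (abs_nonneg _), abs_of_pos (by linarith)]
      refine Real.rpow_le_rpow (by positivity) ?_ hγ.le
      rw [pow_succ] at hn1
      have : 2 / T * (t - s) = 2 * ((t - s) / T) := by ring
      rw [this]; linarith
    have h4 : D s t / ENNReal.ofReal (|t - s| ^ γ) ≤ c * S ^ (1 / q) := by
      rw [ENNReal.div_le_iff (by simpa using hts) ENNReal.ofReal_ne_top]
      refine h1.trans ?_
      calc (G + (1 + G)) * e n ≤ (G + (1 + G)) *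
            (ENNReal.ofReal ((2 / T) ^ γ * |t - s| ^ γ) * S ^ (1 / q)) := by
            simp only [he]; gcongr
        _ = _ := by rw [ENNReal.ofReal_mul (by positivity), hc]; ring
    calc _ ≤ (c * S ^ (1 / q)) ^ q := by gcongr
      _ = c ^ q * S := by
        rw [ENNReal.mul_rpow_of_nonneg _ _ hq.le, ← ENNReal.rpow_mul, one_div_mul_cancel hq.ne',
          ENNReal.rpow_one]
  intro s hs t ht hst
  rcases hst.lt_or_gt with h | h
  · exact main s hs t ht h
  · rw [hsymm, abs_sub_comm]
    exact main t ht s hs h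

end Chaining
end

noncomputable section

/-! ### Quantitative regularity of the vector field and of its dyadic blocks. -/

section MixedBound

variable {d : ℕ} {Ω : Type*} [MetricSpace Ω]

/-- Quantitative form of membership in `C^{α,κ}`, with the roles of the variables exchanged. -/
structure MixedBound (α κ A : ℝ) (f : Ω → EucSp d → ℝ) : Prop where
  contDiff : ∀ y, ContDiff ℝ ⌊α⌋₊ (f y)
  bound : ∀ L : List (Fin d), L.length ≤ ⌊α⌋₊ → ∀ x y, |listD L (f y) x| ≤ A
  holder_right : ∀ L : List (Fin d), L.length ≤ ⌊α⌋₊ → ∀ x y y',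
    |listD L (f y) x - listD L (f y') x| ≤ A * dist y y' ^ κ
  holder_left : ∀ L : List (Fin d), L.length = ⌊α⌋₊ → ∀ x x' y,
    |listD L (f y) x - listD L (f y) x'| ≤ A * ‖x - x'‖ ^ (α - ⌊α⌋₊)
  holder_both : ∀ L : List (Fin d), L.length = ⌊α⌋₊ → ∀ x x' y y',
    |(listD L (f y) x - listD L (f y) x') - (listD L (f y') x - listD L (f y') x')| ≤
      A * ‖x - x'‖ ^ (α - ⌊α⌋₊) * dist y y' ^ κ

lemma abs_le_of_holderNormM_le {κ c : ℝ} (hc : 0 ≤ c) {v : Ω → ℝ}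
    (h : holderNormM κ v ≤ ENNReal.ofReal c) :
    (∀ y, |v y| ≤ c) ∧ ∀ y y', |v y - v y'| ≤ c * dist y y' ^ κ := by
  constructor
  · intro y
    have h1 : ‖v y‖ₑ ≤ ENNReal.ofReal c :=
      (le_iSup (fun y => ‖v y‖ₑ) y).trans (le_self_add.trans h)
    rwa [← ofReal_norm, ENNReal.ofReal_le_ofReal_iff hc] at h1
  · intro y y'
    by_cases hy : y = y'
    · subst hy; simp; positivity
    have hpos : 0 < dist y y' ^ κ := Real.rpow_pos_of_pos (dist_pos.mpr hy) _
    have h1 : ‖v y - v y'‖ₑ / ENNReal.ofReal (dist y y' ^ κ) ≤ ENNReal.ofReal c := by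
      refine le_trans ?_ (le_add_self.trans h)
      exact le_iSup_of_le y (le_iSup_of_le y' (le_iSup_of_le (f := fun _ : y ≠ y' =>
        ‖v y - v y'‖ₑ / ENNReal.ofReal (dist y y' ^ κ)) hy le_rfl))
    rw [← ofReal_norm, ← ENNReal.ofReal_div_of_pos hpos, ENNReal.ofReal_le_ofReal_iff hc,
      div_le_iff₀ hpos] at h1
    exact h1

lemma exists_mixedBound {α κ : ℝ} {u : EucSp d → Ω → ℝ}
    (hu : ∀ y, ContDiff ℝ ⌊α⌋₊ fun x => u x y)
    (hfin : mixedNorm (holderNormM κ) α u < ∞) :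
    ∃ A : ℝ, 0 ≤ A ∧ MixedBound α κ A fun y x => u x y := by
  set c := (mixedNorm (holderNormM κ) α u).toReal with hcdef
  have hc : 0 ≤ c := ENNReal.toReal_nonneg
  have hcE : mixedNorm (holderNormM κ) α u = ENNReal.ofReal c :=
    (ENNReal.ofReal_toReal hfin.ne).symm
  have h1 : ∀ L : List (Fin d), L.length ≤ ⌊α⌋₊ → ∀ x,
      holderNormM κ (fun y => listD L (fun x => u x y) x) ≤ ENNReal.ofReal c := by
    intro L hL x
    obtain ⟨k, hk, hkL⟩ := exists_listD_eq_multiD L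
    have hD : ∀ y, listD L (fun x => u x y) = multiD k fun x => u x y := fun y =>
      hkL _ ((hu y).of_le (by exact_mod_cast hL))
    simp only [hD]
    rw [← hcE, mixedNorm]
    refine le_trans ?_ le_self_add
    refine le_trans ?_ (Finset.single_le_sum (fun _ _ => zero_le)
      (Finset.mem_range.mpr (Nat.lt_succ_of_le hL)))
    refine le_trans ?_ (Finset.single_le_sum (fun _ _ => zero_le) hk)
    exact le_iSup (fun x => holderNormM κ fun y => multiD k (fun x => u x y) x) x
  have hb := fun (L : List (Fin d)) (hL : L.length ≤ ⌊α⌋₊) x =>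
    abs_le_of_holderNormM_le hc (h1 L hL x)
  have h2 : ∀ L : List (Fin d), L.length = ⌊α⌋₊ → ∀ x x',
      (∀ y, |listD L (fun x => u x y) x - listD L (fun x => u x y) x'| ≤
        2 * c * ‖x - x'‖ ^ (α - ⌊α⌋₊)) ∧
      ∀ y y', |(listD L (fun x => u x y) x - listD L (fun x => u x y) x') -
        (listD L (fun x => u x y') x - listD L (fun x => u x y') x')| ≤
        2 * c * ‖x - x'‖ ^ (α - ⌊α⌋₊) * dist y y' ^ κ := by
    intro L hL x x'
    by_cases hx : x = x'
    · subst hx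
      simp only [sub_self, abs_zero]
      constructor
      · intro y; positivity
      · intro y y'; positivity
    -- For integral `α` the norm contains no difference quotient. The exponent is then `0` and the
    -- triangle inequality supplies the bound, at the cost of the factor `2`.
    by_cases hint : (⌊α⌋₊ : ℝ) = α
    · rw [hint, sub_self, Real.rpow_zero, mul_one]
      obtain ⟨b1, b2⟩ := hb L hL.le x
      obtain ⟨b3, b4⟩ := hb L hL.le x'
      constructor
      · intro y
        have := b1 y
        have := b3 y
        exact (abs_sub _ _).trans (by linarith)
      · intro y y'
        rw [sub_sub_sub_comm]
        have := b2 y y'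
        have := b4 y y'
        exact (abs_sub _ _).trans (by linarith)
    · have hpos : 0 < ‖x - x'‖ ^ (α - ⌊α⌋₊) :=
        Real.rpow_pos_of_pos (norm_pos_iff.mpr (sub_ne_zero.mpr hx)) _
      obtain ⟨k, hk, hkL⟩ := exists_listD_eq_multiD L
      have hD : ∀ y, listD L (fun x => u x y) = multiD k fun x => u x y := fun y =>
        hkL _ ((hu y).of_le (by exact_mod_cast hL.le))
      simp only [hD]
      rw [hL] at hk
      have h3 : holderNormM κ (fun y => multiD k (fun x => u x y) x - multiD k (fun x => u x y) x') /
          ENNReal.ofReal (‖x - x'‖ ^ (α - ⌊α⌋₊)) ≤ ENNReal.ofReal c := by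
        rw [← hcE, mixedNorm, if_neg hint]
        refine le_trans ?_ le_add_self
        refine le_trans ?_ (Finset.single_le_sum (fun _ _ => zero_le) hk)
        exact le_iSup_of_le x (le_iSup_of_le x' (le_iSup_of_le (f := fun _ : x ≠ x' =>
          holderNormM κ (fun y => multiD k (fun x => u x y) x - multiD k (fun x => u x y) x') /
          ENNReal.ofReal (‖x - x'‖ ^ (α - ⌊α⌋₊))) hx le_rfl))
      rw [ENNReal.div_le_iff (by simpa using hpos) ENNReal.ofReal_ne_top, ← ENNReal.ofReal_mul hc] at h3
      obtain ⟨b1, b2⟩ := abs_le_of_holderNormM_le (by positivity) h3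
      have hle : c * ‖x - x'‖ ^ (α - ⌊α⌋₊) ≤ 2 * c * ‖x - x'‖ ^ (α - ⌊α⌋₊) := by
        gcongr; linarith
      exact ⟨fun y => (b1 y).trans hle, fun y y' => (b2 y y').trans (by gcongr)⟩
  refine ⟨2 * c, by positivity, hu, fun L hL x y => ?_, fun L hL x y y' => ?_,
    fun L hL x x' y => (h2 L hL x x').1 y, fun L hL x x' y y' => (h2 L hL x x').2 y y'⟩
  · exact ((hb L hL x).1 y).trans (by linarith)
  · exact ((hb L hL x).2 y y').trans (by gcongr; linarith)

namespace MixedBound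

variable {α κ A : ℝ} {f : Ω → EucSp d → ℝ}

lemma nonneg [Nonempty Ω] (hf : MixedBound α κ A f) : 0 ≤ A :=
  (abs_nonneg _).trans (hf.bound [] (by simp) 0 (Classical.arbitrary Ω))

lemma mono {B : ℝ} (hf : MixedBound α κ A f) (h : A ≤ B) : MixedBound α κ B f where
  contDiff := hf.contDiff
  bound L hL x y := (hf.bound L hL x y).trans h
  holder_right L hL x y y' := (hf.holder_right L hL x y y').trans (by gcongr)
  holder_left L hL x x' y := (hf.holder_left L hL x x' y).trans (by gcongr)
  holder_both L hL x x' y y' := (hf.holder_both L hL x x' y y').trans (by gcongr)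

/-- Joint continuity follows from continuity in `x` at one `y` together with Hölder continuity in
`y` uniform in `x`. -/
lemma niceFam (hf : MixedBound α κ A f) (hκ : 0 < κ) : NiceFam ⌊α⌋₊ f := by
  refine ⟨hf.contDiff, fun L hL => ?_⟩
  rw [continuous_iff_continuousAt]
  rintro ⟨y, x⟩
  have h1 : Tendsto (fun w : Ω × EucSp d => listD L (f y) w.2) (𝓝 (y, x)) (𝓝 (listD L (f y) x)) :=
    ((continuous_listD (hf.contDiff y) hL).comp continuous_snd).tendsto (y, x)
  have h2 : Tendsto (fun w : Ω × EucSp d => listD L (f w.1) w.2 - listD L (f y) w.2) (𝓝 (y, x))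
      (𝓝 0) := by
    have hc : ContinuousAt (fun w : Ω × EucSp d => A * dist w.1 y ^ κ) (y, x) :=
      continuousAt_const.mul (ContinuousAt.rpow_const (by fun_prop) (Or.inr hκ.le))
    have hz : Tendsto (fun w : Ω × EucSp d => A * dist w.1 y ^ κ) (𝓝 (y, x)) (𝓝 0) := by
      simpa [ContinuousAt, Real.zero_rpow hκ.ne'] using hc
    exact squeeze_zero_norm (fun w => hf.holder_right L hL w.2 w.1 y) hz
  simpa [ContinuousAt] using h1.add h2

lemma abs_ev_le (hf : MixedBound α κ A f) (hA : 0 ≤ A) {θ : ℝ} (hθ₀ : 0 ≤ θ) (hθ : θ < α) (y : Ω)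
    {l : HFun d} (hl : l.Adm θ) : |l.ev (f y)| ≤ 2 * A + d * A := by
  have hdA : 0 ≤ d * A := by positivity
  have hle : ⌊θ⌋₊ ≤ ⌊α⌋₊ := Nat.floor_le_floor hθ.le
  refine HFun.abs_ev_le (θ := θ) (fun L hL x => ?_) (fun L hL x x' => ?_) hl
  · exact (hf.bound L (hL.trans hle) x y).trans (by linarith)
  · have h2A : |listD L (f y) x - listD L (f y) x'| ≤ 2 * A := by
      have b1 := hf.bound L (hL.le.trans hle) x y
      have b2 := hf.bound L (hL.le.trans hle) x' y
      exact (abs_sub _ _).trans (by linarith)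
    obtain ⟨hβ0, hβ1⟩ := sub_floor_mem hθ₀
    -- If `θ` and `α` have the same integer part, the `α`-Hölder bound is interpolated with the
    -- supremum. Otherwise one more derivative is available and gives a Lipschitz bound to
    -- interpolate.
    rcases hle.eq_or_lt with h | h
    · have h3 := hf.holder_left L (hL.trans h) x x' y
      rw [← h] at h3
      have ht : 0 ≤ ‖x - x'‖ ^ (θ - ⌊θ⌋₊) := by positivity
      have : |listD L (f y) x - listD L (f y) x'| ≤ 2 * A * ‖x - x'‖ ^ (θ - ⌊θ⌋₊) := by
        rcases le_total ‖x - x'‖ 1 with h1 | h1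
        · rcases eq_or_ne x x' with rfl | hx
          · simp; positivity
          · have : ‖x - x'‖ ^ (α - ⌊θ⌋₊) ≤ ‖x - x'‖ ^ (θ - ⌊θ⌋₊) :=
              Real.rpow_le_rpow_of_exponent_ge (norm_pos_iff.mpr (sub_ne_zero.mpr hx)) h1
                (by linarith)
            nlinarith
        · have : 1 ≤ ‖x - x'‖ ^ (θ - ⌊θ⌋₊) := Real.one_le_rpow h1 hβ0
          nlinarith
      exact this.trans (by gcongr; linarith)
    · refine abs_le_mul_rpow h2A ?_ (norm_nonneg _) hβ0 hβ1 hdA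
      refine abs_sub_le_of_partialD ?_ (fun i x => hf.bound (i :: L) (by simp; omega) x y) x x'
      refine (ContDiff.listD (n := 1) L ?_).differentiable (by simp)
      exact (hf.contDiff y).of_le (by norm_cast; omega)

end MixedBound

lemma qblock_sub {M : ℕ} {f g : EucSp d → ℝ} (hf : Continuous f) (hg : Continuous g) (n : ℕ)
    (x : EucSp d) : qblock M n (fun x => f x - g x) x = qblock M n f x - qblock M n g x := by
  cases n with
  | zero => exact qmoll_sub hf hg _ x
  | succ n => simp only [qblock, qmoll_sub hf hg]; ring

lemma qblock_const_mul {M : ℕ} (c : ℝ) (f : EucSp d → ℝ) (n : ℕ) (x : EucSp d) :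
    qblock M n (fun x => c * f x) x = c * qblock M n f x := by
  have h : ∀ r, moll r (fun x => c * f x) x = c * moll r f x := by
    intro r
    simp only [moll, ← integral_const_mul, mul_left_comm]
  have h' : ∀ s, qmoll M s (fun x => c * f x) x = c * qmoll M s f x := by
    intro s
    simp only [qmoll, h, Finset.mul_sum, mul_left_comm]
  cases n <;> simp only [qblock, h', mul_sub]

/-- Dyadic blocks commute with integration over a parameter in a finite measure space. -/
lemma qblock_integral {Y : Type*} [TopologicalSpace Y] [MeasurableSpace Y] [OpensMeasurableSpace Y]
    [SecondCountableTopology Y] {ν : Measure Y} [IsFiniteMeasure ν] {M : ℕ} {f : Y → EucSp d → ℝ}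
    (hf : Continuous f.uncurry) {A : ℝ} (hA : ∀ᵐ y ∂ν, ∀ x, |f y x| ≤ A) (n : ℕ) (x : EucSp d) :
    qblock M n (fun x => ∫ y, f y x ∂ν) x = ∫ y, qblock M n (f y) x ∂ν := by
  have hball : IsFiniteMeasure (volume.restrict (Metric.closedBall (0 : EucSp d) 1)) :=
    ⟨by simpa using measure_closedBall_lt_top⟩
  have hm : ∀ r, moll r (fun x => ∫ y, f y x ∂ν) x = ∫ y, moll r (f y) x ∂ν := by
    intro r
    simp only [moll, ← integral_const_mul]
    rw [integral_integral_swap]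
    obtain ⟨B, hB⟩ := ((isCompact_closedBall (0 : EucSp d) 1).image
      (continuous_mollBump (d := d))).isBounded.exists_norm_le
    have hc : Continuous fun w : EucSp d × Y => mollBump d w.1 * f w.2 (x + r • w.1) :=
      (continuous_mollBump.comp continuous_fst).mul (hf.comp
        (by fun_prop : Continuous fun w : EucSp d × Y => (w.2, x + r • w.1)))
    refine Integrable.of_bound (C := B * A) hc.aestronglyMeasurable ?_
    have h1 : ∀ᵐ h ∂(volume.restrict (Metric.closedBall (0 : EucSp d) 1)), ‖mollBump d h‖ ≤ B := by
      rw [ae_restrict_iff' measurableSet_closedBall]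
      exact Eventually.of_forall fun h hh => hB _ (mem_image_of_mem _ hh)
    filter_upwards [Measure.quasiMeasurePreserving_fst.ae h1,
      Measure.quasiMeasurePreserving_snd.ae hA] with w hw1 hw2
    simp only [Function.uncurry_def, norm_mul]
    exact mul_le_mul hw1 (hw2 _) (norm_nonneg _) ((norm_nonneg _).trans hw1)
  have hint : ∀ r, Integrable (fun y => moll r (f y) x) ν := by
    intro r
    have hmeas : AEStronglyMeasurable (fun y => moll r (f y) x) ν := by
      have hc : Continuous fun w : Y × EucSp d => mollBump d w.2 * f w.1 (x + r • w.2) :=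
        (continuous_mollBump.comp continuous_snd).mul (hf.comp
          (by fun_prop : Continuous fun w : Y × EucSp d => (w.1, x + r • w.2)))
      exact (hc.stronglyMeasurable.integral_prod_right
        (ν := volume.restrict (Metric.closedBall (0 : EucSp d) 1))).aestronglyMeasurable
    refine Integrable.of_bound hmeas A ?_
    filter_upwards [hA] with y hy
    exact abs_moll_le hy r x
  have hq : ∀ s, qmoll M s (fun x => ∫ y, f y x ∂ν) x = ∫ y, qmoll M s (f y) x ∂ν := by
    intro s
    simp only [qmoll, hm]
    rw [integral_finsetSum _ fun j _ => (hint _).const_mul _]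
    simp only [integral_const_mul]
  have hqi : ∀ s, Integrable (fun y => qmoll M s (f y) x) ν := fun s =>
    integrable_finsetSum _ fun j _ => (hint _).const_mul _
  cases n with
  | zero => exact hq _
  | succ n =>
    simp only [qblock, hq]
    rw [integral_sub (hqi _) (hqi _)]

lemma qblock_intervalIntegral {M : ℕ} {f : ℝ → EucSp d → ℝ}
    (hf : Continuous f.uncurry) {A a b : ℝ} (hA : ∀ u ∈ uIoc a b, ∀ x, |f u x| ≤ A) (n : ℕ)
    (x : EucSp d) : qblock M n (fun x => ∫ u in a..b, f u x) x = ∫ u in a..b, qblock M n (f u) x := by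
  simp only [intervalIntegral.intervalIntegral_eq_integral_uIoc, smul_eq_mul, qblock_const_mul]
  have : IsFiniteMeasure (volume.restrict (uIoc a b)) := ⟨by simp [uIoc]⟩
  rw [qblock_integral hf (A := A)]
  rw [ae_restrict_iff' measurableSet_uIoc]
  exact Eventually.of_forall hA

lemma continuous_qblock_family {P : Type*} [TopologicalSpace P] [FirstCountableTopology P] {M : ℕ}
    {f : P → EucSp d → ℝ} (hf : Continuous f.uncurry) (n : ℕ) :
    Continuous fun w : P × EucSp d => qblock M n (f w.1) w.2 := by
  have h : ∀ s : ℝ, Continuous fun w : P × EucSp d => qmoll M s (f w.1) w.2 := fun s =>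
    (continuous_qmoll_family hf).comp (by fun_prop : Continuous fun w : P × EucSp d => (w.1, s, w.2))
  cases n with
  | zero => exact h 1
  | succ n => exact (h _).sub (h _)

/-- The decay estimate is applied to `f y` for the size and to `f y - f y'` for the Hölder constant;
the latter function has all its bounds multiplied by `dist y y' ^ κ`. The mean vanishes because
blocks commute with integration over `Ω`. -/
lemma MixedBound.exists_holderBall_qblock [MeasurableSpace Ω] [BorelSpace Ω]
    [SecondCountableTopology Ω] {μ : Measure Ω} [IsProbabilityMeasure μ] {α κ A : ℝ} (hα : 0 ≤ α)
    (hκ : 0 < κ) {f : Ω → EucSp d → ℝ} (hf : MixedBound α κ A f) (hmean : ∀ x, ∫ y, f y x ∂μ = 0) :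
    ∃ C : ℝ, 0 ≤ C ∧ ∀ (n : ℕ) (x : EucSp d),
      HolderBall μ κ (C * 2 ^ (-(α * n))) fun y => qblock (⌊α⌋₊ + 1) n (f y) x := by
  obtain ⟨C, hC, h⟩ := exists_abs_qblock_le d hα
  have : Nonempty Ω := μ.nonempty_of_neZero
  have hA := hf.nonneg
  refine ⟨C * A, by positivity, fun n x => ⟨fun y => ?_, fun y y' => ?_, ?_⟩⟩
  · exact h A (f y) (hf.contDiff y) (fun x => hf.bound [] (by simp) x y)
      (fun L hL x x' => hf.holder_left L hL x x' y) n x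
  · rw [← qblock_sub (hf.contDiff y).continuous (hf.contDiff y').continuous]
    have := h (A * dist y y' ^ κ) (fun x => f y x - f y' x) ((hf.contDiff y).sub (hf.contDiff y'))
      (fun x => hf.holder_right [] (by simp) x y y') (fun L hL x x' => ?_) n x
    · exact this.trans_eq (by ring)
    · have hL' : (L.length : WithTop ℕ∞) ≤ ⌊α⌋₊ := by exact_mod_cast hL.le
      rw [listD_sub L ((hf.contDiff y).of_le hL') ((hf.contDiff y').of_le hL')]
      have := hf.holder_both L hL x x' y y'
      rw [sub_sub_sub_comm]
      exact this.trans_eq (by ring)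
  · rw [← qblock_integral (hf.niceFam hκ).continuous_uncurry (A := A)
      (Eventually.of_forall fun y x => hf.bound [] (by simp) x y)]
    simp only [hmean]
    exact qblock_zero_fun n x

end MixedBound
end

noncomputable section

/-! ### Iterated integrals of paths of functions and Chen's relation. -/

section PathInt

variable {d : ℕ}

/-- The integral over `[s,t]` of a path of functions. -/
def pathInt (g : ℝ → EucSp d → ℝ) (s t : ℝ) (x : EucSp d) : ℝ := ∫ u in s..t, g u x

/-- The iterated integral over `[s,t]` of two paths of functions. -/
def pathInt₂ (g h : ℝ → EucSp d → ℝ) (s t : ℝ) (x z : EucSp d) : ℝ :=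
  ∫ r in s..t, pathInt g s r x * h r z

variable {P : Type*} [TopologicalSpace P] [FirstCountableTopology P] {m : ℕ}

lemma NiceFam.pathInt_family {G : P → ℝ → EucSp d → ℝ}
    (hG : NiceFam m fun w : P × ℝ => G w.1 w.2) :
    NiceFam m fun q : P × ℝ × ℝ => pathInt (G q.1) q.2.1 q.2.2 :=
  NiceFam.intervalIntegral (P := P × ℝ × ℝ) (f := fun w x => G w.1.1 w.2 x)
    (hG.comp (by fun_prop : Continuous fun w : (P × ℝ × ℝ) × ℝ => (w.1.1, w.2)))
    (by fun_prop) (by fun_prop)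

lemma NiceFam.pathInt₂_family {G H : P → ℝ → EucSp d → ℝ}
    (hG : NiceFam m fun w : P × ℝ => G w.1 w.2) (hH : NiceFam m fun w : P × ℝ => H w.1 w.2) :
    NiceFam₂ m fun q : P × ℝ × ℝ => pathInt₂ (G q.1) (H q.1) q.2.1 q.2.2 :=
  NiceFam₂.intervalIntegral (P := P × ℝ × ℝ) (F := fun w x => pathInt (G w.1.1) w.1.2.1 w.2 x)
    (G := fun w x => H w.1.1 w.2 x)
    (hG.pathInt_family.comp
      (by fun_prop : Continuous fun w : (P × ℝ × ℝ) × ℝ => (w.1.1, w.1.2.1, w.2)))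
    (hH.comp (by fun_prop : Continuous fun w : (P × ℝ × ℝ) × ℝ => (w.1.1, w.2)))
    (by fun_prop) (by fun_prop)

variable {g h : ℝ → EucSp d → ℝ}

lemma NiceFam.pathInt (hg : NiceFam m g) : NiceFam m fun q : ℝ × ℝ => pathInt g q.1 q.2 :=
  (NiceFam.pathInt_family (P := Unit) (G := fun _ => g) (hg.comp continuous_snd)).comp
    (by fun_prop : Continuous fun q : ℝ × ℝ => ((), q))

lemma NiceFam.pathInt₂ (hg : NiceFam m g) (hh : NiceFam m h) :
    NiceFam₂ m fun q : ℝ × ℝ => pathInt₂ g h q.1 q.2 :=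
  (NiceFam.pathInt₂_family (P := Unit) (G := fun _ => g) (H := fun _ => h)
    (hg.comp continuous_snd) (hh.comp continuous_snd)).comp
    (by fun_prop : Continuous fun q : ℝ × ℝ => ((), q))

lemma NiceFam.contDiff_pathInt (hg : NiceFam m g) (s t : ℝ) : ContDiff ℝ m (_root_.pathInt g s t) :=
  hg.pathInt.contDiff (s, t)

lemma NiceFam.pathInt₂_unit (hg : NiceFam m g) (hh : NiceFam m h) (s t : ℝ) :
    NiceFam₂ m fun _ : Unit => _root_.pathInt₂ g h s t :=
  (hg.pathInt₂ hh).comp (g := fun _ => (s, t)) continuous_const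

lemma NiceFam.intervalIntegrable (hg : NiceFam m g) (s t : ℝ) (x : EucSp d) :
    IntervalIntegrable (fun u => g u x) volume s t :=
  (hg.continuous_uncurry.comp (by fun_prop : Continuous fun u : ℝ => (u, x))).intervalIntegrable _ _

lemma pathInt_self (g : ℝ → EucSp d → ℝ) (s : ℝ) (x : EucSp d) : pathInt g s s x = 0 :=
  intervalIntegral.integral_same

lemma pathInt₂_self (g h : ℝ → EucSp d → ℝ) (s : ℝ) (x z : EucSp d) : pathInt₂ g h s s x z = 0 :=
  intervalIntegral.integral_same

lemma pathInt_swap (g : ℝ → EucSp d → ℝ) (s t : ℝ) (x : EucSp d) :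
    pathInt g t s x = -1 * pathInt g s t x := by
  rw [neg_one_mul]; exact intervalIntegral.integral_symm _ _

lemma pathInt_add (hg : NiceFam m g) (s t u : ℝ) (x : EucSp d) :
    pathInt g s u x = pathInt g s t x + pathInt g t u x :=
  (intervalIntegral.integral_add_adjacent_intervals (hg.intervalIntegrable _ _ _)
    (hg.intervalIntegrable _ _ _)).symm

/-- Chen's relation. -/
lemma pathInt₂_add (hg : NiceFam m g) (hh : NiceFam m h) (s t u : ℝ) (x z : EucSp d) :
    pathInt₂ g h s u x z =
      pathInt₂ g h s t x z + pathInt₂ g h t u x z + pathInt g s t x * pathInt h t u z := by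
  have hc : ∀ s, Continuous fun r => pathInt g s r x * h r z := fun s =>
    (hg.pathInt.continuous_uncurry.comp (by fun_prop : Continuous fun r : ℝ => ((s, r), x))).mul
      (hh.continuous_uncurry.comp (by fun_prop : Continuous fun r : ℝ => (r, z)))
  have h1 : pathInt₂ g h s u x z = pathInt₂ g h s t x z + ∫ r in t..u, pathInt g s r x * h r z :=
    (intervalIntegral.integral_add_adjacent_intervals ((hc s).intervalIntegrable _ _)
      ((hc s).intervalIntegrable _ _)).symm
  rw [h1, add_assoc]
  congr 1
  have h2 : (fun r => pathInt g s r x * h r z) =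
      fun r => pathInt g s t x * h r z + pathInt g t r x * h r z := by
    funext r; rw [pathInt_add hg s t r x, add_mul]
  rw [h2, intervalIntegral.integral_add, intervalIntegral.integral_const_mul, add_comm]
  · rfl
  · exact (hh.intervalIntegrable _ _ _).const_mul _
  · exact (hc t).intervalIntegrable _ _

variable {θ : ℝ}

lemma hsup_pathInt_le (hg : NiceFam ⌊θ⌋₊ g) {A : ℝ}
    (hA : ∀ (l : HFun d) (r : ℝ), l.Adm θ → |l.ev (g r)| ≤ A) (s t : ℝ) :
    hsup θ (pathInt g s t) ≤ ENNReal.ofReal (A * |t - s|) := by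
  refine iSup₂_le fun l hl => ?_
  have : l.ev (pathInt g s t) = ∫ u in s..t, l.ev (g u) := HFun.ev_intervalIntegral hg hl.1 s t
  rw [this, ← ofReal_norm]
  exact ENNReal.ofReal_le_ofReal
    (intervalIntegral.norm_integral_le_of_norm_le_const fun u _ => hA l u hl)

lemma abs_ev_pathInt_le (hg : NiceFam ⌊θ⌋₊ g) {A : ℝ} (hA₀ : 0 ≤ A)
    (hA : ∀ (l : HFun d) (r : ℝ), l.Adm θ → |l.ev (g r)| ≤ A) (s t : ℝ) {l : HFun d}
    (hl : l.Adm θ) : |l.ev (pathInt g s t)| ≤ A * |t - s| := by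
  have := (enorm_ev_le_hsup hl _).trans (hsup_pathInt_le hg hA s t)
  rwa [← ofReal_norm, ENNReal.ofReal_le_ofReal_iff (by positivity)] at this

/-- Functionals in the two variables pass to separate factors of the integrand. One factor `|t - s|`
comes from the inner integral, the other from the outer one. -/
lemma hsup₂_pathInt₂_le (hg : NiceFam ⌊θ⌋₊ g) (hh : NiceFam ⌊θ⌋₊ h) {A B : ℝ} (hA₀ : 0 ≤ A)
    (hA : ∀ (l : HFun d) (r : ℝ), l.Adm θ → |l.ev (g r)| ≤ A)
    (hB : ∀ (l : HFun d) (r : ℝ), l.Adm θ → |l.ev (h r)| ≤ B) (s t : ℝ) :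
    hsup₂ θ (pathInt₂ g h s t) ≤ ENNReal.ofReal (A * B * |t - s| ^ 2) := by
  have hF : NiceFam ⌊θ⌋₊ fun r => pathInt g s r :=
    hg.pathInt.comp (by fun_prop : Continuous fun r : ℝ => (s, r))
  refine iSup₂_le fun l hl => iSup₂_le fun l' hl' => ?_
  have hF1 : Continuous fun r => l.ev (pathInt g s r) := HFun.continuous_ev hF hl.1
  have h1 : (fun z => l.ev fun x => pathInt₂ g h s t x z) =
      fun z => ∫ r in s..t, l.ev (pathInt g s r) * h r z := by
    funext z
    have := HFun.ev_intervalIntegral (hF.mul_const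
      (hh.continuous_uncurry.comp (by fun_prop : Continuous fun r : ℝ => (r, z)))) hl.1 s t
    refine this.trans ?_
    simp only [HFun.ev_mul_const, Function.comp_def]
  rw [h1, HFun.ev_intervalIntegral (hh.const_mul hF1) hl'.1 s t, ← ofReal_norm]
  refine ENNReal.ofReal_le_ofReal ?_
  rw [sq, ← mul_assoc]
  refine intervalIntegral.norm_integral_le_of_norm_le_const fun r hr => ?_
  rw [HFun.ev_const_mul, norm_mul, mul_right_comm]
  have hB₀ : 0 ≤ B := (abs_nonneg _).trans (hB l' r hl')
  have hr' : |r - s| ≤ |t - s| := by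
    rcases le_total s t with hst | hst
    · rw [uIoc_of_le hst] at hr
      rw [abs_of_nonneg (by linarith [hr.1]), abs_of_nonneg (by linarith)]; linarith [hr.2]
    · rw [uIoc_of_ge hst] at hr
      rw [abs_of_nonpos (by linarith [hr.2]), abs_of_nonpos (by linarith)]; linarith [hr.1]
  exact mul_le_mul ((abs_ev_pathInt_le hg hA₀ hA s r hl).trans (by gcongr)) (hB l' r hl')
    (norm_nonneg _) (by positivity)

lemma hsup_pathInt_swap (g : ℝ → EucSp d → ℝ) (s t : ℝ) :
    hsup θ (pathInt g t s) = hsup θ (pathInt g s t) := by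
  have : pathInt g t s = fun x => -1 * pathInt g s t x := funext fun x => pathInt_swap g s t x
  rw [this, hsup_const_mul]; simp

lemma hsup_zero : hsup θ (fun _ : EucSp d => 0) = 0 := by
  simp [hsup, HFun.ev_zero]

lemma hsup₂_zero : hsup₂ θ (fun _ _ : EucSp d => 0) = 0 := by
  simp [hsup₂, HFun.ev_zero, hsup_zero]

lemma hsup_pathInt_add_le (hg : NiceFam ⌊θ⌋₊ g) (s t u : ℝ) :
    hsup θ (pathInt g s u) ≤ hsup θ (pathInt g s t) + hsup θ (pathInt g t u) := by
  have : pathInt g s u = fun x => pathInt g s t x + pathInt g t u x :=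
    funext fun x => pathInt_add hg s t u x
  rw [this]
  exact hsup_add_le (hg.contDiff_pathInt _ _) (hg.contDiff_pathInt _ _)

lemma hsup₂_pathInt₂_add_le (hg : NiceFam ⌊θ⌋₊ g) (hh : NiceFam ⌊θ⌋₊ h) (s t u : ℝ) :
    hsup₂ θ (pathInt₂ g h s u) ≤ hsup₂ θ (pathInt₂ g h s t) + hsup₂ θ (pathInt₂ g h t u) +
      hsup θ (pathInt g s t) * hsup θ (pathInt h t u) := by
  have : pathInt₂ g h s u = fun x z => pathInt₂ g h s t x z + pathInt₂ g h t u x z +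
      pathInt g s t x * pathInt h t u z :=
    funext fun x => funext fun z => pathInt₂_add hg hh s t u x z
  have h1 : NiceFam ⌊θ⌋₊ fun _ : Unit => pathInt g s t := .of_contDiff (hg.contDiff_pathInt _ _)
  have h2 : NiceFam ⌊θ⌋₊ fun _ : Unit => pathInt h t u := .of_contDiff (hh.contDiff_pathInt _ _)
  rw [this]
  refine (hsup₂_add_le ((hg.pathInt₂_unit hh s t).add (hg.pathInt₂_unit hh t u)) (.mul h1 h2)).trans ?_
  gcongr
  · exact hsup₂_add_le (hg.pathInt₂_unit hh s t) (hg.pathInt₂_unit hh t u)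
  · exact hsup₂_mul_le _ _

/-- Chen's relation along `s, t, s`, where the total increment is zero, expresses the backward
increment through forward ones. -/
lemma hsup₂_pathInt₂_swap_le (hg : NiceFam ⌊θ⌋₊ g) (hh : NiceFam ⌊θ⌋₊ h) (s t : ℝ) :
    hsup₂ θ (pathInt₂ g h t s) ≤ hsup₂ θ (pathInt₂ g h s t) +
      hsup θ (pathInt g s t) * hsup θ (pathInt h s t) := by
  have : pathInt₂ g h t s = fun x z => -1 * pathInt₂ g h s t x z +
      pathInt g s t x * pathInt h s t z := by
    funext x z
    have := pathInt₂_add hg hh s t s x z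
    rw [pathInt₂_self, pathInt_swap h s t z] at this
    linarith
  have h1 : NiceFam ⌊θ⌋₊ fun _ : Unit => pathInt g s t := .of_contDiff (hg.contDiff_pathInt _ _)
  have h2 : NiceFam ⌊θ⌋₊ fun _ : Unit => pathInt h s t := .of_contDiff (hh.contDiff_pathInt _ _)
  rw [this]
  refine (hsup₂_add_le ((hg.pathInt₂_unit hh s t).const_mul continuous_const) (.mul h1 h2)).trans ?_
  gcongr
  · rw [hsup₂_const_mul]; simp
  · exact hsup₂_mul_le _ _

end PathInt
end

noncomputable section

/-! ### A pseudo-metric controlling both levels of the rough path. -/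

section RoughSize

variable {d : ℕ}

lemma ENNReal.rpow_half_le_iff {x y : ℝ≥0∞} : x ^ (1 / 2 : ℝ) ≤ y ↔ x ≤ y * y := by
  rw [one_div, ENNReal.rpow_inv_le_iff (by norm_num), ← sq, ← ENNReal.rpow_natCast]
  norm_num

/-- The size of the first order increment of a path. -/
def pathSup (θ : ℝ) (g : Fin d → ℝ → EucSp d → ℝ) (s t : ℝ) : ℝ≥0∞ :=
  ⨆ i, hsup θ (pathInt (g i) s t)

/-- The size of the second order increment of a path. -/
def pathSup₂ (θ : ℝ) (g : Fin d → ℝ → EucSp d → ℝ) (s t : ℝ) : ℝ≥0∞ :=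
  ⨆ (i) (j), hsup₂ θ (pathInt₂ (g i) (g j) s t)

/-- A homogeneous subadditive size of the increments of a path. -/
def roughSize (θ : ℝ) (g : Fin d → ℝ → EucSp d → ℝ) (s t : ℝ) : ℝ≥0∞ :=
  max (pathSup θ g s t) ((2 * pathSup₂ θ g s t) ^ (1 / 2 : ℝ))

/-- A homogeneous distance between the points of a path. -/
def roughDist (θ : ℝ) (g : Fin d → ℝ → EucSp d → ℝ) (s t : ℝ) : ℝ≥0∞ :=
  max (roughSize θ g s t) (roughSize θ g t s)

variable {θ : ℝ} {g : Fin d → ℝ → EucSp d → ℝ}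

lemma hsup_le_pathSup (s t : ℝ) (i : Fin d) : hsup θ (pathInt (g i) s t) ≤ pathSup θ g s t :=
  le_iSup (fun i => hsup θ (pathInt (g i) s t)) i

lemma hsup₂_le_pathSup₂ (s t : ℝ) (i j : Fin d) :
    hsup₂ θ (pathInt₂ (g i) (g j) s t) ≤ pathSup₂ θ g s t :=
  le_iSup₂ (f := fun i j => hsup₂ θ (pathInt₂ (g i) (g j) s t)) i j

lemma pathSup_le_roughSize (s t : ℝ) : pathSup θ g s t ≤ roughSize θ g s t := le_max_left _ _

lemma two_mul_pathSup₂_le (s t : ℝ) :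
    2 * pathSup₂ θ g s t ≤ roughSize θ g s t * roughSize θ g s t :=
  ENNReal.rpow_half_le_iff.mp (le_max_right _ _)

lemma roughSize_le {s t : ℝ} {X : ℝ≥0∞} (h1 : pathSup θ g s t ≤ X)
    (h2 : 2 * pathSup₂ θ g s t ≤ X * X) : roughSize θ g s t ≤ X :=
  max_le h1 (ENNReal.rpow_half_le_iff.mpr h2)

lemma roughSize_self (s : ℝ) : roughSize θ g s s = 0 := by
  refine le_antisymm (roughSize_le ?_ ?_) zero_le
  · refine iSup_le fun i => ?_
    have : pathInt (g i) s s = fun _ => 0 := funext fun x => pathInt_self _ _ _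
    rw [this, hsup_zero]
  · have : pathSup₂ θ g s s = 0 := by
      refine le_antisymm (iSup₂_le fun i j => ?_) zero_le
      have : pathInt₂ (g i) (g j) s s = fun _ _ => 0 :=
        funext fun x => funext fun z => pathInt₂_self _ _ _ _ _
      rw [this, hsup₂_zero]
    simp [this]

lemma pathSup_swap (s t : ℝ) : pathSup θ g t s = pathSup θ g s t := by
  simp only [pathSup, fun i => hsup_pathInt_swap (θ := θ) (g i) s t]

lemma pathSup_add_le (hg : ∀ i, NiceFam ⌊θ⌋₊ (g i)) (s t u : ℝ) :
    pathSup θ g s u ≤ pathSup θ g s t + pathSup θ g t u :=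
  iSup_le fun i => (hsup_pathInt_add_le (hg i) s t u).trans
    (add_le_add (hsup_le_pathSup s t i) (hsup_le_pathSup t u i))

lemma pathSup₂_add_le (hg : ∀ i, NiceFam ⌊θ⌋₊ (g i)) (s t u : ℝ) :
    pathSup₂ θ g s u ≤ pathSup₂ θ g s t + pathSup₂ θ g t u + pathSup θ g s t * pathSup θ g t u :=
  iSup₂_le fun i j => (hsup₂_pathInt₂_add_le (hg i) (hg j) s t u).trans
    (add_le_add (add_le_add (hsup₂_le_pathSup₂ s t i j) (hsup₂_le_pathSup₂ t u i j))
      (mul_le_mul' (hsup_le_pathSup s t i) (hsup_le_pathSup t u j)))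

lemma pathSup₂_swap_le (hg : ∀ i, NiceFam ⌊θ⌋₊ (g i)) (s t : ℝ) :
    pathSup₂ θ g t s ≤ pathSup₂ θ g s t + pathSup θ g s t * pathSup θ g s t :=
  iSup₂_le fun i j => (hsup₂_pathInt₂_swap_le (hg i) (hg j) s t).trans
    (add_le_add (hsup₂_le_pathSup₂ s t i j)
      (mul_le_mul' (hsup_le_pathSup s t i) (hsup_le_pathSup s t j)))

/-- The factor `2` in `roughSize` is made for this proof: doubling Chen's cross term gives the mixed
term of `(a + b)²`, while the diagonal terms absorb the doubled second order increments. -/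
lemma roughSize_add_le (hg : ∀ i, NiceFam ⌊θ⌋₊ (g i)) (s t u : ℝ) :
    roughSize θ g s u ≤ roughSize θ g s t + roughSize θ g t u := by
  refine roughSize_le ((pathSup_add_le hg s t u).trans
    (add_le_add (pathSup_le_roughSize _ _) (pathSup_le_roughSize _ _))) ?_
  calc 2 * pathSup₂ θ g s u
      ≤ 2 * (pathSup₂ θ g s t + pathSup₂ θ g t u + pathSup θ g s t * pathSup θ g t u) := by
        gcongr; exact pathSup₂_add_le hg s t u
    _ = 2 * pathSup₂ θ g s t + 2 * pathSup₂ θ g t u + 2 * (pathSup θ g s t * pathSup θ g t u) := by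
        ring
    _ ≤ roughSize θ g s t * roughSize θ g s t + roughSize θ g t u * roughSize θ g t u +
        2 * (roughSize θ g s t * roughSize θ g t u) := by
        exact add_le_add (add_le_add (two_mul_pathSup₂_le s t) (two_mul_pathSup₂_le t u))
          (mul_le_mul_right (mul_le_mul' (pathSup_le_roughSize s t) (pathSup_le_roughSize t u)) 2)
    _ = _ := by ring

/-- Reversal at second order costs at most `1 + 2 = 3` squares of the size, fewer than the `4`
allowed by the factor `2`. -/
lemma roughSize_swap_le (hg : ∀ i, NiceFam ⌊θ⌋₊ (g i)) (s t : ℝ) :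
    roughSize θ g t s ≤ 2 * roughSize θ g s t := by
  refine roughSize_le ?_ ?_
  · rw [pathSup_swap, two_mul]
    exact (pathSup_le_roughSize s t).trans le_self_add
  · calc 2 * pathSup₂ θ g t s
        ≤ 2 * (pathSup₂ θ g s t + pathSup θ g s t * pathSup θ g s t) := by
          gcongr; exact pathSup₂_swap_le hg s t
      _ = 2 * pathSup₂ θ g s t + 2 * (pathSup θ g s t * pathSup θ g s t) := by ring
      _ ≤ roughSize θ g s t * roughSize θ g s t +
          2 * (roughSize θ g s t * roughSize θ g s t) := by
          exact add_le_add (two_mul_pathSup₂_le s t)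
            (mul_le_mul_right (mul_le_mul' (pathSup_le_roughSize s t) (pathSup_le_roughSize s t)) 2)
      _ ≤ roughSize θ g s t * roughSize θ g s t +
          2 * (roughSize θ g s t * roughSize θ g s t) +
          roughSize θ g s t * roughSize θ g s t := le_self_add
      _ = _ := by ring

lemma roughDist_self (s : ℝ) : roughDist θ g s s = 0 := by simp [roughDist, roughSize_self]

lemma roughDist_comm (s t : ℝ) : roughDist θ g s t = roughDist θ g t s := max_comm _ _

lemma roughDist_triangle (hg : ∀ i, NiceFam ⌊θ⌋₊ (g i)) (s t u : ℝ) :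
    roughDist θ g s u ≤ roughDist θ g s t + roughDist θ g t u := by
  refine max_le ((roughSize_add_le hg s t u).trans
    (add_le_add (le_max_left _ _) (le_max_left _ _))) ((roughSize_add_le hg u t s).trans ?_)
  rw [add_comm]
  exact add_le_add (le_max_right _ _) (le_max_right _ _)

lemma pathSup_le (hg : ∀ i, NiceFam ⌊θ⌋₊ (g i)) {A : ℝ}
    (hA : ∀ i (l : HFun d) (r : ℝ), l.Adm θ → |l.ev (g i r)| ≤ A) (s t : ℝ) :
    pathSup θ g s t ≤ ENNReal.ofReal (A * |t - s|) :=
  iSup_le fun i => hsup_pathInt_le (hg i) (hA i) s t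

lemma pathSup₂_le (hg : ∀ i, NiceFam ⌊θ⌋₊ (g i)) {A : ℝ} (hA₀ : 0 ≤ A)
    (hA : ∀ i (l : HFun d) (r : ℝ), l.Adm θ → |l.ev (g i r)| ≤ A) (s t : ℝ) :
    pathSup₂ θ g s t ≤ ENNReal.ofReal (A * |t - s|) * ENNReal.ofReal (A * |t - s|) := by
  refine iSup₂_le fun i j => (hsup₂_pathInt₂_le (hg i) (hg j) hA₀ (hA i) (hA j) s t).trans_eq ?_
  rw [← ENNReal.ofReal_mul (by positivity)]
  congr 1; ring

lemma roughDist_le (hg : ∀ i, NiceFam ⌊θ⌋₊ (g i)) {A : ℝ} (hA₀ : 0 ≤ A)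
    (hA : ∀ i (l : HFun d) (r : ℝ), l.Adm θ → |l.ev (g i r)| ≤ A) (s t : ℝ) :
    roughDist θ g s t ≤ ENNReal.ofReal (2 * A) * ENNReal.ofReal |t - s| := by
  have h : ∀ s t, roughSize θ g s t ≤ ENNReal.ofReal (2 * A) * ENNReal.ofReal |t - s| := by
    intro s t
    have e : ENNReal.ofReal (2 * A) * ENNReal.ofReal |t - s| =
        2 * ENNReal.ofReal (A * |t - s|) := by
      rw [← ENNReal.ofReal_mul (by positivity), mul_assoc, ENNReal.ofReal_mul (by norm_num)]
      simp
    rw [e]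
    refine roughSize_le ((pathSup_le hg hA s t).trans ?_) ?_
    · rw [two_mul]; exact le_self_add
    · refine (mul_le_mul_right (pathSup₂_le hg hA₀ hA s t) 2).trans ?_
      rw [mul_assoc 2]
      refine mul_le_mul_right (mul_le_mul_right ?_ _) _
      rw [two_mul]; exact le_self_add
  refine max_le (h s t) ?_
  rw [abs_sub_comm]; exact h t s

/-- Backward increments are bounded by forward ones and maxima by sums, leaving single entries whose
moments can be estimated separately. -/
lemma roughDist_rpow_le (hg : ∀ i, NiceFam ⌊θ⌋₊ (g i)) {p : ℝ} (hp : 0 < p) (s t : ℝ) :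
    roughDist θ g s t ^ (2 * p) ≤ 2 ^ (2 * p) *
      (∑ i, hsup θ (pathInt (g i) s t) ^ (2 * p) +
        2 ^ p * ∑ i, ∑ j, hsup₂ θ (pathInt₂ (g i) (g j) s t) ^ p) := by
  have h1 : roughDist θ g s t ≤ 2 * roughSize θ g s t :=
    max_le (by rw [two_mul]; exact le_self_add) (roughSize_swap_le hg s t)
  refine (ENNReal.rpow_le_rpow h1 (by positivity)).trans ?_
  rw [ENNReal.mul_rpow_of_nonneg _ _ (by positivity)]
  gcongr
  have h2 : roughSize θ g s t ^ (2 * p) ≤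
      pathSup θ g s t ^ (2 * p) + (2 * pathSup₂ θ g s t) ^ p := by
    rcases le_total (pathSup θ g s t) ((2 * pathSup₂ θ g s t) ^ (1 / 2 : ℝ)) with h | h
    · rw [roughSize, max_eq_right h, ← ENNReal.rpow_mul]
      refine le_trans (le_of_eq ?_) le_add_self
      congr 1; ring
    · rw [roughSize, max_eq_left h]
      exact le_self_add
  refine h2.trans ?_
  rw [ENNReal.mul_rpow_of_nonneg _ _ hp.le]
  gcongr
  · have := ENNReal.iSup₂_rpow_le (q := 2 * p) (by positivity) (p := fun _ : Fin d => True)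
      (f := fun i => hsup θ (pathInt (g i) s t))
      (B := ∑ i, hsup θ (pathInt (g i) s t) ^ (2 * p)) fun i _ =>
      Finset.single_le_sum (f := fun i => hsup θ (pathInt (g i) s t) ^ (2 * p))
        (fun _ _ => zero_le) (Finset.mem_univ i)
    simpa [pathSup] using this
  · have h3 := ENNReal.iSup₂_rpow_le (q := p) hp (p := fun _ : Fin d × Fin d => True)
      (f := fun i => hsup₂ θ (pathInt₂ (g i.1) (g i.2) s t))
      (B := ∑ i : Fin d × Fin d, hsup₂ θ (pathInt₂ (g i.1) (g i.2) s t) ^ p) fun i _ =>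
      Finset.single_le_sum (f := fun i : Fin d × Fin d =>
        hsup₂ θ (pathInt₂ (g i.1) (g i.2) s t) ^ p) (fun _ _ => zero_le) (Finset.mem_univ i)
    rw [Fintype.sum_prod_type] at h3
    simpa [pathSup₂, iSup_prod] using h3

end RoughSize

section RoughPath

variable {d : ℕ} {θ : ℝ} {g : Fin d → ℝ → EucSp d → ℝ} {W : ℝ → EucSp d → EucSp d}
  {WW : ℝ → Fin d → Fin d → EucSp d → EucSp d → ℝ}

/-- `(W, 𝕎)` is the canonical lift of the path with velocity `g`. -/
structure IsLift (g : Fin d → ℝ → EucSp d → ℝ) (W : ℝ → EucSp d → EucSp d)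
    (WW : ℝ → Fin d → Fin d → EucSp d → EucSp d → ℝ) : Prop where
  fst : ∀ t x i, W t x i = pathInt (g i) 0 t x
  snd : ∀ t i j, WW t i j = pathInt₂ (g i) (g j) 0 t

namespace IsLift

lemma incr_eq (h : IsLift g W WW) {m : ℕ} (hg : ∀ i, NiceFam m (g i)) (s t : ℝ) (i : Fin d) :
    (fun x => incr W s t x i) = pathInt (g i) s t := by
  funext x
  have := pathInt_add (hg i) 0 s t x
  simp only [incr, PiLp.sub_apply, h.fst]
  linarith

/-- Chen's relation from base point `0`: the product subtracted in `incr₂` is exactly the cross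
term. -/
lemma incr₂_eq (h : IsLift g W WW) {m : ℕ} (hg : ∀ i, NiceFam m (g i)) (s t : ℝ) (i j : Fin d) :
    incr₂ W WW s t i j = pathInt₂ (g i) (g j) s t := by
  funext x z
  have := pathInt₂_add (hg i) (hg j) 0 s t x z
  have h2 := congrFun (h.incr_eq hg s t j) z
  simp only at h2
  simp only [incr₂, h.fst, h.snd, h2]
  linarith

lemma holderNormVec_incr_le (h : IsLift g W WW) (hg : ∀ i, NiceFam ⌊θ⌋₊ (g i)) (s t : ℝ) :
    holderNormVec θ (incr W s t) ≤ d * holderCount d θ * pathSup θ g s t := by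
  unfold holderNormVec
  simp only [h.incr_eq hg]
  refine (Finset.sum_le_card_nsmul _ _ (holderCount d θ * pathSup θ g s t) fun i _ => ?_).trans_eq ?_
  · exact (holderNorm_le_hsup θ _).trans (mul_le_mul_right (hsup_le_pathSup s t i) _)
  · simp [mul_assoc]

lemma tensorNorm_incr₂_le (h : IsLift g W WW) (hg : ∀ i, NiceFam ⌊θ⌋₊ (g i)) (s t : ℝ) :
    tensorNorm θ (incr₂ W WW s t) ≤
      (d * holderCount d θ) * (d * holderCount d θ) * pathSup₂ θ g s t := by
  unfold tensorNorm
  simp only [h.incr₂_eq hg]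
  refine (Finset.sum_le_card_nsmul _ _
    (d * (holderCount d θ * (holderCount d θ * pathSup₂ θ g s t))) fun i _ =>
    (Finset.sum_le_card_nsmul _ _ (holderCount d θ * (holderCount d θ * pathSup₂ θ g s t))
      fun j _ => ?_).trans_eq ?_).trans_eq ?_
  · refine (holderNorm₂_le_hsup₂ θ _).trans ?_
    gcongr
    exact hsup₂_le_pathSup₂ s t i j
  · simp
  · simp only [Finset.card_univ, Fintype.card_fin, nsmul_eq_mul]; ring

/-- The comparison constant for the second level is the square of that for the first, so after the
square root both halves contribute equally; hence the factor `2`. -/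
lemma roughNorm_le (h : IsLift g W WW) (hg : ∀ i, NiceFam ⌊θ⌋₊ (g i)) {γ T : ℝ} {S : ℝ≥0∞}
    (hS : ∀ s ∈ Icc 0 T, ∀ t ∈ Icc 0 T, s ≠ t →
      roughDist θ g s t / ENNReal.ofReal (|t - s| ^ γ) ≤ S) :
    roughNorm θ γ T W WW ≤ 2 * (d * holderCount d θ) * S := by
  have key : ∀ (N : ℝ≥0∞) (s t : ℝ), s ∈ Icc 0 T → t ∈ Icc 0 T → s ≠ t →
      N ≤ d * holderCount d θ * roughDist θ g s t →
      N / ENNReal.ofReal (|t - s| ^ γ) ≤ d * holderCount d θ * S := by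
    intro N s t hs ht hst hN
    refine (ENNReal.div_le_div_right hN _).trans ?_
    rw [mul_div_assoc]
    gcongr
    exact hS s hs t ht hst
  have e : 2 * (d * holderCount d θ) * S = d * holderCount d θ * S + d * holderCount d θ * S := by
    ring
  rw [e]
  refine add_le_add (iSup₂_le fun s hs => iSup₂_le fun t ht => iSup_le fun hst => ?_)
    (iSup₂_le fun s hs => iSup₂_le fun t ht => iSup_le fun hst => ?_)
  · refine key _ s t hs ht hst ((h.holderNormVec_incr_le hg s t).trans ?_)
    gcongr
    exact (pathSup_le_roughSize s t).trans (le_max_left _ _)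
  · refine key _ s t hs ht hst (ENNReal.rpow_half_le_iff.mpr ?_)
    refine (h.tensorNorm_incr₂_le hg s t).trans ?_
    rw [mul_mul_mul_comm _ (roughDist θ g s t)]
    refine mul_le_mul' le_rfl ?_
    calc pathSup₂ θ g s t ≤ 2 * pathSup₂ θ g s t := by rw [two_mul]; exact le_self_add
      _ ≤ roughSize θ g s t * roughSize θ g s t := two_mul_pathSup₂_le s t
      _ ≤ _ := by gcongr <;> exact le_max_left _ _

end IsLift

/-- A chaining bound for the rough path norm of the canonical lift of a path. -/
lemma exists_roughNorm_rpow_le (d : ℕ) (θ : ℝ) {γ T p : ℝ} (hT : 0 < T) (hγ : 0 < γ) (hp : 0 < p) :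
    ∃ K : ℝ≥0∞, K ≠ ∞ ∧ ∀ (g : Fin d → ℝ → EucSp d → ℝ) (W : ℝ → EucSp d → EucSp d)
      (WW : ℝ → Fin d → Fin d → EucSp d → EucSp d → ℝ), IsLift g W WW →
      (∀ i, NiceFam ⌊θ⌋₊ (g i)) →
      (∃ A : ℝ, 0 ≤ A ∧ ∀ i (l : HFun d) (r : ℝ), l.Adm θ → |l.ev (g i r)| ≤ A) →
      roughNorm θ γ T W WW ^ (2 * p) ≤
        K * ∑' k : ℕ, ∑ n ∈ Finset.range (2 ^ k), ENNReal.ofReal (2 ^ (γ * (2 * p) * k)) *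
          (∑ i, hsup θ (pathInt (g i) (dyadicPt T k n) (dyadicPt T k (n + 1))) ^ (2 * p) +
          2 ^ p * ∑ i, ∑ j, hsup₂ θ
            (pathInt₂ (g i) (g j) (dyadicPt T k n) (dyadicPt T k (n + 1))) ^ p) := by
  obtain ⟨K, hK, h⟩ := exists_chaining_bound hT hγ (q := 2 * p) (by positivity)
  have hp2 : 0 < 2 * p := by positivity
  refine ⟨(2 * (d * holderCount d θ)) ^ (2 * p) * (K * 2 ^ (2 * p)),
    ENNReal.mul_ne_top (ENNReal.rpow_ne_top_of_nonneg hp2.le ?_)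
      (ENNReal.mul_ne_top hK (ENNReal.rpow_ne_top_of_nonneg hp2.le (by simp))),
    fun g W WW hW hg ⟨A, hA₀, hA⟩ => ?_⟩
  · exact ENNReal.mul_ne_top (by simp) (ENNReal.mul_ne_top (by simp) (by simp))
  set X := ∑' k : ℕ, ∑ i ∈ Finset.range (2 ^ k), ENNReal.ofReal (2 ^ (γ * (2 * p) * k)) *
    roughDist θ g (dyadicPt T k i) (dyadicPt T k (i + 1)) ^ (2 * p)
  have h1 := h (roughDist θ g) roughDist_self roughDist_comm (roughDist_triangle hg)
    ⟨ENNReal.ofReal (2 * A), ENNReal.ofReal_ne_top, fun s _ t _ => roughDist_le hg hA₀ hA s t⟩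
  have h2 := hW.roughNorm_le hg (γ := γ) (T := T) (S := (K * X) ^ (2 * p)⁻¹)
    fun s hs t ht hst => (ENNReal.le_rpow_inv_iff hp2).mpr (h1 s hs t ht hst)
  refine (ENNReal.rpow_le_rpow h2 hp2.le).trans ?_
  rw [ENNReal.mul_rpow_of_nonneg _ _ hp2.le, ENNReal.rpow_inv_rpow hp2.ne', mul_assoc, mul_assoc K]
  gcongr
  rw [← ENNReal.tsum_mul_left]
  refine ENNReal.tsum_le_tsum fun k => ?_
  rw [Finset.mul_sum]
  refine Finset.sum_le_sum fun n _ => ?_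
  rw [mul_left_comm (2 ^ (2 * p) : ℝ≥0∞)]
  exact mul_le_mul_right (roughDist_rpow_le hg hp _ _) _

end RoughPath
end

noncomputable section

/-! ### The rough path property for a bounded velocity. -/

section Regularity

variable {d : ℕ} {θ : ℝ}

lemma memHolderSp_of_hsup {u : EucSp d → ℝ} (hu : ContDiff ℝ ⌊θ⌋₊ u) {C : ℝ≥0∞} (hC : C ≠ ∞)
    (h : hsup θ u ≤ C) : MemHolderSp θ u :=
  ⟨hu, (holderNorm_le_hsup θ u).trans_lt ((mul_le_mul' le_rfl h).trans_lt
    (ENNReal.mul_lt_top (by simp) hC.lt_top))⟩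

lemma NiceFam₂.memHolderSp₂ {U : EucSp d → EucSp d → ℝ} (hU : NiceFam₂ ⌊θ⌋₊ fun _ : Unit => U)
    {C : ℝ≥0∞} (hC : C ≠ ∞) (h : hsup₂ θ U ≤ C) : MemHolderSp₂ θ U := by
  refine ⟨?_, hU.contDiff_fst (), fun n hn k hk x => ?_, ?_⟩
  · exact hU.fst.continuous_uncurry.comp
      (by fun_prop : Continuous fun q : EucSp d × EucSp d => (((), q.2), q.1))
  · simp only [multiD_eq_listD]
    exact (hU.snd _ (by rw [length_idxList_of_mem hk]; exact hn)).contDiff ((), x)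
  · exact (holderNorm₂_le_hsup₂ θ U).trans_lt ((mul_le_mul' le_rfl (mul_le_mul' le_rfl h)).trans_lt
      (ENNReal.mul_lt_top (by simp) (ENNReal.mul_lt_top (by simp) hC.lt_top)))

lemma hsup₂_sum_le {ι : Type*} (s : Finset ι) {U : ι → EucSp d → EucSp d → ℝ}
    (hU : ∀ i ∈ s, NiceFam₂ ⌊θ⌋₊ fun _ : Unit => U i) :
    hsup₂ θ (fun x z => ∑ i ∈ s, U i x z) ≤ ∑ i ∈ s, hsup₂ θ (U i) := by
  classical
  induction s using Finset.induction_on with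
  | empty => simp [hsup₂_zero]
  | insert i s hi ih =>
    have hs : ∀ j ∈ s, NiceFam₂ ⌊θ⌋₊ fun _ : Unit => U j := fun j hj => hU j (by simp [hj])
    simp only [Finset.sum_insert hi]
    exact (hsup₂_add_le (hU i (by simp)) (NiceFam₂.sum (P := Unit) s (U := fun j _ => U j) hs)).trans
      (add_le_add le_rfl (ih hs))

/-- Chen's relation iterated along a partition: short iterated integrals plus a left endpoint
Riemann sum, which is a finite sum of products. -/
lemma pathInt₂_eq_sum {m : ℕ} {g h : ℝ → EucSp d → ℝ} (hg : NiceFam m g) (hh : NiceFam m h)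
    (τ : ℕ → ℝ) (n : ℕ) (x z : EucSp d) :
    pathInt₂ g h (τ 0) (τ n) x z = ∑ j ∈ Finset.range n, pathInt₂ g h (τ j) (τ (j + 1)) x z +
      ∑ j ∈ Finset.range n, pathInt g (τ 0) (τ j) x * pathInt h (τ j) (τ (j + 1)) z := by
  induction n with
  | zero => simp [pathInt₂_self]
  | succ n ih =>
    rw [Finset.sum_range_succ, Finset.sum_range_succ, pathInt₂_add hg hh (τ 0) (τ n), ih]
    ring

/-- The Riemann sums on uniform partitions lie in the algebraic tensor product. The error consists
of `N` iterated integrals of size `O(N⁻²)`, so it tends to zero in `C^{θ,θ}`. -/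
lemma memTensor_pathInt₂ {g h : ℝ → EucSp d → ℝ} (hg : NiceFam ⌊θ⌋₊ g) (hh : NiceFam ⌊θ⌋₊ h)
    {A : ℝ} (hA₀ : 0 ≤ A) (hA : ∀ (l : HFun d) (r : ℝ), l.Adm θ → |l.ev (g r)| ≤ A)
    (hA' : ∀ (l : HFun d) (r : ℝ), l.Adm θ → |l.ev (h r)| ≤ A) (t : ℝ) :
    MemTensor θ (pathInt₂ g h 0 t) := by
  refine ⟨(hg.pathInt₂_unit hh 0 t).memHolderSp₂ ENNReal.ofReal_ne_top
    (hsup₂_pathInt₂_le hg hh hA₀ hA hA' 0 t), fun δ hδ => ?_⟩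
  set c : ℝ := (holderCount d θ : ℝ)
  have hlim : Tendsto (fun N : ℕ => ENNReal.ofReal (c * (c * (A * A * t ^ 2)) / N)) atTop (𝓝 0) := by
    simpa using ENNReal.tendsto_ofReal (tendsto_const_div_atTop_nhds_zero_nat (c * (c * (A * A * t ^ 2))))
  obtain ⟨N, hN, hN0⟩ := ((hlim.eventually_lt_const hδ).and (eventually_gt_atTop 0)).exists
  have hN1 : (0 : ℝ) < N := by exact_mod_cast hN0
  set τ : ℕ → ℝ := fun j => t * (j / N)
  have hτ0 : τ 0 = 0 := by simp [τ]
  have hτN : τ N = t := by simp only [τ]; field_simp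
  have hτ : ∀ j, |τ (j + 1) - τ j| = |t| / N := by
    intro j
    have : τ (j + 1) - τ j = t / N := by simp only [τ]; push_cast; ring
    rw [this, abs_div, Nat.abs_cast]
  refine ⟨fun x z => ∑ j ∈ Finset.range N, pathInt g (τ 0) (τ j) x * pathInt h (τ j) (τ (j + 1)) z,
    ⟨N, fun j => pathInt g (τ 0) (τ j), fun j => pathInt h (τ j) (τ (j + 1)), fun j => ?_,
      fun j => ?_, fun x z => (Fin.sum_univ_eq_sum_range
        (fun j => pathInt g (τ 0) (τ j) x * pathInt h (τ j) (τ (j + 1)) z) N).symm⟩, ?_⟩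
  · exact memHolderSp_of_hsup (hg.contDiff_pathInt _ _) ENNReal.ofReal_ne_top
      (hsup_pathInt_le hg hA _ _)
  · exact memHolderSp_of_hsup (hh.contDiff_pathInt _ _) ENNReal.ofReal_ne_top
      (hsup_pathInt_le hh hA' _ _)
  · have e : (fun x z => pathInt₂ g h 0 t x z -
        ∑ j ∈ Finset.range N, pathInt g (τ 0) (τ j) x * pathInt h (τ j) (τ (j + 1)) z) =
        fun x z => ∑ j ∈ Finset.range N, pathInt₂ g h (τ j) (τ (j + 1)) x z := by
      funext x z
      have := pathInt₂_eq_sum hg hh τ N x z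
      rw [hτN] at this
      nth_rw 1 [hτ0] at this
      linarith
    rw [e]
    refine lt_of_le_of_lt ?_ hN
    refine (holderNorm₂_le_hsup₂ θ _).trans ?_
    have h1 : hsup₂ θ (fun x z => ∑ j ∈ Finset.range N, pathInt₂ g h (τ j) (τ (j + 1)) x z) ≤
        ENNReal.ofReal (A * A * t ^ 2 / N) := by
      refine (hsup₂_sum_le _ fun j _ => hg.pathInt₂_unit hh _ _).trans ?_
      refine (Finset.sum_le_card_nsmul _ _ (ENNReal.ofReal (A * A * (|t| / N) ^ 2))
        fun j _ => ?_).trans_eq ?_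
      · rw [← hτ j]
        exact hsup₂_pathInt₂_le hg hh hA₀ hA hA' _ _
      · rw [Finset.card_range, ← ENNReal.ofReal_nsmul]
        congr 1
        rw [div_pow, sq_abs, nsmul_eq_mul]
        field_simp
    refine (mul_le_mul' le_rfl (mul_le_mul' le_rfl h1)).trans_eq ?_
    have hc : (holderCount d θ : ℝ≥0∞) = ENNReal.ofReal c := (ENNReal.ofReal_natCast _).symm
    have hc0 : 0 ≤ c := Nat.cast_nonneg _
    rw [hc, ← ENNReal.ofReal_mul hc0, ← ENNReal.ofReal_mul hc0]
    congr 1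
    ring

lemma ofReal_div_rpow_le {T r β : ℝ} (hr : 0 < r) (hrT : r ≤ T) (hβ : β ≤ 1) :
    ENNReal.ofReal r / ENNReal.ofReal (r ^ β) ≤ ENNReal.ofReal (T ^ (1 - β)) := by
  rw [← ENNReal.ofReal_div_of_pos (Real.rpow_pos_of_pos hr _)]
  refine ENNReal.ofReal_le_ofReal ?_
  nth_rw 1 [← Real.rpow_one r]
  rw [← Real.rpow_sub hr]
  exact Real.rpow_le_rpow hr.le hrT (by linarith)

/-- The canonical lift of a path with bounded velocity is a rough path. -/
lemma IsLift.isRoughPath {g : Fin d → ℝ → EucSp d → ℝ} {W : ℝ → EucSp d → EucSp d}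
    {WW : ℝ → Fin d → Fin d → EucSp d → EucSp d → ℝ} (h : IsLift g W WW)
    (hg : ∀ i, NiceFam ⌊θ⌋₊ (g i)) {A : ℝ} (hA₀ : 0 ≤ A)
    (hA : ∀ i (l : HFun d) (r : ℝ), l.Adm θ → |l.ev (g i r)| ≤ A) {γ T : ℝ} (hγ : 2 * γ ≤ 1)
    (hγ' : γ ≤ 1) : IsRoughPath θ γ T W WW := by
  have hX : ∀ t, Tendsto (fun s => ENNReal.ofReal (A * |s - t|)) (𝓝 t) (𝓝 0) := by
    intro t
    have : Continuous fun s => ENNReal.ofReal (A * |s - t|) :=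
      ENNReal.continuous_ofReal.comp (by fun_prop)
    simpa using this.tendsto t
  have hdc : ((d : ℝ≥0∞) * holderCount d θ) ≠ ∞ := ENNReal.mul_ne_top (by simp) (by simp)
  have hdist : ∀ s ∈ Icc 0 T, ∀ t ∈ Icc 0 T, |t - s| ≤ T := fun s hs t ht =>
    abs_le.mpr ⟨by linarith [hs.2, ht.1], by linarith [hs.1, ht.2]⟩
  refine ⟨fun t ht => ⟨fun i => ?_, fun i j => ?_⟩, fun t ht => ?_, fun t ht => ?_, ?_, ?_, ?_, ?_⟩
  · simp only [h.fst]
    exact memHolderSp_of_hsup ((hg i).contDiff_pathInt _ _) ENNReal.ofReal_ne_top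
      (hsup_pathInt_le (hg i) (hA i) _ _)
  · rw [h.snd]
    exact memTensor_pathInt₂ (hg i) (hg j) hA₀ (hA i) (hA j) t
  · refine tendsto_of_tendsto_of_tendsto_of_le_of_le tendsto_const_nhds
      (h := fun s => (d * holderCount d θ) * ENNReal.ofReal (A * |s - t|)) ?_ (fun _ => zero_le)
      fun s => ?_
    · simpa using ENNReal.Tendsto.const_mul ((hX t).mono_left nhdsWithin_le_nhds) (Or.inr hdc)
    · exact (h.holderNormVec_incr_le hg t s).trans (mul_le_mul' le_rfl (pathSup_le hg hA t s))
  · refine tendsto_of_tendsto_of_tendsto_of_le_of_le tendsto_const_nhds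
      (h := fun s => d * (d * (holderCount d θ * (holderCount d θ *
        (ENNReal.ofReal (A * |s - t|) * ENNReal.ofReal (A * |s - t|) +
          ENNReal.ofReal (A * |t - 0|) * ENNReal.ofReal (A * |s - t|)))))) ?_ (fun _ => zero_le)
      fun s => ?_
    · have h0 := (hX t).mono_left (nhdsWithin_le_nhds (s := Icc 0 T))
      have h1 := (ENNReal.Tendsto.mul h0 (Or.inr ENNReal.zero_ne_top) h0
        (Or.inr ENNReal.zero_ne_top)).add
        (ENNReal.Tendsto.const_mul h0 (Or.inr (ENNReal.ofReal_ne_top (r := A * |t - 0|))))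
      have h2 := ENNReal.Tendsto.const_mul (ENNReal.Tendsto.const_mul (ENNReal.Tendsto.const_mul
        (ENNReal.Tendsto.const_mul h1 (Or.inr (ENNReal.natCast_ne_top (holderCount d θ))))
        (Or.inr (ENNReal.natCast_ne_top (holderCount d θ)))) (Or.inr (ENNReal.natCast_ne_top d)))
        (Or.inr (ENNReal.natCast_ne_top d))
      simpa using h2
    · unfold tensorNorm
      refine (Finset.sum_le_card_nsmul _ _ _ fun i _ => Finset.sum_le_card_nsmul _ _
        (holderCount d θ * (holderCount d θ *
        (ENNReal.ofReal (A * |s - t|) * ENNReal.ofReal (A * |s - t|) +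
          ENNReal.ofReal (A * |t - 0|) * ENNReal.ofReal (A * |s - t|)))) fun j _ => ?_).trans_eq ?_
      · refine (holderNorm₂_le_hsup₂ θ _).trans (mul_le_mul' le_rfl (mul_le_mul' le_rfl ?_))
        -- The plain difference differs from the second order increment by a product, which also
        -- vanishes as `s → t`.
        have e : (fun x z => WW s i j x z - WW t i j x z) = fun x z =>
            pathInt₂ (g i) (g j) t s x z + pathInt (g i) 0 t x * pathInt (g j) t s z := by
          funext x z
          rw [h.snd, h.snd, pathInt₂_add (hg i) (hg j) 0 t s]
          ring
        have h1 : NiceFam ⌊θ⌋₊ fun _ : Unit => pathInt (g i) 0 t :=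
          .of_contDiff ((hg i).contDiff_pathInt _ _)
        have h2 : NiceFam ⌊θ⌋₊ fun _ : Unit => pathInt (g j) t s :=
          .of_contDiff ((hg j).contDiff_pathInt _ _)
        refine (congrArg (hsup₂ θ) e).trans_le ?_
        refine (hsup₂_add_le ((hg i).pathInt₂_unit (hg j) t s) (.mul h1 h2)).trans
          (add_le_add ?_ ((hsup₂_mul_le _ _).trans (mul_le_mul' ?_ ?_)))
        · exact (hsup₂_le_pathSup₂ t s i j).trans (pathSup₂_le hg hA₀ hA t s)
        · exact hsup_pathInt_le (hg i) (hA i) _ _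
        · exact hsup_pathInt_le (hg j) (hA j) _ _
      · simp
  · funext x
    ext i
    rw [h.fst]
    exact pathInt_self _ _ _
  · funext i j x z
    rw [h.snd]
    exact pathInt₂_self _ _ _ _ _
  · refine lt_of_le_of_lt (b := d * holderCount d θ *
      (ENNReal.ofReal A * ENNReal.ofReal (T ^ (1 - γ)))) ?_
      (ENNReal.mul_lt_top hdc.lt_top (by finiteness))
    refine iSup₂_le fun s hs => iSup₂_le fun t ht => iSup_le fun hst => ?_
    have hpos : 0 < |t - s| := abs_pos.mpr (sub_ne_zero.mpr (Ne.symm hst))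
    refine (ENNReal.div_le_div_right ((h.holderNormVec_incr_le hg s t).trans
      (mul_le_mul' le_rfl (pathSup_le hg hA s t))) _).trans ?_
    rw [ENNReal.ofReal_mul hA₀, mul_div_assoc, mul_div_assoc]
    exact mul_le_mul' le_rfl (mul_le_mul' le_rfl (ofReal_div_rpow_le hpos (hdist s hs t ht) hγ'))
  · refine lt_of_le_of_lt (b := (d * holderCount d θ) * (d * holderCount d θ) *
      (ENNReal.ofReal A * ENNReal.ofReal T * (ENNReal.ofReal A * ENNReal.ofReal (T ^ (1 - 2 * γ))))) ?_
      (ENNReal.mul_lt_top (ENNReal.mul_lt_top hdc.lt_top hdc.lt_top) (by finiteness))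
    refine iSup₂_le fun s hs => iSup₂_le fun t ht => iSup_le fun hst => ?_
    have hpos : 0 < |t - s| := abs_pos.mpr (sub_ne_zero.mpr (Ne.symm hst))
    refine (ENNReal.div_le_div_right ((h.tensorNorm_incr₂_le hg s t).trans
      (mul_le_mul' le_rfl (pathSup₂_le hg hA₀ hA s t))) _).trans ?_
    rw [ENNReal.ofReal_mul hA₀, mul_div_assoc, mul_div_assoc, mul_div_assoc]
    exact mul_le_mul' le_rfl (mul_le_mul' (mul_le_mul' le_rfl
      (ENNReal.ofReal_le_ofReal (hdist s hs t ht)))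
      (mul_le_mul' le_rfl (ofReal_div_rpow_le hpos (hdist s hs t ht) hγ)))

end Regularity
end

noncomputable section

/-! ### Moment criteria for random fields in Hölder spaces. -/

section RandomField

variable {d : ℕ}

lemma tsum_two_rpow_neg_ne_top {δ : ℝ} (hδ : 0 < δ) :
    ∑' n : ℕ, ENNReal.ofReal (2 ^ (-(δ * n))) ≠ ∞ := by
  have h1 : (2 : ℝ) ^ (-δ) < 1 := Real.rpow_lt_one_of_one_lt_of_neg one_lt_two (by linarith)
  have h2 : ∀ n : ℕ, (2 : ℝ) ^ (-(δ * n)) = (2 ^ (-δ)) ^ n := fun n => by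
    rw [← Real.rpow_natCast, ← Real.rpow_mul (by norm_num)]; ring_nf
  simp only [h2]
  rw [← ENNReal.ofReal_tsum_of_nonneg (fun n => by positivity)
    (summable_geometric_of_lt_one (by positivity) h1)]
  exact ENNReal.ofReal_ne_top

lemma ofReal_two_rpow_mul (a b c : ℝ) (h : a + b = c) :
    ENNReal.ofReal (2 ^ a) * ENNReal.ofReal (2 ^ b) = ENNReal.ofReal (2 ^ c) := by
  rw [← ENNReal.ofReal_mul (by positivity), ← Real.rpow_add (by norm_num), h]

lemma lintegral_le_mul_volume_closedBall {F : EucSp d → ℝ≥0∞} {R : ℝ} {c : ℝ≥0∞}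
    (h0 : ∀ x, R < ‖x‖ → F x = 0) (hc : ∀ x, F x ≤ c) :
    ∫⁻ x, F x ≤ c * volume (Metric.closedBall (0 : EucSp d) R) := by
  rw [← lintegral_indicator_const Metric.isClosed_closedBall.measurableSet]
  refine lintegral_mono fun x => ?_
  by_cases hx : x ∈ Metric.closedBall (0 : EucSp d) R
  · rw [indicator_of_mem hx]; exact hc x
  · rw [h0 x (by simpa using hx)]; exact zero_le

variable {Ω : Type*} [TopologicalSpace Ω] [FirstCountableTopology Ω]
  [MeasurableSpace Ω] [BorelSpace Ω] {μ : Measure Ω} [SFinite μ] {M : ℕ} {θ α q : ℝ}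

/-- A Kolmogorov criterion for compactly supported random fields. -/
lemma exists_lintegral_hsup_rpow_le (hθ : 0 ≤ θ) (hq : 1 < q) (hα : θ + d / q < α) (hM : M ≠ 0)
    (R : ℝ) : ∃ C : ℝ≥0∞, C ≠ ∞ ∧ ∀ (X : Ω → EucSp d → ℝ) (K : ℝ≥0∞), NiceFam ⌊θ⌋₊ X →
      (∀ y x, R < ‖x‖ → X y x = 0) →
      (∀ n x, ∫⁻ y, ‖qblock M n (X y) x‖ₑ ^ q ∂μ ≤ K * ENNReal.ofReal (2 ^ (-(α * q * n)))) →
      ∫⁻ y, hsup θ (X y) ^ q ∂μ ≤ C * K := by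
  -- The intermediate `θ'` splits the gap: `θ + d/q < θ'` pays for the Besov bound, and `θ' < α`
  -- leaves geometric decay in the block index.
  obtain ⟨θ', h1, h2⟩ := exists_between hα
  have hq0 : 0 < q := by linarith
  obtain ⟨C, hC, h⟩ := exists_hsup_rpow_le hθ hq h1 hM
  have hS := tsum_two_rpow_neg_ne_top (δ := (α - θ') * q) (mul_pos (by linarith) hq0)
  set S := ∑' n : ℕ, ENNReal.ofReal (2 ^ (-((α - θ') * q * n)))
  set V := volume (Metric.closedBall (0 : EucSp d) (R + M))
  have hV : V ≠ ∞ := measure_closedBall_lt_top.ne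
  refine ⟨C * (S * V), ENNReal.mul_ne_top hC (ENNReal.mul_ne_top hS hV), fun X K hX hsupp hmom => ?_⟩
  have hw : ∀ n : ℕ, ENNReal.ofReal (2 ^ (θ' * q * n)) * ENNReal.ofReal (2 ^ (-(α * q * n))) =
      ENNReal.ofReal (2 ^ (-((α - θ') * q * n))) := fun n => ofReal_two_rpow_mul _ _ _ (by ring)
  have hcont : ∀ n, Continuous fun w : Ω × EucSp d => ‖qblock M n (X w.1) w.2‖ₑ ^ q := fun n =>
    (ENNReal.continuous_rpow_const).comp (continuous_qblock_family hX.continuous_uncurry n).enorm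
  have hmeas : ∀ n, Measurable fun y => ∫⁻ x, ‖qblock M n (X y) x‖ₑ ^ q := fun n =>
    (hcont n).measurable.lintegral_prod_right'
  calc ∫⁻ y, hsup θ (X y) ^ q ∂μ
      ≤ ∫⁻ y, C * ∑' n : ℕ, ENNReal.ofReal (2 ^ (θ' * q * n)) *
          (∫⁻ x, ‖qblock M n (X y) x‖ₑ ^ q) ∂μ :=
        lintegral_mono fun y => h (X y) (hX.contDiff y) ⟨R, hsupp y⟩
    _ = C * ∑' n : ℕ, ENNReal.ofReal (2 ^ (θ' * q * n)) *
          ∫⁻ x, ∫⁻ y, ‖qblock M n (X y) x‖ₑ ^ q ∂μ := by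
        rw [lintegral_const_mul' _ _ hC, lintegral_tsum fun n => ((hmeas n).const_mul _).aemeasurable]
        congr 1
        refine tsum_congr fun n => ?_
        rw [lintegral_const_mul _ (hmeas n), lintegral_lintegral_swap (hcont n).aemeasurable]
    -- After Tonelli only moments at fixed points are needed. The blocks vanish outside a ball whose
    -- radius is independent of `n`, so the space integral contributes just the volume `V`.
    _ ≤ C * ∑' n : ℕ, ENNReal.ofReal (2 ^ (θ' * q * n)) *
          (K * ENNReal.ofReal (2 ^ (-(α * q * n))) * V) := by
        refine mul_le_mul' le_rfl (ENNReal.tsum_le_tsum fun n => mul_le_mul' le_rfl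
          (lintegral_le_mul_volume_closedBall (fun x hx => ?_) (hmom n)))
        simp [fun y => qblock_eq_zero (hsupp y) n hx, hq0]
    _ = C * ∑' n : ℕ, ENNReal.ofReal (2 ^ (-((α - θ') * q * n))) * (V * K) := by
        congr 1
        refine tsum_congr fun n => ?_
        rw [← hw n]
        ring
    _ = C * (S * V) * K := by rw [ENNReal.tsum_mul_right]; ring

/-- A Kolmogorov criterion for compactly supported random fields of two variables. -/
lemma exists_lintegral_hsup₂_rpow_le (hθ : 0 ≤ θ) (hq : 1 < q) (hα : θ + d / q < α) (hM : M ≠ 0)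
    (R : ℝ) : ∃ C : ℝ≥0∞, C ≠ ∞ ∧ ∀ (X : Ω → EucSp d → EucSp d → ℝ) (K : ℝ≥0∞),
      NiceFam₂ ⌊θ⌋₊ X → (∀ y x z, R < ‖x‖ → X y x z = 0) → (∀ y x z, R < ‖z‖ → X y x z = 0) →
      (∀ n k x z, ∫⁻ y, ‖qblock M k (fun x => qblock M n (X y x) z) x‖ₑ ^ q ∂μ ≤
        K * (ENNReal.ofReal (2 ^ (-(α * q * n))) * ENNReal.ofReal (2 ^ (-(α * q * k))))) →
      ∫⁻ y, hsup₂ θ (X y) ^ q ∂μ ≤ C * K := by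
  obtain ⟨θ', h1, h2⟩ := exists_between hα
  have hq0 : 0 < q := by linarith
  obtain ⟨C, hC, h⟩ := exists_hsup₂_rpow_le hθ hq h1 hM
  have hS := tsum_two_rpow_neg_ne_top (δ := (α - θ') * q) (mul_pos (by linarith) hq0)
  set S := ∑' n : ℕ, ENNReal.ofReal (2 ^ (-((α - θ') * q * n)))
  set V := volume (Metric.closedBall (0 : EucSp d) (R + M))
  have hV : V ≠ ∞ := measure_closedBall_lt_top.ne
  refine ⟨C * (S * V * (S * V)), ENNReal.mul_ne_top hC (ENNReal.mul_ne_top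
    (ENNReal.mul_ne_top hS hV) (ENNReal.mul_ne_top hS hV)), fun X K hX hx₀ hz₀ hmom => ?_⟩
  have hw : ∀ n : ℕ, ENNReal.ofReal (2 ^ (θ' * q * n)) * ENNReal.ofReal (2 ^ (-(α * q * n))) =
      ENNReal.ofReal (2 ^ (-((α - θ') * q * n))) := fun n => ofReal_two_rpow_mul _ _ _ (by ring)
  set Q : ℕ → ℕ → Ω → EucSp d → EucSp d → ℝ≥0∞ := fun n k y z x =>
    ‖qblock M k (fun x => qblock M n (X y x) z) x‖ₑ ^ q with hQ
  have hcont : ∀ n k, Continuous fun w : (Ω × EucSp d) × EucSp d => Q n k w.1.1 w.1.2 w.2 := by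
    intro n k
    have c1 : Continuous fun w : (Ω × EucSp d) × EucSp d => qblock M n (X w.1.1 w.1.2) w.2 := by
      refine continuous_qblock_family (P := Ω × EucSp d) (f := fun w => X w.1 w.2) ?_ n
      exact hX.fst.continuous_uncurry.comp
        (by fun_prop : Continuous fun w : (Ω × EucSp d) × EucSp d => ((w.1.1, w.2), w.1.2))
    have c2 : Continuous fun w : (Ω × EucSp d) × EucSp d =>
        qblock M k (fun x => qblock M n (X w.1.1 x) w.1.2) w.2 := by
      refine continuous_qblock_family (P := Ω × EucSp d)
        (f := fun w x => qblock M n (X w.1 x) w.2) ?_ k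
      exact c1.comp
        (by fun_prop : Continuous fun w : (Ω × EucSp d) × EucSp d => ((w.1.1, w.2), w.1.2))
    exact ENNReal.continuous_rpow_const.comp c2.enorm
  have hm1 : ∀ n k, Measurable fun w : Ω × EucSp d => ∫⁻ x, Q n k w.1 w.2 x := fun n k =>
    (hcont n k).measurable.lintegral_prod_right'
  have hm2 : ∀ n, Measurable fun w : Ω × EucSp d =>
      ∑' k : ℕ, ENNReal.ofReal (2 ^ (θ' * q * k)) * ∫⁻ x, Q n k w.1 w.2 x := fun n =>
    Measurable.tsum fun k => (hm1 n k).const_mul _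
  have hm3 : ∀ n, Measurable fun y =>
      ∫⁻ z, ∑' k : ℕ, ENNReal.ofReal (2 ^ (θ' * q * k)) * ∫⁻ x, Q n k y z x := fun n =>
    (hm2 n).lintegral_prod_right'
  have hzero : ∀ n k y z x, R + M < ‖z‖ → Q n k y z x = 0 := by
    intro n k y z x hz
    simp only [hQ, fun x => qblock_eq_zero (M := M) (hz₀ y x) n hz, qblock_zero_fun, enorm_zero,
      ENNReal.zero_rpow_of_pos hq0]
  have hzero' : ∀ n k y z x, R + M < ‖x‖ → Q n k y z x = 0 := by
    intro n k y z x hx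
    have : ∀ x, R < ‖x‖ → qblock M n (X y x) z = 0 := fun x hx => by
      rw [show X y x = fun _ => 0 from funext fun z => hx₀ y x z hx, qblock_zero_fun]
    simp only [hQ, qblock_eq_zero (M := M) this k hx, enorm_zero, ENNReal.zero_rpow_of_pos hq0]
  -- The sum over blocks in `x` is first estimated with `n` and `z` fixed; the same argument is then
  -- repeated for the blocks in `z`.
  have hin : ∀ n z, ∫⁻ y, ∑' k : ℕ, ENNReal.ofReal (2 ^ (θ' * q * k)) * (∫⁻ x, Q n k y z x) ∂μ ≤
      K * ENNReal.ofReal (2 ^ (-(α * q * n))) * (S * V) := by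
    intro n z
    have hm : ∀ k, Measurable fun y => ∫⁻ x, Q n k y z x := fun k =>
      (hm1 n k).comp (by fun_prop : Measurable fun y : Ω => (y, z))
    have hc : ∀ k, Continuous fun w : Ω × EucSp d => Q n k w.1 z w.2 := fun k =>
      (hcont n k).comp (by fun_prop : Continuous fun w : Ω × EucSp d => ((w.1, z), w.2))
    rw [lintegral_tsum fun k => ((hm k).const_mul _).aemeasurable]
    calc ∑' k : ℕ, ∫⁻ y, ENNReal.ofReal (2 ^ (θ' * q * k)) * (∫⁻ x, Q n k y z x) ∂μ
        = ∑' k : ℕ, ENNReal.ofReal (2 ^ (θ' * q * k)) * ∫⁻ x, ∫⁻ y, Q n k y z x ∂μ := by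
          refine tsum_congr fun k => ?_
          rw [lintegral_const_mul _ (hm k), lintegral_lintegral_swap (hc k).aemeasurable]
      _ ≤ ∑' k : ℕ, ENNReal.ofReal (2 ^ (θ' * q * k)) *
          (K * (ENNReal.ofReal (2 ^ (-(α * q * n))) * ENNReal.ofReal (2 ^ (-(α * q * k)))) * V) := by
          refine ENNReal.tsum_le_tsum fun k => mul_le_mul' le_rfl
            (lintegral_le_mul_volume_closedBall (fun x hx => ?_) fun x => hmom n k x z)
          simp [fun y => hzero' n k y z x hx]
      _ = ∑' k : ℕ, ENNReal.ofReal (2 ^ (-((α - θ') * q * k))) *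
          (K * ENNReal.ofReal (2 ^ (-(α * q * n))) * V) := by
          refine tsum_congr fun k => ?_
          rw [← hw k]; ring
      _ = _ := by rw [ENNReal.tsum_mul_right]; ring
  calc ∫⁻ y, hsup₂ θ (X y) ^ q ∂μ
      ≤ ∫⁻ y, C * ∑' n : ℕ, ENNReal.ofReal (2 ^ (θ' * q * n)) *
          (∫⁻ z, ∑' k : ℕ, ENNReal.ofReal (2 ^ (θ' * q * k)) * ∫⁻ x, Q n k y z x) ∂μ :=
        lintegral_mono fun y => h (X y) (hX.comp (g := fun _ => y) continuous_const)
          ⟨R, hx₀ y⟩ ⟨R, hz₀ y⟩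
    _ = C * ∑' n : ℕ, ENNReal.ofReal (2 ^ (θ' * q * n)) *
          ∫⁻ z, ∫⁻ y, ∑' k : ℕ, ENNReal.ofReal (2 ^ (θ' * q * k)) * (∫⁻ x, Q n k y z x) ∂μ := by
        rw [lintegral_const_mul' _ _ hC, lintegral_tsum fun n => ((hm3 n).const_mul _).aemeasurable]
        congr 1
        refine tsum_congr fun n => ?_
        rw [lintegral_const_mul _ (hm3 n), lintegral_lintegral_swap (hm2 n).aemeasurable]
    _ ≤ C * ∑' n : ℕ, ENNReal.ofReal (2 ^ (θ' * q * n)) *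
          (K * ENNReal.ofReal (2 ^ (-(α * q * n))) * (S * V) * V) := by
        refine mul_le_mul' le_rfl (ENNReal.tsum_le_tsum fun n => mul_le_mul' le_rfl
          (lintegral_le_mul_volume_closedBall (fun z hz => ?_) (hin n)))
        simp [fun k y x => hzero n k y z x hz]
    _ = C * ∑' n : ℕ, ENNReal.ofReal (2 ^ (-((α - θ') * q * n))) * (S * V * V * K) := by
        congr 1
        refine tsum_congr fun n => ?_
        rw [← hw n]
        ring
    _ = C * (S * V * (S * V)) * K := by rw [ENNReal.tsum_mul_right]; ring

end RandomField

section Blocks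

variable {d M : ℕ} {g h : ℝ → EucSp d → ℝ} {A : ℝ}

lemma qblock_pathInt (hg : Continuous g.uncurry) (hA : ∀ u x, |g u x| ≤ A) (n : ℕ) (s t : ℝ)
    (x : EucSp d) : qblock M n (pathInt g s t) x = ∫ u in s..t, qblock M n (g u) x :=
  qblock_intervalIntegral hg (fun u _ x => hA u x) n x

/-- The variable `x` occurs only in the inner integral and `z` only in the outer factor, so each
block moves to its own factor. The outcome is an iterated integral of scalar functions, the form
required by the flow hypothesis. -/
lemma qblock_pathInt₂ (hg : Continuous g.uncurry) (hh : Continuous h.uncurry)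
    (hA : ∀ u x, |g u x| ≤ A) (hA' : ∀ u x, |h u x| ≤ A) (n k : ℕ) (s t : ℝ) (x z : EucSp d) :
    qblock M k (fun x => qblock M n (pathInt₂ g h s t x) z) x =
      ∫ r in s..t, (∫ u in s..r, qblock M k (g u) x) * qblock M n (h r) z := by
  have hA₀ : 0 ≤ A := (abs_nonneg _).trans (hA 0 0)
  have hG : Continuous fun w : ℝ × EucSp d => pathInt g s w.1 w.2 :=
    continuous_intervalIntegral_of_continuous (f := fun (w : ℝ × EucSp d) u => g u w.2)
      (hg.comp (by fun_prop : Continuous fun w : (ℝ × EucSp d) × ℝ => (w.2, w.1.2)))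
      continuous_const continuous_fst
  have hGb : ∀ r ∈ uIoc s t, ∀ x, |pathInt g s r x| ≤ A * |t - s| := by
    intro r hr x
    refine (intervalIntegral.norm_integral_le_of_norm_le_const
      (f := fun u => g u x) fun u _ => hA u x).trans ?_
    refine mul_le_mul_of_nonneg_left ?_ hA₀
    exact abs_sub_left_of_mem_uIcc (uIoc_subset_uIcc hr)
  have hq : Continuous fun w : ℝ × EucSp d => qblock M n (h w.1) w.2 := continuous_qblock_family hh n
  have hqz : Continuous fun r : ℝ => qblock M n (h r) z :=
    hq.comp (by fun_prop : Continuous fun r : ℝ => (r, z))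
  have e1 : ∀ x, qblock M n (pathInt₂ g h s t x) z =
      ∫ r in s..t, pathInt g s r x * qblock M n (h r) z := by
    intro x
    have := qblock_intervalIntegral (M := M) (f := fun r z => pathInt g s r x * h r z) (a := s)
      (b := t) (A := A * |t - s| * A) ?_ ?_ n z
    · simp only [qblock_const_mul] at this; exact this
    · exact (hG.comp (by fun_prop : Continuous fun w : ℝ × EucSp d => (w.1, x))).mul hh
    · intro r hr z
      rw [abs_mul]
      exact mul_le_mul (hGb r hr x) (hA' r z) (abs_nonneg _) (by positivity)
  simp only [e1]
  obtain ⟨B, hB⟩ := (isCompact_uIcc (a := s) (b := t)).image hqz |>.isBounded.exists_norm_le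
  have := qblock_intervalIntegral (M := M)
    (f := fun r x => qblock M n (h r) z * pathInt g s r x) (a := s)
    (b := t) (A := B * (A * |t - s|)) ?_ ?_ k x
  · simp only [qblock_const_mul, qblock_pathInt hg hA] at this
    simp only [mul_comm (pathInt g s _ _), this]
    simp only [mul_comm (qblock M n (h _) z)]
  · exact (hqz.comp continuous_fst).mul hG
  · intro r hr x
    have hBr := hB _ (mem_image_of_mem _ (uIoc_subset_uIcc hr))
    rw [abs_mul]
    exact mul_le_mul hBr (hGb r hr x) (abs_nonneg _) ((norm_nonneg _).trans hBr)

end Blocks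
end

noncomputable section

/-! ### Moments of the increments of the rescaled path. -/

section FastVelocity

variable {d : ℕ} {Ω : Type*} [MetricSpace Ω] {α κ A θ : ℝ} {f f' : Ω → EucSp d → ℝ}

/-- The velocity of the rescaled path driven by the observable `f`. -/
def fastVel (φ : Flow ℝ Ω) (ε : ℝ) (f : Ω → EucSp d → ℝ) (y : Ω) (r : ℝ) (x : EucSp d) : ℝ :=
  ε⁻¹ * f (φ (r / ε ^ 2) y) x

lemma MixedBound.niceFam_fastVel (hf : MixedBound α κ A f) (hκ : 0 < κ) (hθ : θ ≤ α)
    (φ : Flow ℝ Ω) (ε : ℝ) : NiceFam ⌊θ⌋₊ fun w : Ω × ℝ => fastVel φ ε f w.1 w.2 :=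
  (((hf.niceFam hκ).mono (Nat.floor_le_floor hθ)).comp ((continuous_flow_uncurry φ).comp
    (by fun_prop : Continuous fun w : Ω × ℝ => (w.2 / ε ^ 2, w.1)))).const_mul
    (c := fun _ => ε⁻¹) continuous_const

lemma MixedBound.niceFam_fastVel_time (hf : MixedBound α κ A f) (hκ : 0 < κ) (hθ : θ ≤ α)
    (φ : Flow ℝ Ω) (ε : ℝ) (y : Ω) : NiceFam ⌊θ⌋₊ (fastVel φ ε f y) :=
  (hf.niceFam_fastVel hκ hθ φ ε).comp (by fun_prop : Continuous fun r : ℝ => (y, r))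

lemma MixedBound.abs_fastVel_le (hf : MixedBound α κ A f) (φ : Flow ℝ Ω) (ε : ℝ) (y : Ω) (r : ℝ)
    (x : EucSp d) : |fastVel φ ε f y r x| ≤ |ε⁻¹| * A := by
  rw [fastVel, abs_mul]
  exact mul_le_mul_of_nonneg_left (hf.bound [] (by simp) x _) (abs_nonneg _)

lemma MixedBound.abs_ev_fastVel_le (hf : MixedBound α κ A f) (hA : 0 ≤ A) (hθ₀ : 0 ≤ θ)
    (hθ : θ < α) (φ : Flow ℝ Ω) (ε : ℝ) (y : Ω) (r : ℝ) {l : HFun d} (hl : l.Adm θ) :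
    |l.ev (fastVel φ ε f y r)| ≤ |ε⁻¹| * (2 * A + d * A) := by
  have : l.ev (fastVel φ ε f y r) = ε⁻¹ * l.ev (f (φ (r / ε ^ 2) y)) := l.ev_const_mul _ _
  rw [this, abs_mul]
  exact mul_le_mul_of_nonneg_left (hf.abs_ev_le hA hθ₀ hθ _ hl) (abs_nonneg _)

lemma pathInt_fastVel_eq_zero {R : ℝ} (hf : ∀ y x, R < ‖x‖ → f y x = 0) (φ : Flow ℝ Ω) (ε : ℝ)
    (y : Ω) (s t : ℝ) {x : EucSp d} (hx : R < ‖x‖) : pathInt (fastVel φ ε f y) s t x = 0 := by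
  simp [pathInt, fastVel, hf _ x hx]

lemma pathInt₂_fastVel_eq_zero_left {R : ℝ} (hf : ∀ y x, R < ‖x‖ → f y x = 0) (φ : Flow ℝ Ω)
    (ε : ℝ) (y : Ω) (s t : ℝ) {x : EucSp d} (hx : R < ‖x‖) (z : EucSp d) :
    pathInt₂ (fastVel φ ε f y) (fastVel φ ε f' y) s t x z = 0 := by
  simp [pathInt₂, pathInt_fastVel_eq_zero hf φ ε y s _ hx]

lemma pathInt₂_fastVel_eq_zero_right {R : ℝ} (hf' : ∀ y x, R < ‖x‖ → f' y x = 0) (φ : Flow ℝ Ω)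
    (ε : ℝ) (y : Ω) (s t : ℝ) (x : EucSp d) {z : EucSp d} (hz : R < ‖z‖) :
    pathInt₂ (fastVel φ ε f y) (fastVel φ ε f' y) s t x z = 0 := by
  simp [pathInt₂, fastVel, hf' _ z hz]

lemma MixedBound.niceFam_pathInt_fastVel (hf : MixedBound α κ A f) (hκ : 0 < κ) (hθ : θ ≤ α)
    (φ : Flow ℝ Ω) (ε s t : ℝ) : NiceFam ⌊θ⌋₊ fun y => pathInt (fastVel φ ε f y) s t :=
  (hf.niceFam_fastVel hκ hθ φ ε).pathInt_family.comp (by fun_prop : Continuous fun y : Ω => (y, s, t))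

lemma MixedBound.niceFam_pathInt₂_fastVel (hf : MixedBound α κ A f) (hf' : MixedBound α κ A f')
    (hκ : 0 < κ) (hθ : θ ≤ α) (φ : Flow ℝ Ω) (ε s t : ℝ) :
    NiceFam₂ ⌊θ⌋₊ fun y => pathInt₂ (fastVel φ ε f y) (fastVel φ ε f' y) s t :=
  ((hf.niceFam_fastVel hκ hθ φ ε).pathInt₂_family (hf'.niceFam_fastVel hκ hθ φ ε)).comp
    (by fun_prop : Continuous fun y : Ω => (y, s, t))

section Moments

variable [SecondCountableTopology Ω] [MeasurableSpace Ω] [BorelSpace Ω] {φ : Flow ℝ Ω}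
  {μ : Measure Ω} [IsProbabilityMeasure μ] {p R : ℝ}

lemma two_rpow_decay_rpow {C a q : ℝ} (hC : 0 ≤ C) (n : ℕ) :
    (C * 2 ^ (-(a * n))) ^ q = C ^ q * 2 ^ (-(a * q * n)) := by
  rw [Real.mul_rpow hC (by positivity), ← Real.rpow_mul (by norm_num)]
  congr 2; ring

/-- The blocks of the vector field at a point are observables of size `O(2^{-αn})`, so the
homogeneous moment bound provides the decay that the criterion for random fields demands. With `q =
2p` the spatial loss is only `d/(2p)`. -/
lemma exists_lintegral_hsup_fastVel_le (hμ : ∀ t, MeasurePreserving (φ t) μ μ) (hp : 1 < p)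
    (hκ : 0 < κ) (hmom : FlowMoments φ μ κ p) (hθ : 0 ≤ θ) (hα : θ + d / p < α)
    (hf : MixedBound α κ A f) (hmean : ∀ x, ∫ y, f y x ∂μ = 0)
    (hsupp : ∀ y x, R < ‖x‖ → f y x = 0) :
    ∃ C : ℝ≥0∞, C ≠ ∞ ∧ ∀ ε : ℝ, 0 < ε → ∀ s t : ℝ, s ≤ t →
      ∫⁻ y, hsup θ (pathInt (fastVel φ ε f y) s t) ^ (2 * p) ∂μ ≤
        C * ENNReal.ofReal ((t - s) ^ p) := by
  have hdp : (0 : ℝ) ≤ d / p := by positivity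
  have hdp' : (d : ℝ) / (2 * p) ≤ d / p := by gcongr; linarith
  have hα₀ : 0 ≤ α := by linarith
  obtain ⟨B, hB, hball⟩ := hf.exists_holderBall_qblock hα₀ hκ hmean
  obtain ⟨K, hK, hfast, -⟩ := hmom.exists_fast hp.le hκ hμ
  obtain ⟨C, hC, h⟩ := exists_lintegral_hsup_rpow_le (d := d) (μ := μ) (M := ⌊α⌋₊ + 1) hθ
    (q := 2 * p) (by linarith) (by linarith : θ + d / (2 * p) < α) (by omega) R
  refine ⟨C * (K * ENNReal.ofReal (B ^ (2 * p))), ENNReal.mul_ne_top hC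
    (ENNReal.mul_ne_top hK ENNReal.ofReal_ne_top), fun ε hε s t hst => ?_⟩
  have hts : 0 ≤ (t - s) ^ p := Real.rpow_nonneg (by linarith) _
  have hBp : 0 ≤ B ^ (2 * p) := by positivity
  refine (h (fun y => pathInt (fastVel φ ε f y) s t)
    (K * (ENNReal.ofReal (B ^ (2 * p)) * ENNReal.ofReal ((t - s) ^ p)))
    (hf.niceFam_pathInt_fastVel hκ (by linarith) φ ε s t)
    (fun y x hx => pathInt_fastVel_eq_zero hsupp φ ε y s t hx) fun n x => ?_).trans_eq (by ring)
  have e : ∀ y, qblock (⌊α⌋₊ + 1) n (pathInt (fastVel φ ε f y) s t) x =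
      ε⁻¹ * ∫ r in s..t, qblock (⌊α⌋₊ + 1) n (f (φ (r / ε ^ 2) y)) x := by
    intro y
    rw [qblock_pathInt (hf.niceFam_fastVel_time (θ := θ) hκ (by linarith) φ ε y).continuous_uncurry
      (hf.abs_fastVel_le φ ε y), ← intervalIntegral.integral_const_mul]
    exact intervalIntegral.integral_congr fun r _ => qblock_const_mul _ _ _ _
  simp only [e]
  refine (hfast _ _ (hball n x) ε hε s t hst).trans_eq ?_
  rw [two_rpow_decay_rpow hB, mul_assoc K, ← ENNReal.ofReal_mul hBp,
    ← ENNReal.ofReal_mul (by positivity)]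
  congr 2; ring

/-- The iterated integral has only `p` moments, so the spatial loss is the full `d/p` in each
variable. -/
lemma exists_lintegral_hsup₂_fastVel_le (hμ : ∀ t, MeasurePreserving (φ t) μ μ) (hp : 1 < p)
    (hκ : 0 < κ) (hmom : FlowMoments φ μ κ p) (hθ : 0 ≤ θ) (hα : θ + d / p < α)
    (hf : MixedBound α κ A f) (hmean : ∀ x, ∫ y, f y x ∂μ = 0)
    (hsupp : ∀ y x, R < ‖x‖ → f y x = 0)
    (hf' : MixedBound α κ A f') (hmean' : ∀ x, ∫ y, f' y x ∂μ = 0)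
    (hsupp' : ∀ y x, R < ‖x‖ → f' y x = 0) :
    ∃ C : ℝ≥0∞, C ≠ ∞ ∧ ∀ ε : ℝ, 0 < ε → ∀ s t : ℝ, s ≤ t →
      ∫⁻ y, hsup₂ θ (pathInt₂ (fastVel φ ε f y) (fastVel φ ε f' y) s t) ^ p ∂μ ≤
        C * ENNReal.ofReal ((t - s) ^ p) := by
  have hdp : (0 : ℝ) ≤ d / p := by positivity
  have hα₀ : 0 ≤ α := by linarith
  obtain ⟨B, hB, hball⟩ := hf.exists_holderBall_qblock hα₀ hκ hmean
  obtain ⟨B', hB', hball'⟩ := hf'.exists_holderBall_qblock hα₀ hκ hmean'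
  obtain ⟨K, hK, -, hfast⟩ := hmom.exists_fast hp.le hκ hμ
  obtain ⟨C, hC, h⟩ := exists_lintegral_hsup₂_rpow_le (d := d) (μ := μ) (M := ⌊α⌋₊ + 1) hθ
    hp hα (by omega) R
  refine ⟨C * (K * ENNReal.ofReal (B ^ p * B' ^ p)), ENNReal.mul_ne_top hC
    (ENNReal.mul_ne_top hK ENNReal.ofReal_ne_top), fun ε hε s t hst => ?_⟩
  have hts : 0 ≤ (t - s) ^ p := Real.rpow_nonneg (by linarith) _
  have hBp : 0 ≤ B ^ p * B' ^ p := by positivity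
  refine (h (fun y => pathInt₂ (fastVel φ ε f y) (fastVel φ ε f' y) s t)
    (K * (ENNReal.ofReal (B ^ p * B' ^ p) * ENNReal.ofReal ((t - s) ^ p)))
    (hf.niceFam_pathInt₂_fastVel hf' hκ (by linarith) φ ε s t)
    (fun y x z hx => pathInt₂_fastVel_eq_zero_left hsupp φ ε y s t hx z)
    (fun y x z hz => pathInt₂_fastVel_eq_zero_right hsupp' φ ε y s t x hz)
    fun n k x z => ?_).trans_eq (by ring)
  have e : ∀ y, qblock (⌊α⌋₊ + 1) k (fun x => qblock (⌊α⌋₊ + 1) n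
      (pathInt₂ (fastVel φ ε f y) (fastVel φ ε f' y) s t x) z) x =
      (ε ^ 2)⁻¹ * ∫ r in s..t, (∫ u in s..r, qblock (⌊α⌋₊ + 1) k (f (φ (u / ε ^ 2) y)) x) *
        qblock (⌊α⌋₊ + 1) n (f' (φ (r / ε ^ 2) y)) z := by
    intro y
    rw [qblock_pathInt₂
      (hf.niceFam_fastVel_time (θ := θ) hκ (by linarith) φ ε y).continuous_uncurry
      (hf'.niceFam_fastVel_time (θ := θ) hκ (by linarith) φ ε y).continuous_uncurry
      (hf.abs_fastVel_le φ ε y) (hf'.abs_fastVel_le φ ε y), ← intervalIntegral.integral_const_mul]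
    refine intervalIntegral.integral_congr fun r _ => ?_
    have e1 : ∀ (f : Ω → EucSp d → ℝ) n r x, qblock (⌊α⌋₊ + 1) n (fastVel φ ε f y r) x =
        ε⁻¹ * qblock (⌊α⌋₊ + 1) n (f (φ (r / ε ^ 2) y)) x := fun f n r x => qblock_const_mul _ _ _ _
    simp only [e1, intervalIntegral.integral_const_mul]
    rw [sq, mul_inv]; ring
  simp only [e]
  refine (hfast _ _ _ _ (hball k x) (hball' n z) ε hε s t hst).trans_eq ?_
  rw [two_rpow_decay_rpow hB, two_rpow_decay_rpow hB', mul_assoc K, ← ENNReal.ofReal_mul hBp,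
    ← ENNReal.ofReal_mul (by positivity), ← ENNReal.ofReal_mul (by positivity)]
  congr 2; ring

end Moments

end FastVelocity
end

noncomputable section

/-! ### Summation over dyadic times and conclusion. -/

section Assembly

variable {d : ℕ} {Ω : Type*} [MetricSpace Ω] {α κ A θ γ T : ℝ} {b : EucSp d → Ω → EucSp d}

lemma MemMixedHolder.exists_mixedBound (hb : MemMixedHolder α κ b) :
    ∃ A : ℝ, 0 ≤ A ∧ ∀ i, MixedBound α κ A fun y x => b x y i := by
  choose B hB h using fun i => _root_.exists_mixedBound (hb i).1 (hb i).2
  exact ⟨∑ i, B i, Finset.sum_nonneg fun i _ => hB i, fun i =>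
    (h i).mono (Finset.single_le_sum (fun j _ => hB j) (Finset.mem_univ i))⟩

lemma isLift_fastVel (hb : ∀ i, MixedBound α κ A fun y x => b x y i) (hκ : 0 < κ) (φ : Flow ℝ Ω)
    (ε : ℝ) (y : Ω) : IsLift (fun i => fastVel φ ε (fun y x => b x y i) y) (pathW φ b ε y)
      (pathWW φ b ε y) := by
  constructor
  · intro t x i
    have hc : Continuous fun r => b x (fastTraj φ ε y r) := by
      have : Continuous fun r => WithLp.toLp 2 fun i => b x (fastTraj φ ε y r) i := by
        refine (PiLp.continuous_toLp 2 _).comp (continuous_pi fun i => ?_)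
        exact ((hb i).niceFam hκ).continuous_uncurry.comp ((continuous_flow_time φ y).comp
          (by fun_prop : Continuous fun r : ℝ => r / ε ^ 2) |>.prodMk continuous_const)
      exact this
    have h1 := (EuclideanSpace.proj (𝕜 := ℝ) i : EucSp d →L[ℝ] ℝ).intervalIntegral_comp_comm
      (hc.intervalIntegrable (μ := volume) 0 t)
    simp only [EuclideanSpace.coe_proj] at h1
    simp only [pathW, PiLp.smul_apply, smul_eq_mul, pathInt, fastVel,
      intervalIntegral.integral_const_mul]
    exact congrArg (ε⁻¹ * ·) h1.symm
  · intro t i j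
    funext x z
    simp only [pathWW, pathInt₂, pathInt, fastVel, fastTraj, intervalIntegral.integral_mul_const,
      intervalIntegral.integral_const_mul]
    rw [← intervalIntegral.integral_const_mul]
    refine intervalIntegral.integral_congr fun r _ => ?_
    simp only [sq, mul_inv]; ring

lemma lowerSemicontinuous_roughSup {N : Ω → ℝ → ℝ → ℝ≥0∞} {β : ℝ}
    (hN : ∀ s t, LowerSemicontinuous fun y => N y s t) :
    LowerSemicontinuous fun y => ⨆ (s ∈ Icc 0 T) (t ∈ Icc 0 T) (_ : s ≠ t),
      N y s t / ENNReal.ofReal (|t - s| ^ β) := by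
  refine lowerSemicontinuous_iSup fun s => lowerSemicontinuous_iSup fun _ =>
    lowerSemicontinuous_iSup fun t => lowerSemicontinuous_iSup fun _ =>
    lowerSemicontinuous_iSup fun hst => (hN s t).ennreal_div_const ?_
  have : 0 < |t - s| ^ β := Real.rpow_pos_of_pos (abs_pos.mpr (sub_ne_zero.mpr (Ne.symm hst))) _
  simpa using this

/-- At fixed times the increments depend continuously on the initial condition, with their
derivatives. The norm is thus built from lower semicontinuous functions, even with a supremum over
all pairs of times. -/
lemma measurable_roughNorm_fast [MeasurableSpace Ω] [OpensMeasurableSpace Ω]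
    (hb : ∀ i, MixedBound α κ A fun y x => b x y i) (hκ : 0 < κ)
    (hθ : θ ≤ α) (φ : Flow ℝ Ω) (ε : ℝ) :
    Measurable fun y => roughNorm θ γ T (pathW φ b ε y) (pathWW φ b ε y) := by
  have hL := isLift_fastVel hb hκ φ ε
  have hg := fun y i => (hb i).niceFam_fastVel_time hκ hθ φ ε y
  refine Measurable.add (LowerSemicontinuous.measurable (lowerSemicontinuous_roughSup fun s t => ?_))
    (LowerSemicontinuous.measurable (lowerSemicontinuous_roughSup
      (N := fun y s t => tensorNorm θ (incr₂ (pathW φ b ε y) (pathWW φ b ε y) s t) ^ (1 / 2 : ℝ))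
      fun s t => ?_))
  · simp only [holderNormVec, fun y => (hL y).incr_eq (hg y) s t]
    exact lowerSemicontinuous_sum fun i _ =>
      lowerSemicontinuous_holderNorm ((hb i).niceFam_pathInt_fastVel hκ hθ φ ε s t)
  · refine ENNReal.continuous_rpow_const.comp_lowerSemicontinuous ?_
      fun _ _ h => ENNReal.rpow_le_rpow h (by norm_num)
    simp only [tensorNorm, fun y => (hL y).incr₂_eq (hg y) s t]
    exact lowerSemicontinuous_sum fun i _ => lowerSemicontinuous_sum fun j _ =>
      ((hb i).niceFam_pathInt₂_fastVel (hb j) hκ hθ φ ε s t).lowerSemicontinuous_holderNorm₂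

lemma dyadicPt_succ_sub (k n : ℕ) :
    dyadicPt T k (n + 1) - dyadicPt T k n = T * 2 ^ (-(k : ℝ)) := by
  simp only [dyadicPt]
  rw [Real.rpow_neg (by norm_num), Real.rpow_natCast]
  push_cast; ring

variable [SecondCountableTopology Ω] [MeasurableSpace Ω] [BorelSpace Ω] {φ : Flow ℝ Ω}
  {μ : Measure Ω} [IsProbabilityMeasure μ] {p R : ℝ}

/-- The moments of the increments over dyadic intervals control those of the rough path norm. -/
lemma exists_lintegral_roughNorm_le (hμ : ∀ t, MeasurePreserving (φ t) μ μ) (hp : 1 < p)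
    (hκ : 0 < κ) (hmom : FlowMoments φ μ κ p) (hθ : 0 ≤ θ) (hα : θ + d / p < α)
    (hγ₀ : 0 < γ) (hγ₁ : γ < 1 / 2 - 1 / (2 * p)) (hT : 0 < T) (hA : 0 ≤ A)
    (hb : ∀ i, MixedBound α κ A fun y x => b x y i) (hmean : ∀ x i, ∫ y, b x y i ∂μ = 0)
    (hsupp : ∀ x y, R < ‖x‖ → b x y = 0) :
    ∃ C : ℝ≥0∞, C ≠ ∞ ∧ ∀ ε : ℝ, 0 < ε →
      ∫⁻ y, roughNorm θ γ T (pathW φ b ε y) (pathWW φ b ε y) ^ (2 * p) ∂μ ≤ C := by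
  have hdp : (0 : ℝ) ≤ d / p := by positivity
  have hp0 : 0 < p := by linarith
  have hθα : θ ≤ α := by linarith
  have hsupp' : ∀ i (y : Ω) x, R < ‖x‖ → b x y i = 0 := fun i y x hx => by simp [hsupp x y hx]
  choose C hC h1 using fun i => exists_lintegral_hsup_fastVel_le hμ hp hκ hmom hθ hα (hb i)
    (fun x => hmean x i) (hsupp' i)
  choose D hD h2 using fun i j => exists_lintegral_hsup₂_fastVel_le hμ hp hκ hmom hθ hα (hb i)
    (fun x => hmean x i) (hsupp' i) (hb j) (fun x => hmean x j) (hsupp' j)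
  obtain ⟨K, hK, hrough⟩ := exists_roughNorm_rpow_le d θ (p := p) hT hγ₀ hp0
  set B : ℝ≥0∞ := ∑ i, C i + 2 ^ p * ∑ i, ∑ j, D i j with hBdef
  have h2p : (2 : ℝ≥0∞) ^ p ≠ ∞ := ENNReal.rpow_ne_top_of_nonneg hp0.le (by simp)
  have hB : B ≠ ∞ := ENNReal.add_ne_top.mpr ⟨ENNReal.sum_ne_top.mpr fun i _ => hC i,
    ENNReal.mul_ne_top h2p (ENNReal.sum_ne_top.mpr fun i _ => ENNReal.sum_ne_top.mpr fun j _ => hD i j)⟩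
  -- Level `k` has `2^k` intervals, each with weight `2^{2pγk}` and moment of order `2^{-pk}`, so it
  -- contributes `2^{-(p-1-2pγ)k}`. Positivity of this exponent is the upper bound on `γ`.
  have hδ : 0 < p - 1 - γ * (2 * p) := by
    have : γ * (2 * p) < (1 / 2 - 1 / (2 * p)) * (2 * p) := by gcongr
    have e : (1 / 2 - 1 / (2 * p)) * (2 * p) = p - 1 := by field_simp
    linarith
  have hS := tsum_two_rpow_neg_ne_top hδ
  set S := ∑' n : ℕ, ENNReal.ofReal (2 ^ (-((p - 1 - γ * (2 * p)) * n)))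
  refine ⟨K * (S * (B * ENNReal.ofReal (T ^ p))), ENNReal.mul_ne_top hK (ENNReal.mul_ne_top hS
    (ENNReal.mul_ne_top hB ENNReal.ofReal_ne_top)), fun ε hε => ?_⟩
  set g : Ω → Fin d → ℝ → EucSp d → ℝ := fun y i => fastVel φ ε (fun y x => b x y i) y with hg
  set F : ℝ → ℝ → Ω → ℝ≥0∞ := fun s t y => ∑ i, hsup θ (pathInt (g y i) s t) ^ (2 * p) +
    2 ^ p * ∑ i, ∑ j, hsup₂ θ (pathInt₂ (g y i) (g y j) s t) ^ p with hF
  have m1 : ∀ s t i, Measurable fun y => hsup θ (pathInt (g y i) s t) ^ (2 * p) := fun s t i =>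
    (lowerSemicontinuous_hsup
      ((hb i).niceFam_pathInt_fastVel hκ hθα φ ε s t)).measurable.pow_const _
  have m2 : ∀ s t i j, Measurable fun y => hsup₂ θ (pathInt₂ (g y i) (g y j) s t) ^ p :=
    fun s t i j => ((hb i).niceFam_pathInt₂_fastVel (hb j) hκ hθα φ ε s
      t).lowerSemicontinuous_hsup₂.measurable.pow_const _
  have hFm : ∀ s t, Measurable (F s t) := fun s t => by
    have := m1 s t
    have := m2 s t
    fun_prop
  have hFle : ∀ s t, s ≤ t → ∫⁻ y, F s t y ∂μ ≤ B * ENNReal.ofReal ((t - s) ^ p) := by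
    intro s t hst
    have m3 : Measurable fun y => ∑ i, hsup θ (pathInt (g y i) s t) ^ (2 * p) :=
      Finset.measurable_sum _ fun i _ => m1 s t i
    simp only [hF]
    rw [lintegral_add_left m3, lintegral_const_mul' _ _ h2p, lintegral_finsetSum _ fun i _ => m1 s t i,
      lintegral_finsetSum _ fun i _ => Finset.measurable_sum _ fun j _ => m2 s t i j, hBdef, add_mul,
      Finset.sum_mul, mul_assoc, Finset.sum_mul]
    refine add_le_add (Finset.sum_le_sum fun i _ => h1 i ε hε s t hst)
      (mul_le_mul' le_rfl (Finset.sum_le_sum fun i _ => ?_))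
    rw [lintegral_finsetSum _ fun j _ => m2 s t i j, Finset.sum_mul]
    exact Finset.sum_le_sum fun j _ => h2 i j ε hε s t hst
  calc ∫⁻ y, roughNorm θ γ T (pathW φ b ε y) (pathWW φ b ε y) ^ (2 * p) ∂μ
      ≤ ∫⁻ y, K * ∑' k : ℕ, ∑ n ∈ Finset.range (2 ^ k),
          ENNReal.ofReal (2 ^ (γ * (2 * p) * k)) * F (dyadicPt T k n) (dyadicPt T k (n + 1)) y ∂μ := by
        refine lintegral_mono fun y => hrough (g y) _ _ (isLift_fastVel hb hκ φ ε y)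
          (fun i => (hb i).niceFam_fastVel_time hκ hθα φ ε y) ⟨|ε⁻¹| * (2 * A + d * A), by positivity,
            fun i l r hl => ?_⟩
        exact (hb i).abs_ev_fastVel_le hA hθ (by linarith) φ ε y r hl
    _ = K * ∑' k : ℕ, ∑ n ∈ Finset.range (2 ^ k), ENNReal.ofReal (2 ^ (γ * (2 * p) * k)) *
          ∫⁻ y, F (dyadicPt T k n) (dyadicPt T k (n + 1)) y ∂μ := by
        rw [lintegral_const_mul' _ _ hK, lintegral_tsum fun k =>
          (Finset.measurable_sum _ fun n _ => (hFm _ _).const_mul _).aemeasurable]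
        congr 1
        refine tsum_congr fun k => ?_
        rw [lintegral_finsetSum _ fun n _ => (hFm _ _).const_mul _]
        exact Finset.sum_congr rfl fun n _ => lintegral_const_mul _ (hFm _ _)
    _ ≤ K * ∑' k : ℕ, ENNReal.ofReal (2 ^ (-((p - 1 - γ * (2 * p)) * k))) *
          (B * ENNReal.ofReal (T ^ p)) := by
        refine mul_le_mul' le_rfl (ENNReal.tsum_le_tsum fun k => ?_)
        refine (Finset.sum_le_card_nsmul _ _ (ENNReal.ofReal (2 ^ (γ * (2 * p) * k)) *
          (B * ENNReal.ofReal ((T * 2 ^ (-(k : ℝ))) ^ p))) fun n _ => ?_).trans_eq ?_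
        · refine mul_le_mul' le_rfl ?_
          rw [← dyadicPt_succ_sub (T := T) k n]
          refine hFle _ _ (sub_nonneg.mp ?_)
          rw [dyadicPt_succ_sub]
          positivity
        · have e : (2 : ℝ≥0∞) ^ k * (ENNReal.ofReal (2 ^ (γ * (2 * p) * k)) *
              ENNReal.ofReal (2 ^ (-(k : ℝ) * p))) =
              ENNReal.ofReal (2 ^ (-((p - 1 - γ * (2 * p)) * k))) := by
            rw [ofReal_two_rpow_mul _ _ _ rfl, ← ENNReal.ofReal_ofNat, ← ENNReal.ofReal_pow (by norm_num),
              ← Real.rpow_natCast]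
            exact ofReal_two_rpow_mul _ _ _ (by ring)
          rw [Finset.card_range, nsmul_eq_mul, Real.mul_rpow hT.le (by positivity),
            ← Real.rpow_mul (by norm_num), ENNReal.ofReal_mul (by positivity), ← e]
          push_cast
          ring
    _ = K * (S * (B * ENNReal.ofReal (T ^ p))) := by rw [ENNReal.tsum_mul_right]

end Assembly
end

theorem mainTheorem6 {Ω : Type*} [MetricSpace Ω] [SecondCountableTopology Ω]
    [MeasurableSpace Ω] [BorelSpace Ω]
    (φ : Flow ℝ Ω) (μ : Measure Ω) [IsProbabilityMeasure μ]
    (hμ : ∀ t, MeasurePreserving (φ t) μ μ)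
    (d : ℕ) (p κ α θ γ T : ℝ) (hp : 3 < p) (hκ₀ : 0 < κ) (hκ₁ : κ < 1)
    (hmom : FlowMoments φ μ κ p)
    (hθ : 2 + 2 / (p - 1) < θ) (hα : θ + d / p < α)
    (hγ₀ : 1 / 3 < γ) (hγ₁ : γ < 1 / 2 - 1 / (2 * p)) (hT : 0 < T)
    (b : EucSp d → Ω → EucSp d) (hb : MemMixedHolder α κ b)
    (hb₀ : ∀ x, ∫ y, b x y ∂μ = 0)
    (hsupp : ∃ R : ℝ, 0 < R ∧ ∀ x y, R < ‖x‖ → b x y = 0) :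
    (∀ ε : ℝ, 0 < ε → ∀ y, IsRoughPath θ γ T (pathW φ b ε y) (pathWW φ b ε y)) ∧
    (∀ ε : ℝ, 0 < ε →
      Measurable (fun y => roughNorm θ γ T (pathW φ b ε y) (pathWW φ b ε y))) ∧
    (⨆ (ε : ℝ) (_ : 0 < ε),
      ∫⁻ y, roughNorm θ γ T (pathW φ b ε y) (pathWW φ b ε y) ^ (2 * p) ∂μ) < ∞ := by
  obtain ⟨R, -, hR⟩ := hsupp
  obtain ⟨A, hA, hbA⟩ := hb.exists_mixedBound
  have hp1 : 0 < p - 1 := by linarith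
  have hθ₀ : 0 ≤ θ := by
    have : 0 < 2 / (p - 1) := by positivity
    linarith
  have hdp : (0 : ℝ) ≤ d / p := by positivity
  have hθα : θ < α := by linarith
  have hγ : 2 * γ ≤ 1 := by
    have : 0 < 1 / (2 * p) := by positivity
    linarith
  -- The vector-valued mean is read coordinatewise, which needs each coordinate integrable;
  -- boundedness and continuity in `y` ensure this.
  have hmean : ∀ x i, ∫ y, b x y i ∂μ = 0 := by
    intro x i
    rw [← eval_integral_piLp (f := fun y => b x y) fun i => ?_, hb₀ x]
    · rfl
    · refine Integrable.of_bound (C := A) ?_ (Eventually.of_forall fun y =>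
        (hbA i).bound [] (by simp) x y)
      exact (((hbA i).niceFam hκ₀).continuous_uncurry.comp
        (by fun_prop : Continuous fun y : Ω => (y, x))).aestronglyMeasurable
  refine ⟨fun ε _ y => ?_, fun ε _ => measurable_roughNorm_fast hbA hκ₀ hθα.le φ ε, ?_⟩
  · exact (isLift_fastVel hbA hκ₀ φ ε y).isRoughPath
      (fun i => (hbA i).niceFam_fastVel_time hκ₀ hθα.le φ ε y)
      (A := |ε⁻¹| * (2 * A + d * A)) (by positivity)
      (fun i l r hl => (hbA i).abs_ev_fastVel_le hA hθ₀ hθα φ ε y r hl) hγ (by linarith)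
  · obtain ⟨C, hC, h⟩ := exists_lintegral_roughNorm_le hμ (by linarith) hκ₀ hmom hθ₀ hα
      (by linarith) hγ₁ hT hA hbA hmean hR
    exact (iSup₂_le h).trans_lt hC.lt_top
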